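/- Let $M$ be a smooth $n$-dimensional manifold, $I\subset\mathbb R$ a (nondegenerate) interval and $X:M\times I\to\mathbb R^{n+1}$ a smooth solution of mean curvature flow: each $X_t=X(\cdot,t)$ is an immersion and $\partial_tX=\vec H$, where $\vec H=\Delta X$ and $\Delta$ is the Laplace–Beltrami operator of the metric $g_t$ induced by $X_t$. Let $\nu$ be a smooth unit normal field along $X$, let $A(u,v)=\langle D_u\nu,D_vX\rangle$ be the corresponding Weingarten tensor, $H=-\langle\vec H,\nu\rangle$ the mean curvature, and $\mu_t$ the area measure of $X_t$. Let $\mathcal S(n)$ be the space of self-adjoint endomorphisms of $\mathbb R^n$ with the norm $|W|^2=\operatorname{tr}(W^2)$, and let $\Gamma\subset\mathcal S(n)$ be a nonempty, proper, closed, convex cone (invariant under scaling by positive numbers) that is $O(n)$-invariant (invariant under conjugation by orthogonal matrices). Let $d_\Gamma$ be the signed distance to $\partial\Gamma$: $d_\Gamma(W)=\operatorname{dist}(W,\mathcal S(n)\setminus\Gamma)$ if $W\in\Gamma$ and $d_\Gamma(W)=-\operatorname{dist}(W,\Gamma)$ otherwise. Then the function $G:M\times I\to\mathbb R$, $G(x,t):=d_\Gamma(A_{(x,t)})$,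 where $A_{(x,t)}$ is read in an orthonormal basis of $(T_xM,g_t)$, does not depend on the choice of that basis, and satisfies $$(\partial_t-\Delta)G\ge |A|^2G$$ in both of the following senses. (i) Viscosity sense: let $(x_0,t_0)\in M\times I$, let $U\ni x_0$ be open and $r>0$ with $(t_0-r,t_0]\subset I$. If $\varphi$ is smooth on $U\times(t_0-r,t_0]$, $\varphi\le G$ there, and $\varphi(x_0,t_0)=G(x_0,t_0)$, then $(\partial_t-\Delta)\varphi\ge|A|^2\varphi$ at $(x_0,t_0)$ (with the left time derivative). (ii) Distributional sense: for every smooth $\eta\ge0$ with compact support in $M\times\operatorname{int}I$, $$\int_{\operatorname{int} I}\int_M G\,\bigl(-\partial_t\eta-\Delta\eta+H^2\eta-|A|^2\eta\bigr)\,d\mu_t\,dt\ \ge\ 0 ,$$ where $\eta\mapsto-\partial_t\eta-\Delta\eta+H^2\eta$ is the formal adjoint of $\partial_t-\Delta$ with respect to $d\mu_t\,dt$, because $\partial_t\,d\mu_t=-H^2\,d\mu_t$. The integrals converge. -/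

import Mathlib

open Set MeasureTheory Topology
open scoped Manifold ContDiff Matrix

/-! ## Symmetric matrices and the signed distance to the boundary of a set of them -/

/-- The space of self-adjoint endomorphisms of `ℝⁿ`, as symmetric real matrices. -/
def symMatrices (n : ℕ) : Set (Matrix (Fin n) (Fin n) ℝ) := {W | W.IsSymm}

section Frobenius
attribute [local instance] Matrix.frobeniusNormedAddCommGroup

open Classical in
/-- Signed distance, in the space of symmetric matrices with the Frobenius (trace) norm, to the
boundary of `C`: the distance to the complement for points of `C`, minus the distance to `C` for
all other points. -/
noncomputable def signedBdryDist {n : ℕ} (C : Set (Matrix (Fin n) (Fin n) ℝ))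
    (W : Matrix (Fin n) (Fin n) ℝ) : ℝ :=
  if W ∈ C then Metric.infDist W (symMatrices n \ C) else -Metric.infDist W C

end Frobenius

/-- A nonempty proper closed convex `O(n)`-invariant cone of symmetric matrices. A cone is a set
invariant under scaling by positive numbers; `O(n)` acts by conjugation. -/
structure IsInvariantConvexCone {n : ℕ} (Γ : Set (Matrix (Fin n) (Fin n) ℝ)) : Prop where
  subset_sym : Γ ⊆ symMatrices n
  nonempty : Γ.Nonempty
  ne_all : Γ ≠ symMatrices n
  closed : IsClosed Γ
  convex : Convex ℝ Γ
  cone : ∀ c : ℝ, 0 < c → ∀ W ∈ Γ, c • W ∈ Γ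
  invariant : ∀ Q ∈ Matrix.orthogonalGroup (Fin n) ℝ, ∀ W ∈ Γ, Q * W * Qᵀ ∈ Γ

/-! ## Geometry of an immersed hypersurface -/

section Geometry

variable {n : ℕ} {M : Type*} [TopologicalSpace M] [ChartedSpace (EuclideanSpace ℝ (Fin n)) M]

/-- The differential `DY_x : T_x M → ℝⁿ⁺¹`. -/
noncomputable def differential (Y : M → EuclideanSpace ℝ (Fin (n + 1))) (x : M) :
    TangentSpace (𝓡 n) x →L[ℝ] EuclideanSpace ℝ (Fin (n + 1)) :=
  mfderiv (𝓡 n) 𝓘(ℝ, EuclideanSpace ℝ (Fin (n + 1))) Y x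

/-- The matrix `g_ij = ⟨∂_i Y, ∂_j Y⟩` of the metric induced by `Y`, in the chart `e`, at the point
with coordinates `y`. -/
noncomputable def chartMetric (Y : M → EuclideanSpace ℝ (Fin (n + 1)))
    (e : OpenPartialHomeomorph M (EuclideanSpace ℝ (Fin n))) (y : EuclideanSpace ℝ (Fin n)) :
    Matrix (Fin n) (Fin n) ℝ :=
  Matrix.of fun i j => inner ℝ (fderiv ℝ (Y ∘ e.symm) y (EuclideanSpace.single i 1))
    (fderiv ℝ (Y ∘ e.symm) y (EuclideanSpace.single j 1))

/-- The Laplace-Beltrami operator of the metric `g` induced by the immersion `Y`, applied to a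
scalar or vector valued function:
`Δu = (det g)^(-1/2) ∑_i ∂_i (∑_j (det g)^(1/2) g^{ij} ∂_j u)`, in the preferred chart at `x`. -/
noncomputable def laplaceBeltrami {V : Type*} [NormedAddCommGroup V] [NormedSpace ℝ V]
    (Y : M → EuclideanSpace ℝ (Fin (n + 1))) (u : M → V) (x : M) : V :=
  let e := chartAt (EuclideanSpace ℝ (Fin n)) x
  (Real.sqrt (chartMetric Y e (e x)).det)⁻¹ •
    ∑ i : Fin n, fderiv ℝ
      (fun y => ∑ j : Fin n, (Real.sqrt (chartMetric Y e y).det * (chartMetric Y e y)⁻¹ i j) •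
        fderiv ℝ (u ∘ e.symm) y (EuclideanSpace.single j 1))
      (e x) (EuclideanSpace.single i 1)

/-- The mean curvature vector `div (DY) = ΔY` of the immersion `Y`. -/
noncomputable def meanCurvatureVector (Y : M → EuclideanSpace ℝ (Fin (n + 1))) (x : M) :
    EuclideanSpace ℝ (Fin (n + 1)) :=
  laplaceBeltrami Y Y x

/-- The mean curvature `H = -⟨H⃗, N⟩` with respect to the unit normal `N`. -/
noncomputable def meanCurvature (Y N : M → EuclideanSpace ℝ (Fin (n + 1))) (x : M) : ℝ :=
  -inner ℝ (meanCurvatureVector Y x) (N x)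

/-- `f` is an orthonormal basis of `T_x M` for the metric induced by `Y`. -/
def IsOrthonormalFrame (Y : M → EuclideanSpace ℝ (Fin (n + 1))) (x : M)
    (f : Fin n → TangentSpace (𝓡 n) x) : Prop :=
  Orthonormal ℝ (fun i => differential Y x (f i))

/-- The matrix `A(f_i, f_j) = ⟨DN(f_i), DY(f_j)⟩` of the Weingarten tensor with respect to the unit
normal `N`, in the frame `f`; round spheres with outward normal have `A > 0`. -/
noncomputable def weingartenMatrix (Y N : M → EuclideanSpace ℝ (Fin (n + 1))) (x : M)
    (f : Fin n → TangentSpace (𝓡 n) x) : Matrix (Fin n) (Fin n) ℝ :=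
  Matrix.of fun i j => inner ℝ (differential N x (f i)) (differential Y x (f j))

/-- Some orthonormal basis of `T_x M` (there is one if `Y` is an immersion). -/
noncomputable def someFrame (Y : M → EuclideanSpace ℝ (Fin (n + 1))) (x : M) :
    Fin n → TangentSpace (𝓡 n) x :=
  @Classical.epsilon _ ⟨fun _ => 0⟩ (IsOrthonormalFrame Y x)

/-- The squared norm `|A|²` of the Weingarten tensor. -/
noncomputable def normSqA (Y N : M → EuclideanSpace ℝ (Fin (n + 1))) (x : M) : ℝ :=
  ∑ i, ∑ j, (weingartenMatrix Y N x (someFrame Y x) i j) ^ 2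

/-- The function `d_Γ(A)`: the signed distance of the Weingarten tensor, read in an orthonormal
basis, to the boundary of `Γ`. -/
noncomputable def curvatureDist (Γ : Set (Matrix (Fin n) (Fin n) ℝ))
    (Y N : M → EuclideanSpace ℝ (Fin (n + 1))) (x : M) : ℝ :=
  signedBdryDist Γ (weingartenMatrix Y N x (someFrame Y x))

/-- The area measure `(det g)^(1/2) dy` of `Y` on the domain of the chart `e`, extended by zero. -/
noncomputable def chartArea [MeasurableSpace M] (Y : M → EuclideanSpace ℝ (Fin (n + 1)))
    (e : OpenPartialHomeomorph M (EuclideanSpace ℝ (Fin n))) : Measure M :=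
  Measure.map e.symm ((volume.restrict e.target).withDensity
    fun y => ENNReal.ofReal (Real.sqrt (chartMetric Y e y).det))

/-- The area measure of the immersion `Y`: the chart measures agree on overlaps of charts, and the
area measure is the smallest measure that dominates all of them, i.e. the one which restricts to
each of them on the domain of the chart. -/
noncomputable def areaMeasure [MeasurableSpace M] (Y : M → EuclideanSpace ℝ (Fin (n + 1))) :
    Measure M :=
  ⨆ x : M, chartArea Y (chartAt (EuclideanSpace ℝ (Fin n)) x)

/-! ## Mean curvature flow and supersolutions -/

/-- `X` is a smooth one-parameter family of immersed hypersurfaces, with time interval `I`, that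
moves with velocity equal to its mean curvature vector. -/
structure IsMeanCurvatureFlow (I : Set ℝ) (X : ℝ → M → EuclideanSpace ℝ (Fin (n + 1))) :
    Prop where
  smooth : ContMDiffOn ((𝓡 n).prod 𝓘(ℝ, ℝ)) 𝓘(ℝ, EuclideanSpace ℝ (Fin (n + 1))) ∞
    (fun p : M × ℝ => X p.2 p.1) (univ ×ˢ I)
  immersion : ∀ t ∈ I, ∀ x : M, Function.Injective (differential (X t) x)
  flow : ∀ t ∈ I, ∀ x : M, derivWithin (fun s => X s x) I t = meanCurvatureVector (X t) x

/-- `ν` is a smooth unit normal field along the family of hypersurfaces `X`. -/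
structure IsUnitNormal (I : Set ℝ) (X ν : ℝ → M → EuclideanSpace ℝ (Fin (n + 1))) : Prop where
  smooth : ContMDiffOn ((𝓡 n).prod 𝓘(ℝ, ℝ)) 𝓘(ℝ, EuclideanSpace ℝ (Fin (n + 1))) ∞
    (fun p : M × ℝ => ν p.2 p.1) (univ ×ˢ I)
  norm_eq_one : ∀ t ∈ I, ∀ x : M, ‖ν t x‖ = 1
  normal : ∀ t ∈ I, ∀ (x : M) (v : TangentSpace (𝓡 n) x),
    inner ℝ (differential (X t) x v) (ν t x) = 0

/-- `(∂_t - Δ) G ≥ c G` in the viscosity sense: at each space-time point, every lower support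
function `φ` of `G` that is smooth on a backward neighbourhood `U × (t₀ - r, t₀]` satisfies the
inequality at that point. -/
def IsViscositySupersolution (I : Set ℝ) (X : ℝ → M → EuclideanSpace ℝ (Fin (n + 1)))
    (c G : ℝ → M → ℝ) : Prop :=
  ∀ t₀ ∈ I, ∀ (x₀ : M) (U : Set M) (r : ℝ), IsOpen U → x₀ ∈ U → 0 < r →
    Ioc (t₀ - r) t₀ ⊆ I → ∀ φ : ℝ → M → ℝ,
    ContMDiffOn ((𝓡 n).prod 𝓘(ℝ, ℝ)) 𝓘(ℝ, ℝ) ∞ (fun p : M × ℝ => φ p.2 p.1)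
      (U ×ˢ Ioc (t₀ - r) t₀) →
    (∀ t ∈ Ioc (t₀ - r) t₀, ∀ x ∈ U, φ t x ≤ G t x) → φ t₀ x₀ = G t₀ x₀ →
    c t₀ x₀ * φ t₀ x₀ ≤
      derivWithin (fun t => φ t x₀) (Iic t₀) t₀ - laplaceBeltrami (X t₀) (φ t₀) x₀

/-- `(∂_t - Δ) G ≥ c G` in the distributional sense along the mean curvature flow `X`, on
`M × interior I`. Since the area measures `μ_t` evolve by `∂_t μ_t = -H² μ_t`, the formal adjoint of
`∂_t - Δ` with respect to `dμ_t dt` is `η ↦ -∂_t η - Δη + H² η`; the inequality is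
`∫∫ G (-∂_t η - Δη + H² η - c η) dμ_t dt ≥ 0` for all nonnegative smooth `η` with compact support in
`M × interior I`, the integrals being convergent. -/
def IsDistributionalSupersolution [MeasurableSpace M] (I : Set ℝ)
    (X ν : ℝ → M → EuclideanSpace ℝ (Fin (n + 1))) (c G : ℝ → M → ℝ) : Prop :=
  ∀ η : ℝ → M → ℝ,
    ContMDiff ((𝓡 n).prod 𝓘(ℝ, ℝ)) 𝓘(ℝ, ℝ) ∞ (fun p : M × ℝ => η p.2 p.1) →
    HasCompactSupport (fun p : M × ℝ => η p.2 p.1) →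
    tsupport (fun p : M × ℝ => η p.2 p.1) ⊆ univ ×ˢ interior I →
    (∀ t x, 0 ≤ η t x) →
    let F : ℝ → M → ℝ := fun t x => G t x * (-deriv (fun s => η s x) t
      - laplaceBeltrami (X t) (η t) x + (meanCurvature (X t) (ν t) x) ^ 2 * η t x
      - c t x * η t x)
    (∀ t ∈ interior I, Integrable (F t) (areaMeasure (X t))) ∧
    IntegrableOn (fun t => ∫ x, F t x ∂(areaMeasure (X t))) (interior I) ∧
    0 ≤ ∫ t in interior I, ∫ x, F t x ∂(areaMeasure (X t))

end Geometry

/-!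
The signed distance to the boundary of a closed convex cone `Γ` is the infimum of the linear
functions `W ↦ ⟨B, W⟩` over the unit vectors `B` of the dual cone (`coneDist`,
`IsInvariantConvexCone.signedBdryDist_eq`). It is therefore concave, positively homogeneous of
degree one and Lipschitz; and it is `O(n)`-invariant because `Γ` is, so that its value on the
Weingarten tensor does not depend on the orthonormal frame.

Along the flow, let `A_ij` be the components of the Weingarten tensor in the orthonormal frame that
arises from one at a base point by rotating the normal there to the nearby normals. At the base
point they satisfy the linear equation `(∂_t - Δ) A_ij = |A|² A_ij`, without gradient terms
(`HypersurfaceAlgebra.IsFlow.L_frameA`, `IsCoordHypersurface.exists_smooth_weingarten`). Its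
derivation is pure algebra with the tangential derivatives `δ_a` in the ambient coordinate
directions; it is carried out in a commutative algebra with commuting derivations
(`HypersurfaceAlgebra`), and applied to the algebra of smooth functions on the product of a
coordinate domain and an interval, which may contain its end points (`SmoothFun`).

Now let a smooth function `φ` touch the signed distance `d(A)` from below at the base point, and
let `B` attain the infimum there. Then `φ ≤ ⟨B, A⟩` near the point at earlier times, with equality
at the point, so the maximum principle (`IsCoordHypersurface.ev_L_nonpos`) gives
`(∂_t - Δ) φ ≥ (∂_t - Δ) ⟨B, A⟩ = |A|² ⟨B, A⟩ = |A|² φ` there. This is the viscosity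
inequality; the same argument (`le_heat_of_support`) works with an error `ε` for functions
whose supergradients satisfy Euler's identity up to `ε`.

For the distributional inequality, the signed distance is mollified in the space of matrices with a
radial kernel. This keeps concavity and invariance, and Euler's identity up to `ε`
(`exists_supergradient_mollify`); hence the mollified functions of `A` are smooth and are classical
supersolutions up to `ε` (`exists_smooth_approx`). Multiplied by a test function and integrated by
parts with Green's identity, in which `∂_t dμ = -H² dμ` enters
(`HypersurfaceAlgebra.IsFlow.green`), they satisfy the weak inequality up to `ε` in each chart
(`IsCoordHypersurface.integral_adjoint_nonneg`). It remains to let `ε` tend to zero and to use a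
partition of unity (`weak_inequality`), since the area measure restricts to the coordinate area on
each chart (`areaMeasure_restrict`).
-/

/-! ### The signed distance to the boundary of a convex cone -/

section ConvexCone

variable {V : Type*} [NormedAddCommGroup V] [InnerProductSpace ℝ V]

/-- The unit vectors of `T` in the dual cone of `C`. -/
def dualUnit (T : Submodule ℝ V) (C : Set V) : Set V :=
  {B | B ∈ T ∧ ‖B‖ = 1 ∧ ∀ Z ∈ C, 0 ≤ inner ℝ B Z}

/-- The infimum of the linear functions `⟨B, ·⟩` over the unit vectors `B` of the dual cone. -/
noncomputable def coneDist (T : Submodule ℝ V) (C : Set V) (W : V) : ℝ :=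
  sInf ((fun B => inner ℝ B W) '' dualUnit T C)

/-- `C` is a nonempty closed convex cone in the subspace `T`, different from `T`. -/
structure IsProperCone (T : Submodule ℝ V) (C : Set V) : Prop where
  subset : C ⊆ T
  nonempty : C.Nonempty
  ne : C ≠ T
  closed : IsClosed C
  convex : Convex ℝ C
  cone : ∀ c : ℝ, 0 < c → ∀ W ∈ C, c • W ∈ C

variable {T : Submodule ℝ V} {C : Set V}

lemma coneDist_map (U : V ≃ₗᵢ[ℝ] V) (hT : ∀ W, U W ∈ T ↔ W ∈ T) (hC : ∀ W, U W ∈ C ↔ W ∈ C)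
    (W : V) : coneDist T C (U W) = coneDist T C W := by
  have : dualUnit T C = U '' dualUnit T C := by
    ext B
    rw [U.image_eq_preimage_symm]
    have hi : ∀ Z, inner ℝ (U.symm B) Z = inner ℝ B (U Z) := fun Z => by
      rw [← U.inner_map_map, U.apply_symm_apply]
    simp only [dualUnit, mem_preimage, mem_ofPred_eq, U.symm.norm_map, hi]
    refine and_congr (by simpa using hT (U.symm B)) (and_congr Iff.rfl ⟨fun H Z hZ => ?_,
      fun H Z hZ => ?_⟩)
    · exact by simpa using H _ ((hC Z).2 hZ)
    · have := H (U.symm Z) ((hC _).1 (by simpa using hZ))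
      simpa using this
  unfold coneDist
  conv_lhs => rw [this]
  rw [image_image]
  simp

variable [FiniteDimensional ℝ V]

/-- The nearest point `p` of the cone to a point `W` outside of it gives the element
`(p - W) / ‖p - W‖` of the dual cone, at which the infimum is attained. -/
lemma IsProperCone.exists_dualUnit (h : IsProperCone T C) {W : V} (hT : W ∈ T) (hW : W ∉ C) :
    ∃ p ∈ C, ∃ B ∈ dualUnit T C, inner ℝ B W = -dist W p ∧ Metric.infDist W C = dist W p := by
  obtain ⟨p, hp, hpm⟩ := exists_norm_eq_iInf_of_complete_convex h.nonempty h.closed.isComplete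
    h.convex W
  have hpi := (norm_eq_iInf_iff_real_inner_le_zero h.convex hp).1 hpm
  have hne : p - W ≠ 0 := fun h0 => hW (by rwa [sub_eq_zero.1 h0] at hp)
  have hpos : 0 < ‖p - W‖ := norm_pos_iff.2 hne
  have h1 := hpi _ (h.cone 2 two_pos p hp)
  have h2 := hpi _ (h.cone (1 / 2) (by norm_num) p hp)
  have e1 : (2 : ℝ) • p - p = p := by module
  have e2 : (1 / 2 : ℝ) • p - p = (-(1 / 2) : ℝ) • p := by module
  rw [e1] at h1
  rw [e2, inner_smul_right] at h2
  have h0 : inner ℝ (W - p) p = 0 := by linarith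
  refine ⟨p, hp, ‖p - W‖⁻¹ • (p - W), ⟨T.smul_mem _ (T.sub_mem (h.subset hp) hT), ?_, ?_⟩, ?_, ?_⟩
  · rw [norm_smul, norm_inv, norm_norm, inv_mul_cancel₀ hpos.ne']
  · intro Z hZ
    have := hpi Z hZ
    rw [inner_sub_right, h0] at this
    rw [inner_smul_left, ← neg_sub W p, inner_neg_left]
    exact mul_nonneg (by simp) (by linarith)
  · have : inner ℝ (p - W) W = -(‖p - W‖ * ‖p - W‖) := by
      rw [← neg_sub W p, norm_neg, ← real_inner_self_eq_norm_mul_norm, inner_neg_left,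
        inner_sub_right (W - p) W p, h0, sub_zero]
    rw [inner_smul_left, this, dist_comm, dist_eq_norm]
    simp only [conj_trivial]
    field_simp
  · refine le_antisymm (Metric.infDist_le_dist_of_mem hp) ?_
    refine (Metric.le_infDist h.nonempty).2 fun Z hZ => ?_
    rw [dist_eq_norm, dist_eq_norm, hpm]
    exact ciInf_le ⟨0, by rintro _ ⟨z, rfl⟩; positivity⟩ (⟨Z, hZ⟩ : C)

lemma IsProperCone.dualUnit_nonempty (h : IsProperCone T C) : (dualUnit T C).Nonempty := by
  obtain ⟨W, hT, hW⟩ : ∃ W ∈ T, W ∉ C := by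
    by_contra! hc
    exact h.ne (h.subset.antisymm hc)
  obtain ⟨p, -, B, hB, -⟩ := h.exists_dualUnit hT hW
  exact ⟨B, hB⟩

lemma isCompact_dualUnit (T : Submodule ℝ V) (C : Set V) : IsCompact (dualUnit T C) := by
  have : ProperSpace V := FiniteDimensional.proper_real V
  refine (isCompact_sphere (0 : V) 1).of_isClosed_subset ?_ fun B hB => by simpa using hB.2.1
  have : dualUnit T C = (T : Set V) ∩ ({B | ‖B‖ = 1} ∩ ⋂ Z ∈ C, {B | 0 ≤ inner ℝ B Z}) := by
    ext B; simp [dualUnit]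
  rw [this]
  refine T.closed_of_finiteDimensional.inter
    ((isClosed_eq continuous_norm continuous_const).inter ?_)
  exact isClosed_biInter fun Z _ => isClosed_le continuous_const (by fun_prop)

lemma IsProperCone.exists_coneDist_eq (h : IsProperCone T C) (W : V) :
    ∃ B ∈ dualUnit T C, coneDist T C W = inner ℝ B W :=
  (isCompact_dualUnit T C).exists_sInf_image_eq h.dualUnit_nonempty (by fun_prop)

lemma coneDist_le {B : V} (hB : B ∈ dualUnit T C) (W : V) : coneDist T C W ≤ inner ℝ B W := by
  refine csInf_le ?_ ⟨B, hB, rfl⟩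
  exact ((isCompact_dualUnit T C).image (by fun_prop)).bddBelow

/-- The signed distance to the boundary of a convex cone is the infimum of the linear functions
`⟨B, ·⟩` over the unit vectors `B` of the dual cone. -/
lemma IsProperCone.coneDist_eq_of_mem (h : IsProperCone T C) {W : V} (hW : W ∈ C) :
    coneDist T C W = Metric.infDist W (T \ C) := by
  obtain ⟨B, hB, hBW⟩ := h.exists_coneDist_eq W
  have hB0 := hB.2.2 W hW
  -- moving from `W` against `B` just beyond the hyperplane `⟨B, ·⟩ = 0` leaves the cone
  have key : ∀ ε : ℝ, 0 < ε → W - (inner ℝ B W + ε) • B ∈ (T : Set V) \ C ∧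
      dist W (W - (inner ℝ B W + ε) • B) = inner ℝ B W + ε := by
    intro ε hε
    refine ⟨⟨T.sub_mem (h.subset hW) (T.smul_mem _ hB.1), fun hm => ?_⟩, ?_⟩
    · have := hB.2.2 _ hm
      rw [inner_sub_right, inner_smul_right, real_inner_self_eq_norm_sq, hB.2.1] at this
      linarith
    · rw [dist_eq_norm, sub_sub_cancel, norm_smul, hB.2.1, mul_one, Real.norm_of_nonneg]
      linarith
  rw [hBW]
  refine le_antisymm ?_ (le_of_forall_pos_le_add fun ε hε => ?_)
  · refine (Metric.le_infDist ⟨_, (key 1 one_pos).1⟩).2 fun Z hZ => ?_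
    obtain ⟨p, hp, B', hB', h1, -⟩ := h.exists_dualUnit hZ.1 hZ.2
    have h2 := coneDist_le hB' W
    have h3 := real_inner_le_norm B' (W - Z)
    rw [hB'.2.1, one_mul, inner_sub_right, h1] at h3
    rw [dist_eq_norm, ← hBW]
    linarith [dist_nonneg (x := Z) (y := p)]
  · obtain ⟨h1, h2⟩ := key ε hε
    rw [← h2]
    exact Metric.infDist_le_dist_of_mem h1

lemma IsProperCone.coneDist_eq_of_notMem (h : IsProperCone T C) {W : V} (hT : W ∈ T)
    (hW : W ∉ C) : coneDist T C W = -Metric.infDist W C := by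
  obtain ⟨p, hp, B, hB, h1, h2⟩ := h.exists_dualUnit hT hW
  rw [h2, ← h1]
  refine le_antisymm (coneDist_le hB W) ?_
  obtain ⟨B', hB', hBW⟩ := h.exists_coneDist_eq W
  have h3 := real_inner_le_norm B' (p - W)
  rw [hB'.2.1, one_mul, inner_sub_right, ← dist_eq_norm, dist_comm] at h3
  have := hB'.2.2 p hp
  rw [hBW, h1]
  linarith

lemma IsProperCone.concaveOn_coneDist (h : IsProperCone T C) :
    ConcaveOn ℝ univ (coneDist T C) := by
  refine ⟨convex_univ, fun x _ y _ a b ha hb _ => ?_⟩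
  obtain ⟨B, hB, e⟩ := h.exists_coneDist_eq (a • x + b • y)
  rw [e, inner_add_right, inner_smul_right, inner_smul_right, smul_eq_mul, smul_eq_mul]
  exact add_le_add (mul_le_mul_of_nonneg_left (coneDist_le hB x) ha)
    (mul_le_mul_of_nonneg_left (coneDist_le hB y) hb)

lemma IsProperCone.coneDist_smul (h : IsProperCone T C) {c : ℝ} (hc : 0 < c) (W : V) :
    coneDist T C (c • W) = c * coneDist T C W := by
  obtain ⟨B, hB, e⟩ := h.exists_coneDist_eq (c • W)
  obtain ⟨B', hB', e'⟩ := h.exists_coneDist_eq W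
  have h1 := coneDist_le hB W
  have h2 := coneDist_le hB' (c • W)
  rw [inner_smul_right] at e h2
  exact le_antisymm (by rw [e']; exact h2) (by rw [e]; exact mul_le_mul_of_nonneg_left h1 hc.le)

lemma IsProperCone.lipschitz_coneDist (h : IsProperCone T C) : LipschitzWith 1 (coneDist T C) := by
  refine LipschitzWith.of_le_add fun x y => ?_
  obtain ⟨B, hB, e⟩ := h.exists_coneDist_eq y
  have h1 := coneDist_le hB x
  have h2 := real_inner_le_norm B (x - y)
  rw [hB.2.1, one_mul, inner_sub_right, ← dist_eq_norm] at h2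
  linarith

end ConvexCone

/-! ### Mollification of concave functions -/

section Mollifier

lemma le_of_hasDerivAt_of_forall_mul_le {g : ℝ → ℝ} {d c : ℝ} (hg : HasDerivAt g d 0)
    (h : ∀ s ∈ Ioo (0 : ℝ) 1, s * c ≤ g s - g 0) : c ≤ d := by
  have h1 : Filter.Tendsto (fun s : ℝ => s⁻¹ • (g (0 + s) - g 0)) (𝓝[>] 0) (𝓝 d) :=
    hg.tendsto_slope_zero.mono_left (nhdsWithin_mono _ fun s hs => (ne_of_gt hs : s ≠ 0))
  refine ge_of_tendsto h1 ?_
  filter_upwards [Ioo_mem_nhdsGT (zero_lt_one : (0 : ℝ) < 1)] with s hs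
  have := h s hs
  rw [zero_add, smul_eq_mul, ← div_eq_inv_mul, le_div_iff₀ hs.1]
  linarith

variable {V : Type*} [NormedAddCommGroup V]

/-- A smooth radial function that is positive on the open ball of radius `ε` and vanishes outside
of it. -/
noncomputable def radialBump (ε : ℝ) (Y : V) : ℝ := Real.smoothTransition (1 - ‖Y‖ ^ 2 / ε ^ 2)

lemma radialBump_nonneg (ε : ℝ) (Y : V) : 0 ≤ radialBump ε Y := Real.smoothTransition.nonneg _

lemma radialBump_eq_zero {ε : ℝ} (hε : 0 < ε) {Y : V} (hY : ε ≤ ‖Y‖) : radialBump ε Y = 0 := by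
  refine Real.smoothTransition.zero_of_nonpos ?_
  rw [sub_nonpos, le_div_iff₀ (by positivity), one_mul]
  gcongr

variable [InnerProductSpace ℝ V]

lemma contDiff_radialBump (ε : ℝ) : ContDiff ℝ ∞ (radialBump ε : V → ℝ) :=
  (Real.smoothTransition.contDiff (n := ⊤)).comp
    (contDiff_const.sub ((contDiff_norm_sq ℝ).div_const _))

variable [FiniteDimensional ℝ V]

lemma hasCompactSupport_radialBump {ε : ℝ} (hε : 0 < ε) :
    HasCompactSupport (radialBump ε : V → ℝ) := by
  have : ProperSpace V := FiniteDimensional.proper_real V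
  refine HasCompactSupport.intro (isCompact_closedBall (0 : V) ε) fun Y hY => ?_
  exact radialBump_eq_zero hε (by simpa using (not_le.1 fun h => hY (by simpa using h)).le)

variable [MeasurableSpace V] [BorelSpace V]

/-- The average of `g` with respect to the radial weight of radius `ε`. -/
noncomputable def radialAvg (ε : ℝ) (g : V → ℝ) : ℝ :=
  (∫ Y : V, radialBump ε Y)⁻¹ * ∫ Y : V, radialBump ε Y * g Y

/-- The convolution of `f` with the normalized radial weight of radius `ε`. -/
noncomputable def mollify (ε : ℝ) (f : V → ℝ) (W : V) : ℝ := radialAvg ε fun Y => f (W - Y)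

lemma integrable_radialBump_mul {ε : ℝ} (hε : 0 < ε) {g : V → ℝ} (hg : Continuous g) :
    Integrable fun Y : V => radialBump ε Y * g Y :=
  ((contDiff_radialBump ε).continuous.mul hg).integrable_of_hasCompactSupport
    (hasCompactSupport_radialBump hε).mul_right

lemma integral_radialBump_pos {ε : ℝ} (hε : 0 < ε) : 0 < ∫ Y : V, radialBump ε Y := by
  refine (contDiff_radialBump ε).continuous.integral_pos_of_hasCompactSupport_nonneg_nonzero
    (hasCompactSupport_radialBump hε) (radialBump_nonneg ε) (x := 0) ?_
  simp [radialBump]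

lemma radialAvg_mono {ε : ℝ} (hε : 0 < ε) {g₁ g₂ : V → ℝ} (h₁ : Continuous g₁)
    (h₂ : Continuous g₂) (h : ∀ Y, ‖Y‖ ≤ ε → g₁ Y ≤ g₂ Y) : radialAvg ε g₁ ≤ radialAvg ε g₂ := by
  refine mul_le_mul_of_nonneg_left (integral_mono (integrable_radialBump_mul hε h₁)
    (integrable_radialBump_mul hε h₂) fun Y => ?_) (inv_nonneg.2 (integral_radialBump_pos hε).le)
  rcases le_total ‖Y‖ ε with hY | hY
  · exact mul_le_mul_of_nonneg_left (h Y hY) (radialBump_nonneg ε Y)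
  · simp [radialBump_eq_zero hε hY]

lemma radialAvg_const {ε : ℝ} (hε : 0 < ε) (c : ℝ) : radialAvg ε (fun _ : V => c) = c := by
  rw [radialAvg, integral_mul_const, ← mul_assoc,
    inv_mul_cancel₀ (integral_radialBump_pos hε).ne', one_mul]

lemma radialAvg_linear {ε : ℝ} (hε : 0 < ε) {g₁ g₂ : V → ℝ} (h₁ : Continuous g₁)
    (h₂ : Continuous g₂) (a b : ℝ) :
    radialAvg ε (fun Y => a * g₁ Y + b * g₂ Y) = a * radialAvg ε g₁ + b * radialAvg ε g₂ := by
  have : ∀ Y : V, radialBump ε Y * (a * g₁ Y + b * g₂ Y) =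
      a * (radialBump ε Y * g₁ Y) + b * (radialBump ε Y * g₂ Y) := fun Y => by ring
  simp only [radialAvg, this]
  rw [integral_add ((integrable_radialBump_mul hε h₁).const_mul a)
    ((integrable_radialBump_mul hε h₂).const_mul b), integral_const_mul, integral_const_mul]
  ring

lemma contDiff_mollify {ε : ℝ} (hε : 0 < ε) {f : V → ℝ} (hf : Continuous f) :
    ContDiff ℝ ∞ (mollify ε f) := by
  have h := (hasCompactSupport_radialBump (V := V) hε).contDiff_convolution_left
    (ContinuousLinearMap.mul ℝ ℝ) (μ := volume) (n := ⊤) (contDiff_radialBump ε)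
    hf.locallyIntegrable
  exact contDiff_const.mul h

variable {f : V → ℝ}

lemma abs_mollify_sub_le {ε : ℝ} (hε : 0 < ε) (hf : LipschitzWith 1 f) (W : V) :
    |mollify ε f W - f W| ≤ ε := by
  have hc : Continuous fun Y => f (W - Y) := hf.continuous.comp (by fun_prop)
  have hd : ∀ Y, ‖Y‖ ≤ ε → |f (W - Y) - f W| ≤ ε := fun Y hY => by
    have := hf.dist_le_mul (W - Y) W
    rw [Real.dist_eq, dist_eq_norm, sub_sub_cancel_left, norm_neg] at this
    simpa using this.trans (by simpa using hY)
  have h1 := radialAvg_mono hε hc continuous_const (g₂ := fun _ => f W + ε)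
    fun Y hY => by linarith [(abs_le.1 (hd Y hY)).2]
  have h2 := radialAvg_mono hε continuous_const hc (g₁ := fun _ => f W - ε)
    fun Y hY => by linarith [(abs_le.1 (hd Y hY)).1]
  rw [radialAvg_const hε] at h1 h2
  exact abs_le.2 ⟨by unfold mollify; linarith, by unfold mollify; linarith⟩

lemma mollify_map {ε : ℝ} (U : V ≃ₗᵢ[ℝ] V) (hU : ∀ W, f (U W) = f W) (W : V) :
    mollify ε f (U W) = mollify ε f W := by
  unfold mollify radialAvg
  congr 1
  rw [← U.measurePreserving.integral_comp U.toHomeomorph.measurableEmbedding]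
  refine integral_congr_ae (.of_forall fun Y => ?_)
  simp only [radialBump, U.norm_map, ← map_sub, hU]

/-- Mollification preserves concavity; and it preserves Euler's identity `Df(W) W = f(W)` for
functions that are homogeneous of degree one up to an error that tends to zero with `ε`. -/
lemma exists_supergradient_mollify {ε : ℝ} (hε : 0 < ε) (hf : LipschitzWith 1 f)
    (hconc : ConcaveOn ℝ univ f) (hhom : ∀ c : ℝ, 0 < c → ∀ W, f (c • W) = c * f W) (W₀ : V) :
    ∃ B : V, (∀ W, mollify ε f W ≤ mollify ε f W₀ + inner ℝ B (W - W₀)) ∧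
      mollify ε f W₀ - ε ≤ inner ℝ B W₀ := by
  have hc : ∀ W, Continuous fun Y => f (W - Y) := fun W => hf.continuous.comp (by fun_prop)
  have hdiff : DifferentiableAt ℝ (mollify ε f) W₀ :=
    (contDiff_mollify hε hf.continuous).differentiable (by simp) W₀
  have hB : ∀ v : V, HasDerivAt (fun s : ℝ => mollify ε f (W₀ + s • v))
      (inner ℝ (gradient (mollify ε f) W₀) v) 0 := fun v => by
    have h1 : HasDerivAt (fun s : ℝ => W₀ + s • v) v 0 := by
      simpa using ((hasDerivAt_id (0 : ℝ)).smul_const v).const_add W₀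
    have h2 : HasFDerivAt (mollify ε f)
        (InnerProductSpace.toDual ℝ V (gradient (mollify ε f) W₀)) (W₀ + (0 : ℝ) • v) := by
      rw [zero_smul, add_zero]
      exact hdiff.hasGradientAt
    exact h2.comp_hasDerivAt (0 : ℝ) h1
  refine ⟨gradient (mollify ε f) W₀, fun W => ?_, ?_⟩
  · have := le_of_hasDerivAt_of_forall_mul_le (hB (W - W₀))
      (c := mollify ε f W - mollify ε f W₀) fun s hs => ?_
    · linarith
    have h1 : (1 - s) * mollify ε f W₀ + s * mollify ε f W ≤ mollify ε f (W₀ + s • (W - W₀)) := by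
      unfold mollify
      rw [← radialAvg_linear hε (hc _) (hc _)]
      refine radialAvg_mono hε (((hc _).const_mul _).add ((hc _).const_mul _)) (hc _) fun Y _ => ?_
      have := hconc.2 (mem_univ (W₀ - Y)) (mem_univ (W - Y)) (by linarith [hs.2] : 0 ≤ 1 - s)
        hs.1.le (by ring)
      have e : (1 - s) • (W₀ - Y) + s • (W - Y) = W₀ + s • (W - W₀) - Y := by module
      rw [e] at this
      exact this
    rw [zero_smul, add_zero]
    linarith
  -- towards the origin, `f (W₀ - s • W₀ - Y)` is `(1 - s) * f (W₀ - Y)` up to the error that comes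
  -- from the shift of the argument by `s • Y`, which has norm at most `s * ε`
  · have := le_of_hasDerivAt_of_forall_mul_le (hB (-W₀)).neg
      (c := mollify ε f W₀ - ε) fun s hs => ?_
    · simpa using this
    have h1 : mollify ε f (W₀ + s • -W₀) ≤ (1 - s) * mollify ε f W₀ + s * ε := by
      have hε' := radialAvg_const (V := V) hε ε
      unfold mollify
      nth_rewrite 3 [← hε']
      rw [← radialAvg_linear hε (hc _) continuous_const]
      refine radialAvg_mono hε (hc _) (((hc _).const_mul _).add (continuous_const.const_mul _))
        fun Y hY => ?_
      rw [← hhom _ (by linarith [hs.2])]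
      have := hf.dist_le_mul (W₀ + s • -W₀ - Y) ((1 - s) • (W₀ - Y))
      have e : W₀ + s • -W₀ - Y - (1 - s) • (W₀ - Y) = -(s • Y) := by module
      rw [Real.dist_eq, dist_eq_norm, e, norm_neg, norm_smul, Real.norm_of_nonneg hs.1.le] at this
      have h3 := mul_le_mul_of_nonneg_left hY hs.1.le
      have h4 := (abs_le.1 this).2
      simp only [NNReal.coe_one, one_mul] at h4
      linarith
    simp only [Pi.neg_apply, zero_smul, add_zero]
    linarith

end Mollifier

/-! ### Tangential calculus on an evolving hypersurface -/

section TangentialCalculus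

/-- An algebraic model of a time-dependent hypersurface in coordinates: `R` is the ring of smooth
functions, `d i` and `τ` are the spatial and the time derivatives, `X a` and `ν a` the components
of the position and of the unit normal, `gi` is the inverse of the induced metric and `s` the area
density. -/
structure HypersurfaceAlgebra (R : Type*) [CommRing R] [Algebra ℝ R] (n : ℕ) where
  d : Fin n → Derivation ℝ R R
  τ : Derivation ℝ R R
  X : Fin (n + 1) → R
  ν : Fin (n + 1) → R
  gi : Matrix (Fin n) (Fin n) R
  s : R
  comm : ∀ i j u, d i (d j u) = d j (d i u)
  comm_τ : ∀ i u, τ (d i u) = d i (τ u)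
  gi_mul : gi * Matrix.of (fun i j => ∑ a, d i (X a) * d j (X a)) = 1
  unit : ∑ a, ν a * ν a = 1
  normal : ∀ i, ∑ a, d i (X a) * ν a = 0
  s_mul_s : s * s = (Matrix.of (fun i j => ∑ a, d i (X a) * d j (X a))).det
  isUnit_s : IsUnit s

namespace HypersurfaceAlgebra

variable {R : Type*} [CommRing R] [Algebra ℝ R] {n : ℕ} (Y : HypersurfaceAlgebra R n)

/-- The coefficients of the tangential gradient of the coordinate function `X a`. -/
def V (a : Fin (n + 1)) (i : Fin n) : R := ∑ j, Y.gi i j * Y.d j (Y.X a)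

/-- The tangential derivative in the ambient coordinate direction `a`: the `a`-th component
`⟨∇u, e_a⟩` of the gradient. -/
def δ (a : Fin (n + 1)) : Derivation ℝ R R := ∑ i, Y.V a i • Y.d i

/-- The Weingarten tensor, extended by zero in the normal direction, in ambient coordinates. -/
def A (a b : Fin (n + 1)) : R := Y.δ a (Y.ν b)

/-- The mean curvature. -/
def H : R := ∑ a, Y.δ a (Y.ν a)

/-- The squared norm of the Weingarten tensor. -/
def N : R := ∑ a, ∑ b, Y.A a b * Y.A a b

/-- The Laplace-Beltrami operator `∑ δ_a δ_a`. -/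
def Δ : R →ₗ[ℝ] R := ∑ a, (Y.δ a : R →ₗ[ℝ] R) ∘ₗ (Y.δ a : R →ₗ[ℝ] R)

/-- The square of the Weingarten tensor. -/
def A2 (a b : Fin (n + 1)) : R := ∑ e, Y.A a e * Y.A e b

/-- The cube of the Weingarten tensor. -/
def A3 (a b : Fin (n + 1)) : R := ∑ e, Y.A a e * Y.A2 e b

lemma δ_apply (a : Fin (n + 1)) (u : R) : Y.δ a u = ∑ i, Y.V a i * Y.d i u := by
  have : ⇑(Y.δ a) = ∑ i, ⇑(Y.V a i • Y.d i) :=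
    map_sum (Derivation.coeFnAddMonoidHom : Derivation ℝ R R →+ R → R) _ _
  rw [this, Finset.sum_apply]
  rfl

lemma Δ_apply (u : R) : Y.Δ u = ∑ a, Y.δ a (Y.δ a u) := by
  simp [Δ]

lemma sum_dX_mul_V (i j : Fin n) :
    ∑ a, Y.d i (Y.X a) * Y.V a j = if j = i then 1 else 0 := by
  have := congrFun₂ Y.gi_mul j i
  rw [Matrix.mul_apply, Matrix.one_apply] at this
  rw [← this]
  simp only [V, Matrix.of_apply, Finset.mul_sum]
  rw [Finset.sum_comm]
  exact Finset.sum_congr rfl fun _ _ => Finset.sum_congr rfl fun _ _ => by ring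

lemma sum_ν_mul_V (j : Fin n) : ∑ a, Y.ν a * Y.V a j = 0 := by
  simp only [V, Finset.mul_sum]
  rw [Finset.sum_comm]
  refine Finset.sum_eq_zero fun i _ => ?_
  rw [← mul_zero (Y.gi j i), ← Y.normal i, Finset.mul_sum]
  exact Finset.sum_congr rfl fun _ _ => by ring

lemma sum_ν_mul_δ (u : R) : ∑ a, Y.ν a * Y.δ a u = 0 := by
  simp only [δ_apply, Finset.mul_sum, ← mul_assoc]
  rw [Finset.sum_comm]
  refine Finset.sum_eq_zero fun i _ => ?_
  rw [← Finset.sum_mul, sum_ν_mul_V, zero_mul]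

/-- The coordinate vector fields and the normal form a basis of the ambient space, so the
tangential gradient of `X b` is the projection of `e_b` to the tangent space. -/
lemma δ_X (a b : Fin (n + 1)) :
    Y.δ a (Y.X b) = (if a = b then 1 else 0) - Y.ν a * Y.ν b := by
  let P : Matrix (Fin n ⊕ Unit) (Fin (n + 1)) R :=
    Matrix.of (Sum.elim (fun i a => Y.d i (Y.X a)) fun _ => Y.ν)
  let Q : Matrix (Fin (n + 1)) (Fin n ⊕ Unit) R :=
    Matrix.of fun a => Sum.elim (fun i => Y.V a i) fun _ => Y.ν a
  have hPQ : P * Q = 1 := by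
    ext i j
    rw [Matrix.mul_apply, Matrix.one_apply]
    rcases i with i | i <;> rcases j with j | j
    · simp [P, Q, sum_dX_mul_V, eq_comm]
    · simp [P, Q, Y.normal]
    · simp [P, Q, sum_ν_mul_V]
    · simp [P, Q, Y.unit]
  have hQP : Q * P = 1 := (Matrix.mul_eq_one_comm_of_card_eq _ _ _ (by simp)).1 hPQ
  have := congrFun₂ hQP a b
  rw [Matrix.mul_apply, Matrix.one_apply, Fintype.sum_sum_type] at this
  simp only [Matrix.of_apply, Sum.elim_inl, Sum.elim_inr, Finset.univ_unique,
    Finset.sum_const, Finset.card_singleton, one_smul, P, Q] at this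
  rw [← this, δ_apply]
  ring

/-- A derivation in the span of the coordinate derivatives is determined by its values on the
position. -/
lemma eq_sum_mul_δ (c : Fin n → R) (u : R) :
    ∑ j, c j * Y.d j u = ∑ e, (∑ j, c j * Y.d j (Y.X e)) * Y.δ e u := by
  have : ∀ j, Y.d j u = ∑ e, Y.d j (Y.X e) * Y.δ e u := fun j => by
    simp only [δ_apply, Finset.mul_sum, ← mul_assoc]
    rw [Finset.sum_comm]
    simp [← Finset.sum_mul, sum_dX_mul_V]
  simp only [this (_ : Fin n), Finset.sum_mul, Finset.mul_sum]
  rw [Finset.sum_comm]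
  exact Finset.sum_congr rfl fun _ _ => Finset.sum_congr rfl fun _ _ => by rw [mul_assoc]

lemma d_eq_sum (i : Fin n) (u : R) : Y.d i u = ∑ e, Y.d i (Y.X e) * Y.δ e u := by
  have := Y.eq_sum_mul_δ (Pi.single i 1) u
  simpa [Pi.single_apply] using this

lemma sum_ν_mul_D (D : Derivation ℝ R R) : ∑ a, Y.ν a * D (Y.ν a) = 0 := by
  have h := congrArg D Y.unit
  rw [map_sum, Derivation.map_one_eq_zero] at h
  simp only [Derivation.leibniz, smul_eq_mul, Finset.sum_add_distrib] at h
  have h2 : (2 : ℝ) • ∑ a, Y.ν a * D (Y.ν a) = 0 := by rw [two_smul]; exact h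
  have := congrArg (fun x => (2⁻¹ : ℝ) • x) h2
  simpa [smul_smul] using this

lemma δ_δ_sub (a b : Fin (n + 1)) (u : R) : Y.δ a (Y.δ b u) - Y.δ b (Y.δ a u) =
    ∑ j, (Y.δ a (Y.V b j) - Y.δ b (Y.V a j)) * Y.d j u := by
  have h : ∀ a b, Y.δ a (Y.δ b u) = ∑ j, Y.δ a (Y.V b j) * Y.d j u +
      ∑ j, ∑ i, Y.V b j * Y.V a i * Y.d i (Y.d j u) := fun a b => by
    rw [Y.δ_apply b u, map_sum, ← Finset.sum_add_distrib]
    refine Finset.sum_congr rfl fun j _ => ?_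
    rw [Derivation.leibniz, smul_eq_mul, smul_eq_mul, Y.δ_apply a (Y.d j u), Finset.mul_sum,
      add_comm, mul_comm (Y.d j u)]
    exact congrArg _ (Finset.sum_congr rfl fun _ _ => by ring)
  have hs : ∑ j, ∑ i, Y.V a j * Y.V b i * Y.d i (Y.d j u) =
      ∑ j, ∑ i, Y.V b j * Y.V a i * Y.d i (Y.d j u) := by
    rw [Finset.sum_comm]
    refine Finset.sum_congr rfl fun i _ => Finset.sum_congr rfl fun j _ => ?_
    rw [Y.comm i j]
    ring
  rw [h a b, h b a, hs, add_sub_add_right_eq_sub, ← Finset.sum_sub_distrib]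
  exact Finset.sum_congr rfl fun _ _ => by ring

lemma τ_δ_sub (a : Fin (n + 1)) (u : R) : Y.τ (Y.δ a u) - Y.δ a (Y.τ u) =
    ∑ j, Y.τ (Y.V a j) * Y.d j u := by
  rw [δ_apply, δ_apply, map_sum, ← Finset.sum_sub_distrib]
  refine Finset.sum_congr rfl fun j _ => ?_
  rw [Derivation.leibniz, smul_eq_mul, smul_eq_mul, Y.comm_τ]
  ring

lemma sum_ν_mul_span (c : Fin n → R) : ∑ a, Y.ν a * ∑ j, c j * Y.d j (Y.X a) = 0 := by
  simp only [Finset.mul_sum]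
  rw [Finset.sum_comm]
  refine Finset.sum_eq_zero fun i _ => ?_
  rw [← mul_zero (c i), ← Y.normal i, Finset.mul_sum]
  exact Finset.sum_congr rfl fun _ _ => by ring

/-- The derivative of the unit normal is tangential. -/
lemma D_ν (D : Derivation ℝ R R) (b : Fin (n + 1)) :
    D (Y.ν b) = -∑ c, Y.ν c * D (Y.δ b (Y.X c)) := by
  have h0 : ∑ c, Y.ν c * Y.δ b (Y.X c) = 0 := by
    simp [δ_X, mul_sub, ← mul_assoc, mul_comm _ (Y.ν b)]
    simp only [mul_assoc, ← Finset.mul_sum, Y.unit]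
    simp
  have h1 := congrArg D h0
  rw [map_sum, map_zero] at h1
  simp only [Derivation.leibniz, smul_eq_mul, Finset.sum_add_distrib] at h1
  rw [eq_neg_iff_add_eq_zero, ← h1, add_comm]
  congr 1
  simp only [δ_X, sub_mul, Finset.sum_sub_distrib]
  have := Y.sum_ν_mul_D D
  simp only [mul_assoc, ← Finset.mul_sum, this]
  simp

lemma A_symm (a b : Fin (n + 1)) : Y.A a b = Y.A b a := by
  rw [A, A, D_ν, D_ν, neg_inj, ← sub_eq_zero, ← Finset.sum_sub_distrib]
  simp only [← mul_sub, δ_δ_sub]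
  exact Y.sum_ν_mul_span _

lemma sum_A_mul_ν (a : Fin (n + 1)) : ∑ b, Y.A a b * Y.ν b = 0 := by
  rw [← Y.sum_ν_mul_D (Y.δ a)]
  exact Finset.sum_congr rfl fun _ _ => mul_comm _ _

lemma sum_ν_mul_A (b : Fin (n + 1)) : ∑ a, Y.ν a * Y.A a b = 0 := Y.sum_ν_mul_δ _

lemma δ_comm (a b : Fin (n + 1)) (u : R) : Y.δ a (Y.δ b u) =
    Y.δ b (Y.δ a u) + ∑ e, (Y.ν a * Y.A b e - Y.ν b * Y.A a e) * Y.δ e u := by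
  rw [← sub_eq_iff_eq_add', δ_δ_sub, eq_sum_mul_δ]
  refine Finset.sum_congr rfl fun e _ => ?_
  have h := Y.A_symm a b
  rw [← δ_δ_sub, δ_X, δ_X, map_sub, map_sub, Derivation.leibniz, Derivation.leibniz]
  simp only [smul_eq_mul]
  have : ∀ (c d e : Fin (n + 1)), Y.δ c (if d = e then 1 else 0) = 0 := fun c d e => by
    split_ifs <;> simp
  rw [this, this]
  simp only [A] at h ⊢
  rw [h]
  ring

lemma Δ_X (b : Fin (n + 1)) : Y.Δ (Y.X b) = -(Y.H * Y.ν b) := by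
  have : ∀ (c d e : Fin (n + 1)), Y.δ c (if d = e then 1 else 0) = 0 := fun c d e => by
    split_ifs <;> simp
  rw [Δ_apply]
  simp only [δ_X, map_sub, this, Derivation.leibniz, smul_eq_mul, zero_sub, Finset.sum_neg_distrib,
    Finset.sum_add_distrib, sum_ν_mul_δ, zero_add, H, Finset.sum_mul]
  exact congrArg _ (Finset.sum_congr rfl fun _ _ => mul_comm _ _)

lemma Δ_ν (b : Fin (n + 1)) : Y.Δ (Y.ν b) = Y.δ b Y.H - Y.N * Y.ν b := by
  have h1 : ∀ a, Y.δ a (Y.δ a (Y.ν b)) = Y.δ b (Y.δ a (Y.ν a)) +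
      ∑ e, (Y.ν a * Y.A b e - Y.ν b * Y.A a e) * Y.A e a := fun a => by
    have := Y.A_symm a b
    simp only [A] at this
    rw [this, δ_comm]
    rfl
  rw [Δ_apply, Finset.sum_congr rfl fun a _ => h1 a, Finset.sum_add_distrib, H, map_sum,
    sub_eq_add_neg]
  congr 1
  simp only [sub_mul, Finset.sum_sub_distrib]
  rw [Finset.sum_comm]
  have h2 : ∀ e, ∑ a, Y.ν a * Y.A b e * Y.A e a = 0 := fun e => by
    rw [← mul_zero (Y.A b e), ← Y.sum_A_mul_ν e, Finset.mul_sum]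
    exact Finset.sum_congr rfl fun _ _ => by ring
  simp only [h2, Finset.sum_const_zero, zero_sub, N, Finset.sum_mul, neg_inj]
  refine Finset.sum_congr rfl fun a _ => Finset.sum_congr rfl fun e _ => ?_
  rw [Y.A_symm e a]
  ring

lemma sum_ν_mul_δ_A (e b : Fin (n + 1)) : ∑ c, Y.ν c * Y.δ e (Y.A c b) = -Y.A2 e b := by
  have h := congrArg (Y.δ e) (Y.sum_ν_mul_A b)
  rw [map_sum, map_zero] at h
  simp only [Derivation.leibniz, smul_eq_mul, Finset.sum_add_distrib] at h
  rw [eq_neg_iff_add_eq_zero, ← h, A2]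
  congr 1
  exact Finset.sum_congr rfl fun _ _ => mul_comm _ _

/-- Simons' identity: the Laplacian of the Weingarten tensor, up to terms with a normal index. It
follows by exchanging derivatives in the Codazzi equations. -/
lemma exists_Δ_A : ∃ r : Fin (n + 1) → R, ∀ a b,
    Y.Δ (Y.A a b) = Y.δ a (Y.Δ (Y.ν b)) + Y.H * Y.A2 a b - 2 * Y.A3 a b + Y.ν a * r b := by
  have h1 : ∀ a b c, Y.δ c (Y.A a b) =
      Y.δ a (Y.A c b) + (Y.ν c * Y.A2 a b - Y.ν a * Y.A2 c b) := fun a b c => by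
    rw [A, δ_comm]
    simp only [A2, Finset.mul_sum, ← Finset.sum_sub_distrib]
    refine congrArg _ (Finset.sum_congr rfl fun e _ => ?_)
    rw [← A]
    ring
  have h2 : ∀ a b c, Y.δ c (Y.δ a (Y.A c b)) = Y.δ a (Y.δ c (Y.A c b)) +
      ∑ e, (Y.ν c * Y.A a e - Y.ν a * Y.A c e) * Y.δ e (Y.A c b) := fun a b c => Y.δ_comm _ _ _
  refine ⟨fun b => -(∑ c, ∑ e, Y.A c e * Y.δ e (Y.A c b)) - ∑ c, Y.δ c (Y.A2 c b), fun a b => ?_⟩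
  have e1 : ∑ c, ∑ e, (Y.ν c * Y.A a e - Y.ν a * Y.A c e) * Y.δ e (Y.A c b) =
      -Y.A3 a b - Y.ν a * ∑ c, ∑ e, Y.A c e * Y.δ e (Y.A c b) := by
    simp only [sub_mul, Finset.sum_sub_distrib, Finset.mul_sum]
    congr 1
    · rw [Finset.sum_comm, A3, ← Finset.sum_neg_distrib]
      refine Finset.sum_congr rfl fun e _ => ?_
      rw [← mul_neg, ← Y.sum_ν_mul_δ_A e b, Finset.mul_sum]
      exact Finset.sum_congr rfl fun _ _ => by ring
    · exact Finset.sum_congr rfl fun _ _ => Finset.sum_congr rfl fun _ _ => by ring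
  have e2 : ∑ c, Y.δ c (Y.ν c * Y.A2 a b) = Y.H * Y.A2 a b := by
    simp only [Derivation.leibniz, smul_eq_mul, Finset.sum_add_distrib, sum_ν_mul_δ, zero_add, H,
      Finset.sum_mul]
    exact Finset.sum_congr rfl fun _ _ => mul_comm _ _
  have e3 : ∑ c, Y.δ c (Y.ν a * Y.A2 c b) =
      Y.ν a * (∑ c, Y.δ c (Y.A2 c b)) + Y.A3 a b := by
    simp only [Derivation.leibniz, smul_eq_mul, Finset.sum_add_distrib, Finset.mul_sum, A3]
    refine congrArg _ (Finset.sum_congr rfl fun c _ => ?_)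
    rw [Y.A_symm a c, mul_comm, A]
  rw [Δ_apply, Δ_apply, map_sum]
  simp only [h1 a b, map_add, map_sub, h2 a b, Finset.sum_add_distrib, Finset.sum_sub_distrib, e1,
    e2, e3]
  have : ∑ c, Y.δ a (Y.δ c (Y.A c b)) = ∑ c, Y.δ a (Y.δ c (Y.δ c (Y.ν b))) := rfl
  rw [this]
  ring

/-- The mean curvature flow equation. -/
def IsFlow : Prop := ∀ b, Y.τ (Y.X b) = Y.Δ (Y.X b)

section Flow

variable {Y}

lemma IsFlow.τ_X (hY : Y.IsFlow) (b : Fin (n + 1)) : Y.τ (Y.X b) = -(Y.H * Y.ν b) := by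
  rw [hY b, Δ_X]

lemma IsFlow.τ_ν (hY : Y.IsFlow) (b : Fin (n + 1)) : Y.τ (Y.ν b) = Y.δ b Y.H := by
  have h : ∑ c, Y.ν c * (Y.τ (Y.δ b (Y.X c)) - Y.δ b (Y.τ (Y.X c))) = 0 := by
    simp only [τ_δ_sub]
    exact Y.sum_ν_mul_span _
  simp only [mul_sub, Finset.sum_sub_distrib] at h
  rw [D_ν, sub_eq_zero.1 h]
  simp only [hY.τ_X, map_neg, mul_neg, Finset.sum_neg_distrib, neg_neg, Derivation.leibniz,
    smul_eq_mul, mul_add, Finset.sum_add_distrib]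
  have h1 : ∑ c, Y.ν c * (Y.H * Y.δ b (Y.ν c)) = 0 := by
    rw [← mul_zero Y.H, ← Y.sum_ν_mul_D (Y.δ b), Finset.mul_sum]
    exact Finset.sum_congr rfl fun _ _ => by ring
  rw [h1, zero_add]
  simp only [← mul_assoc, ← Finset.sum_mul, Y.unit, one_mul]

lemma IsFlow.τ_δ (hY : Y.IsFlow) (a : Fin (n + 1)) (u : R) : Y.τ (Y.δ a u) =
    Y.δ a (Y.τ u) + ∑ e, (Y.H * Y.A a e - Y.ν a * Y.δ e Y.H) * Y.δ e u := by
  rw [← sub_eq_iff_eq_add', τ_δ_sub, eq_sum_mul_δ]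
  refine Finset.sum_congr rfl fun e _ => ?_
  have : ∀ (D : Derivation ℝ R R) (d e : Fin (n + 1)), D (if d = e then 1 else 0) = 0 :=
    fun c d e => by split_ifs <;> simp
  rw [← τ_δ_sub, δ_X, hY.τ_X, map_sub, map_neg, Derivation.leibniz, Derivation.leibniz, this,
    hY.τ_ν, hY.τ_ν]
  simp only [smul_eq_mul, A]
  ring

/-- The evolution equation of the Weingarten tensor, up to terms with a normal index. The term
`2 A³` is due to the use of ambient coordinates: the tangent spaces rotate in space. -/
lemma IsFlow.exists_evolution_A (hY : Y.IsFlow) : ∃ r r' : Fin (n + 1) → R, ∀ a b,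
    Y.τ (Y.A a b) - Y.Δ (Y.A a b) =
      Y.N * Y.A a b + 2 * Y.A3 a b + Y.ν a * r b + r' a * Y.ν b := by
  obtain ⟨r, hr⟩ := Y.exists_Δ_A
  refine ⟨fun b => -r b - ∑ e, Y.δ e Y.H * Y.A e b, fun a => Y.δ a Y.N, fun a b => ?_⟩
  have h1 : Y.τ (Y.A a b) = Y.δ a (Y.δ b Y.H) + Y.H * Y.A2 a b -
      Y.ν a * ∑ e, Y.δ e Y.H * Y.A e b := by
    rw [A, hY.τ_δ, hY.τ_ν]
    simp only [sub_mul, Finset.sum_sub_distrib, A2, Finset.mul_sum, A]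
    rw [add_sub_assoc]
    congr 2
    · exact Finset.sum_congr rfl fun _ _ => by ring
    · exact Finset.sum_congr rfl fun _ _ => by ring
  rw [h1, hr, Δ_ν, map_sub, Derivation.leibniz, smul_eq_mul, smul_eq_mul, ← A]
  ring

end Flow

end HypersurfaceAlgebra

end TangentialCalculus

/-! ### The Weingarten tensor in a rotated frame -/

section TangentialCalculus

namespace HypersurfaceAlgebra

variable {R : Type*} [CommRing R] [Algebra ℝ R] {n : ℕ} (Y : HypersurfaceAlgebra R n)

lemma A3_symm (a b : Fin (n + 1)) : Y.A3 a b = Y.A3 b a := by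
  simp only [A3, A2, Finset.mul_sum]
  rw [Finset.sum_comm]
  refine Finset.sum_congr rfl fun e _ => Finset.sum_congr rfl fun f _ => ?_
  rw [Y.A_symm a f, Y.A_symm e b, Y.A_symm f e]
  ring

/-- The heat operator `∂_t - Δ`. -/
def L : R →ₗ[ℝ] R := (Y.τ : R →ₗ[ℝ] R) - Y.Δ

lemma L_apply (u : R) : Y.L u = Y.τ u - Y.Δ u := rfl

lemma Δ_mul (u v : R) : Y.Δ (u * v) = u * Y.Δ v + v * Y.Δ u + 2 * ∑ c, Y.δ c u * Y.δ c v := by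
  simp only [Δ_apply, Derivation.leibniz, smul_eq_mul, map_add, Finset.sum_add_distrib,
    Finset.mul_sum, two_mul]
  have : ∑ i, Y.δ i v * Y.δ i u = ∑ i, Y.δ i u * Y.δ i v :=
    Finset.sum_congr rfl fun _ _ => mul_comm _ _
  rw [this]
  ring

lemma L_mul (u v : R) : Y.L (u * v) = u * Y.L v + v * Y.L u - 2 * ∑ c, Y.δ c u * Y.δ c v := by
  rw [L_apply, Δ_mul, L_apply, L_apply, Derivation.leibniz, smul_eq_mul, smul_eq_mul]
  ring

section Frame

/-- The `a`-th component of the vector that arises from `w ⟂ ν₀` by the rotation that takes `ν₀` to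
`ν` and fixes `{ν₀, ν}ᗮ`, provided that `q = ⟨w, ν⟩ / (1 + ⟨ν₀, ν⟩)`. -/
def frameVec (ν₀ w : Fin (n + 1) → ℝ) (q : R) (a : Fin (n + 1)) : R :=
  algebraMap ℝ R (w a) - q * (Y.ν a + algebraMap ℝ R (ν₀ a))

/-- The Weingarten tensor on two rotated vectors. -/
def frameA (ν₀ w w' : Fin (n + 1) → ℝ) (q q' : R) : R :=
  ∑ a, ∑ b, Y.frameVec ν₀ w q a * Y.A a b * Y.frameVec ν₀ w' q' b

variable {Y} {ν₀ w w' : Fin (n + 1) → ℝ} {q q' : R}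

lemma sum_frameVec_mul_ν
    (hq : q * (1 + ∑ a, algebraMap ℝ R (ν₀ a) * Y.ν a) = ∑ a, algebraMap ℝ R (w a) * Y.ν a) :
    ∑ a, Y.frameVec ν₀ w q a * Y.ν a = 0 := by
  have : ∀ a, Y.frameVec ν₀ w q a * Y.ν a = algebraMap ℝ R (w a) * Y.ν a -
      (q * (Y.ν a * Y.ν a) + q * (algebraMap ℝ R (ν₀ a) * Y.ν a)) := fun a => by
    rw [frameVec]; ring
  simp only [this, Finset.sum_sub_distrib, Finset.sum_add_distrib, ← Finset.mul_sum, Y.unit]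
  rw [← hq]
  ring

lemma sum_frameVec_mul_frameVec (hν₀ : ∑ a, ν₀ a * ν₀ a = 1) (hw : ∑ a, w a * ν₀ a = 0)
    (hw' : ∑ a, w' a * ν₀ a = 0)
    (hq : q * (1 + ∑ a, algebraMap ℝ R (ν₀ a) * Y.ν a) = ∑ a, algebraMap ℝ R (w a) * Y.ν a)
    (hq' : q' * (1 + ∑ a, algebraMap ℝ R (ν₀ a) * Y.ν a) = ∑ a, algebraMap ℝ R (w' a) * Y.ν a) :
    ∑ a, Y.frameVec ν₀ w q a * Y.frameVec ν₀ w' q' a = algebraMap ℝ R (∑ a, w a * w' a) := by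
  have e0 := congrArg (algebraMap ℝ R) hν₀
  have e1 := congrArg (algebraMap ℝ R) hw
  have e2 := congrArg (algebraMap ℝ R) hw'
  simp only [map_sum, map_mul, map_zero, map_one] at e0 e1 e2 ⊢
  have : ∀ a, Y.frameVec ν₀ w q a * Y.frameVec ν₀ w' q' a =
      algebraMap ℝ R (w a) * algebraMap ℝ R (w' a)
      - (q' * (algebraMap ℝ R (w a) * Y.ν a) + q' * (algebraMap ℝ R (w a) * algebraMap ℝ R (ν₀ a)))
      - (q * (algebraMap ℝ R (w' a) * Y.ν a) + q * (algebraMap ℝ R (w' a) * algebraMap ℝ R (ν₀ a)))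
      + (q * q' * (Y.ν a * Y.ν a) + 2 * q * q' * (algebraMap ℝ R (ν₀ a) * Y.ν a)
        + q * q' * (algebraMap ℝ R (ν₀ a) * algebraMap ℝ R (ν₀ a))) := fun a => by
    rw [frameVec, frameVec]; ring
  simp only [this, Finset.sum_sub_distrib, Finset.sum_add_distrib, ← Finset.mul_sum, Y.unit, e0, e1,
    e2, ← hq, ← hq']
  ring

/-- The Weingarten tensor on two constant vectors. -/
def constA (Y : HypersurfaceAlgebra R n) (u v : Fin (n + 1) → ℝ) : R :=
  ∑ a, ∑ b, (u a * v b) • Y.A a b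

lemma constA_symm (u v : Fin (n + 1) → ℝ) : Y.constA u v = Y.constA v u := by
  rw [constA, Finset.sum_comm]
  exact Finset.sum_congr rfl fun a _ => Finset.sum_congr rfl fun b _ => by
    rw [Y.A_symm, mul_comm]

lemma frameA_eq : Y.frameA ν₀ w w' q q' = Y.constA w w' - q * Y.constA ν₀ w' -
    q' * Y.constA w ν₀ + q * q' * Y.constA ν₀ ν₀ := by
  have h : ∀ a, ∑ b, Y.A a b * Y.frameVec ν₀ w' q' b =
      ∑ b, Y.A a b * (algebraMap ℝ R (w' b) - q' * algebraMap ℝ R (ν₀ b)) := fun a => by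
    have : ∀ b, Y.A a b * Y.frameVec ν₀ w' q' b =
        Y.A a b * (algebraMap ℝ R (w' b) - q' * algebraMap ℝ R (ν₀ b)) - q' * (Y.A a b * Y.ν b) :=
      fun b => by rw [frameVec]; ring
    simp only [this, Finset.sum_sub_distrib, ← Finset.mul_sum, Y.sum_A_mul_ν]
    ring
  have h' : ∀ b, ∑ a, Y.frameVec ν₀ w q a * Y.A a b =
      ∑ a, (algebraMap ℝ R (w a) - q * algebraMap ℝ R (ν₀ a)) * Y.A a b := fun b => by
    have : ∀ a, Y.frameVec ν₀ w q a * Y.A a b =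
        (algebraMap ℝ R (w a) - q * algebraMap ℝ R (ν₀ a)) * Y.A a b - q * (Y.ν a * Y.A a b) :=
      fun b => by rw [frameVec]; ring
    simp only [this, Finset.sum_sub_distrib, ← Finset.mul_sum, Y.sum_ν_mul_A]
    ring
  simp only [frameA, mul_assoc, ← Finset.mul_sum, h]
  simp only [Finset.mul_sum, ← mul_assoc]
  rw [Finset.sum_comm]
  simp only [← Finset.sum_mul, h']
  simp only [Finset.sum_mul]
  rw [Finset.sum_comm]
  simp only [constA, Algebra.smul_def, map_mul, Finset.mul_sum, ← Finset.sum_sub_distrib,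
    ← Finset.sum_add_distrib]
  exact Finset.sum_congr rfl fun a _ => Finset.sum_congr rfl fun b _ => by ring

/-- The evolution equation of the components of the Weingarten tensor in the rotated frame, at the
point where `ν = ν₀`: in that frame the rotation of the tangent spaces is compensated, and the
tensor satisfies the scalar equation `(∂_t - Δ) A = |A|² A`. -/
lemma IsFlow.L_frameA (hY : Y.IsFlow) (ev : R →ₐ[ℝ] ℝ) (hν : ∀ a, ev (Y.ν a) = ν₀ a)
    (hw : ∑ a, w a * ν₀ a = 0) (hw' : ∑ a, w' a * ν₀ a = 0)
    (hq : q * (1 + ∑ a, algebraMap ℝ R (ν₀ a) * Y.ν a) = ∑ a, algebraMap ℝ R (w a) * Y.ν a)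
    (hq' : q' * (1 + ∑ a, algebraMap ℝ R (ν₀ a) * Y.ν a) = ∑ a, algebraMap ℝ R (w' a) * Y.ν a) :
    ev (Y.L (Y.frameA ν₀ w w' q q')) = ev Y.N * ev (Y.frameA ν₀ w w' q q') := by
  have hunit : ∑ a, ν₀ a * ν₀ a = 1 := by
    simpa only [map_sum, map_mul, hν, map_one] using congrArg ev Y.unit
  have hm : ev (1 + ∑ a, algebraMap ℝ R (ν₀ a) * Y.ν a) = 2 := by
    simp only [map_add, map_sum, map_mul, hν, map_one, AlgHom.commutes, Algebra.algebraMap_self,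
      RingHom.id_apply, hunit]
    norm_num
  -- both coefficients vanish at the point, and their first derivatives are known there
  have hq0 : ∀ {q : R} {w : Fin (n + 1) → ℝ}, ∑ a, w a * ν₀ a = 0 →
      q * (1 + ∑ a, algebraMap ℝ R (ν₀ a) * Y.ν a) = ∑ a, algebraMap ℝ R (w a) * Y.ν a →
      ev q = 0 ∧ ∀ c, ev (Y.δ c q) = 2⁻¹ * ∑ a, w a * ev (Y.A c a) := by
    intro q w hw hq
    have h0 : ev q = 0 := by
      have := congrArg ev hq
      rw [map_mul, hm] at this
      simp only [map_sum, map_mul, hν, AlgHom.commutes, Algebra.algebraMap_self,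
        RingHom.id_apply, hw] at this
      linarith
    refine ⟨h0, fun c => ?_⟩
    have := congrArg (fun x => ev (Y.δ c x)) hq
    beta_reduce at this
    rw [Derivation.leibniz, smul_eq_mul, smul_eq_mul, map_add, map_mul, map_mul, h0, hm, zero_mul,
      zero_add] at this
    simp only [map_sum, Derivation.leibniz, smul_eq_mul, Derivation.map_algebraMap, mul_zero,
      add_zero, map_mul, AlgHom.commutes, Algebra.algebraMap_self, RingHom.id_apply] at this
    simp only [A, ← this]
    ring
  obtain ⟨q0, dq⟩ := hq0 hw hq
  obtain ⟨q0', dq'⟩ := hq0 hw' hq'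
  -- the components of `A` in the direction `ν₀` vanish at the point, but their derivatives do not
  have hz : ∀ v, ev (Y.constA ν₀ v) = 0 := fun v => by
    rw [constA, Finset.sum_comm, map_sum]
    refine Finset.sum_eq_zero fun b _ => ?_
    have := congrArg ev (Y.sum_ν_mul_A b)
    simp only [map_sum, map_mul, hν, map_zero] at this
    rw [← mul_zero (v b), ← this, map_sum, Finset.mul_sum]
    refine Finset.sum_congr rfl fun a _ => ?_
    rw [map_smul, smul_eq_mul]
    ring
  have hdz : ∀ v c, ev (Y.δ c (Y.constA ν₀ v)) = -∑ b, v b * ev (Y.A2 c b) := fun v c => by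
    rw [constA, Finset.sum_comm, map_sum, map_sum, ← Finset.sum_neg_distrib]
    refine Finset.sum_congr rfl fun b _ => ?_
    have := congrArg ev (Y.sum_ν_mul_δ_A c b)
    simp only [map_sum, map_mul, hν, map_neg] at this
    rw [← mul_neg, ← this, map_sum, map_sum, Finset.mul_sum]
    refine Finset.sum_congr rfl fun a _ => ?_
    rw [Derivation.map_smul, map_smul, smul_eq_mul]
    ring
  -- the gradient terms of the products of `q`, `q'` with components of `A` in the direction `ν₀`
  have hcross : ∀ {w w' : Fin (n + 1) → ℝ} {q : R},
      (∀ c, ev (Y.δ c q) = 2⁻¹ * ∑ a, w a * ev (Y.A c a)) →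
      ev (∑ c, Y.δ c q * Y.δ c (Y.constA ν₀ w')) =
        -(2⁻¹ * ∑ a, ∑ b, w a * w' b * ev (Y.A3 a b)) := by
    intro w w' q dq
    have h1 : ∀ c, 2⁻¹ * (∑ a, w a * ev (Y.A c a)) * -(∑ b, w' b * ev (Y.A2 c b)) =
        ∑ a, ∑ b, -(2⁻¹ * (w a * w' b * (ev (Y.A a c) * ev (Y.A2 c b)))) := fun c => by
      rw [mul_neg, mul_assoc, Finset.sum_mul_sum, Finset.mul_sum, ← Finset.sum_neg_distrib]
      refine Finset.sum_congr rfl fun a _ => ?_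
      rw [Finset.mul_sum, ← Finset.sum_neg_distrib]
      refine Finset.sum_congr rfl fun b _ => ?_
      rw [Y.A_symm a c]
      ring
    simp only [map_sum, map_mul, dq, hdz, A3, h1]
    rw [Finset.sum_comm, Finset.mul_sum, ← Finset.sum_neg_distrib]
    refine Finset.sum_congr rfl fun a _ => ?_
    rw [Finset.sum_comm, Finset.mul_sum, ← Finset.sum_neg_distrib]
    refine Finset.sum_congr rfl fun b _ => ?_
    rw [Finset.mul_sum, Finset.mul_sum, ← Finset.sum_neg_distrib]
  obtain ⟨r, r', hr⟩ := hY.exists_evolution_A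
  -- in the fixed frame the equation has the extra term `2 A³`, which the gradient terms cancel
  have hL : ev (Y.L (Y.constA w w')) = ev Y.N * ev (Y.constA w w') +
      2 * ∑ a, ∑ b, w a * w' b * ev (Y.A3 a b) := by
    have h1 : ∀ a b, ev (Y.L (Y.A a b)) = ev Y.N * ev (Y.A a b) + 2 * ev (Y.A3 a b) +
        ν₀ a * ev (r b) + ev (r' a) * ν₀ b := fun a b => by
      rw [L_apply, hr]
      simp only [map_add, map_mul, hν, map_ofNat]
    simp only [constA, map_sum, map_smul, smul_eq_mul, h1, mul_add, Finset.sum_add_distrib]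
    have h2 : ∑ a, ∑ b, w a * w' b * (ν₀ a * ev (r b)) = 0 := by
      have : ∀ a b, w a * w' b * (ν₀ a * ev (r b)) = (w a * ν₀ a) * (w' b * ev (r b)) :=
        fun a b => by ring
      simp only [this, ← Finset.mul_sum, ← Finset.sum_mul, hw, zero_mul]
    have h3 : ∑ a, ∑ b, w a * w' b * (ev (r' a) * ν₀ b) = 0 := by
      have : ∀ a b, w a * w' b * (ev (r' a) * ν₀ b) = (w a * ev (r' a)) * (w' b * ν₀ b) :=
        fun a b => by ring
      simp only [this, ← Finset.mul_sum, hw', mul_zero, Finset.sum_const_zero]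
    rw [h2, h3, add_zero, add_zero]
    simp only [Finset.mul_sum]
    congr 1 <;>
    exact Finset.sum_congr rfl fun a _ => Finset.sum_congr rfl fun b _ => by ring
  have hs : ∑ a, ∑ b, w' a * w b * ev (Y.A3 a b) = ∑ a, ∑ b, w a * w' b * ev (Y.A3 a b) := by
    rw [Finset.sum_comm]
    exact Finset.sum_congr rfl fun a _ => Finset.sum_congr rfl fun b _ => by
      rw [Y.A3_symm, mul_comm (w a)]
  have c1 := hcross (w' := w') dq
  have c2 := hcross (w' := w) dq'
  rw [hs] at c2
  rw [frameA_eq, Y.constA_symm w ν₀]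
  have hprod : ∑ c, Y.δ c (q * q') * Y.δ c (Y.constA ν₀ ν₀) =
      q * ∑ c, Y.δ c q' * Y.δ c (Y.constA ν₀ ν₀) + q' * ∑ c, Y.δ c q * Y.δ c (Y.constA ν₀ ν₀) := by
    rw [Finset.mul_sum, Finset.mul_sum, ← Finset.sum_add_distrib]
    refine Finset.sum_congr rfl fun c _ => ?_
    rw [Derivation.leibniz, smul_eq_mul, smul_eq_mul]
    ring
  simp only [map_add, map_sub, L_mul, hprod]
  simp only [map_add, map_sub, map_mul, hL, q0, q0', hz, c1, c2, map_ofNat]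
  ring

end Frame

end HypersurfaceAlgebra

end TangentialCalculus

/-! ### The area density and Green's identity -/

section TangentialCalculus

lemma Derivation.map_finset_prod {R ι : Type*} [CommRing R] [Algebra ℝ R] [DecidableEq ι]
    (D : Derivation ℝ R R) (s : Finset ι) (f : ι → R) :
    D (∏ i ∈ s, f i) = ∑ k ∈ s, D (f k) * ∏ i ∈ s.erase k, f i := by
  induction s using Finset.induction_on with
  | empty => simp
  | insert a s ha ih =>
    rw [Finset.prod_insert ha, Derivation.leibniz, ih, Finset.sum_insert ha, Finset.erase_insert ha,
      smul_eq_mul, smul_eq_mul, Finset.mul_sum, add_comm, mul_comm]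
    congr 1
    refine Finset.sum_congr rfl fun k hk => ?_
    have hka : a ≠ k := fun h => ha (h ▸ hk)
    rw [Finset.erase_insert_of_ne hka, Finset.prod_insert (fun h => ha (Finset.mem_of_mem_erase h))]
    ring

/-- Jacobi's formula. -/
lemma Derivation.map_det {R ι : Type*} [CommRing R] [Algebra ℝ R] [Fintype ι] [DecidableEq ι]
    (D : Derivation ℝ R R) (M : Matrix ι ι R) :
    D M.det = ∑ k, ∑ j, M.adjugate k j * D (M j k) := by
  have h : ∀ k, ∑ j, M.adjugate k j * D (M j k) = (M.updateCol k fun j => D (M j k)).det :=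
    fun k => by
      rw [← Matrix.cramer_apply, Matrix.cramer_eq_adjugate_mulVec]
      rfl
  simp only [h, Matrix.det_apply, map_sum]
  rw [Finset.sum_comm]
  refine Finset.sum_congr rfl fun σ _ => ?_
  rw [← Finset.smul_sum, Units.smul_def, map_zsmul, ← Units.smul_def, Derivation.map_finset_prod]
  refine congrArg _ (Finset.sum_congr rfl fun k _ => ?_)
  rw [← Finset.mul_prod_erase _ _ (Finset.mem_univ k), Matrix.updateCol_self]
  refine congrArg _ (Finset.prod_congr rfl fun i hi => ?_)
  rw [Matrix.updateCol_ne (Finset.ne_of_mem_erase hi)]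

namespace HypersurfaceAlgebra

variable {R : Type*} [CommRing R] [Algebra ℝ R] {n : ℕ} (Y : HypersurfaceAlgebra R n)

/-- The induced metric. -/
def g : Matrix (Fin n) (Fin n) R := Matrix.of fun i j => ∑ a, Y.d i (Y.X a) * Y.d j (Y.X a)

lemma g_apply (i j : Fin n) : Y.g i j = ∑ a, Y.d i (Y.X a) * Y.d j (Y.X a) := rfl

lemma gi_transpose : Y.giᵀ = Y.gi := by
  have h1 : Y.gi * Y.g = 1 := Y.gi_mul
  have hg : Y.gᵀ = Y.g := by
    ext i j
    rw [Matrix.transpose_apply, g_apply, g_apply]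
    exact Finset.sum_congr rfl fun a _ => mul_comm _ _
  have h2 : Y.g * Y.giᵀ = 1 := by
    rw [← Matrix.transpose_inj, Matrix.transpose_mul, Matrix.transpose_transpose, hg, h1,
      Matrix.transpose_one]
  calc Y.giᵀ = Y.gi * Y.g * Y.giᵀ := by rw [h1, one_mul]
    _ = Y.gi := by rw [mul_assoc, h2, mul_one]

lemma gi_symm (i j : Fin n) : Y.gi i j = Y.gi j i := congrFun₂ Y.gi_transpose j i

lemma adjugate_g : Y.g.adjugate = Y.g.det • Y.gi := by
  have h1 : Y.gi * Y.g = 1 := Y.gi_mul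
  calc Y.g.adjugate = Y.gi * Y.g * Y.g.adjugate := by rw [h1, one_mul]
    _ = _ := by rw [mul_assoc, Matrix.mul_adjugate, mul_smul_comm, mul_one]

/-- The derivative of the area density. -/
lemma D_s (D : Derivation ℝ R R) : D Y.s = Y.s * ∑ a, ∑ i, Y.V a i * D (Y.d i (Y.X a)) := by
  have h1 := congrArg D Y.s_mul_s
  have h3 : D Y.g.det = Y.s * (Y.s * ∑ k, ∑ j, Y.gi k j * D (Y.g j k)) := by
    have h2 : Y.s * Y.s = Y.g.det := Y.s_mul_s
    rw [Derivation.map_det, adjugate_g, ← mul_assoc, h2, Finset.mul_sum]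
    refine Finset.sum_congr rfl fun k _ => ?_
    rw [Finset.mul_sum]
    refine Finset.sum_congr rfl fun k _ => ?_
    rw [Matrix.smul_apply, smul_eq_mul, mul_assoc]
  have h4 : ∑ k, ∑ j, Y.gi k j * D (Y.g j k) =
      2 * ∑ a, ∑ i, Y.V a i * D (Y.d i (Y.X a)) := by
    have e1 : ∀ k j, Y.gi k j * D (Y.g j k) = ∑ a, Y.gi k j * Y.d j (Y.X a) * D (Y.d k (Y.X a)) +
        ∑ a, Y.gi j k * Y.d k (Y.X a) * D (Y.d j (Y.X a)) := fun k j => by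
      rw [g_apply, map_sum, Finset.mul_sum, ← Finset.sum_add_distrib]
      refine Finset.sum_congr rfl fun a _ => ?_
      rw [Derivation.leibniz, smul_eq_mul, smul_eq_mul, Y.gi_symm j k]
      ring
    have e2 : ∑ k, ∑ j, ∑ a, Y.gi k j * Y.d j (Y.X a) * D (Y.d k (Y.X a)) =
        ∑ a, ∑ i, Y.V a i * D (Y.d i (Y.X a)) := by
      rw [Finset.sum_comm (γ := Fin (n + 1))]
      refine Finset.sum_congr rfl fun k _ => ?_
      rw [Finset.sum_comm]
      simp only [V, Finset.sum_mul]
    simp only [e1, Finset.sum_add_distrib, e2]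
    rw [Finset.sum_comm (f := fun k j => ∑ a, Y.gi j k * Y.d k (Y.X a) * D (Y.d j (Y.X a))), e2,
      two_mul]
  rw [Derivation.leibniz, smul_eq_mul] at h1
  have h5 : Y.s * (2 * (D Y.s - Y.s * ∑ a, ∑ i, Y.V a i * D (Y.d i (Y.X a)))) = 0 := by
    have : D Y.g.det = Y.s * D Y.s + Y.s * D Y.s := h1.symm
    rw [h3, h4] at this
    linear_combination -this
  have h6 := Y.isUnit_s.mul_right_eq_zero.1 h5
  rw [← Nat.cast_ofNat, ← map_natCast (algebraMap ℝ R), ← Algebra.smul_def] at h6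
  have := congrArg (fun x => (2⁻¹ : ℝ) • x) h6
  simp only [smul_smul, Nat.cast_ofNat, smul_zero] at this
  norm_num at this
  exact sub_eq_zero.1 this

/-- The divergence form of the Laplace-Beltrami operator. -/
lemma sum_d_eq_s_mul_Δ (u : R) :
    ∑ i, Y.d i (Y.s * ∑ j, Y.gi i j * Y.d j u) = Y.s * Y.Δ u := by
  -- the gradient of `u` in terms of the tangential derivatives
  have h1 : ∀ i, ∑ j, Y.gi i j * Y.d j u = ∑ a, Y.V a i * Y.δ a u := fun i => by
    simp only [fun j => Y.d_eq_sum j u, Finset.mul_sum, V, Finset.sum_mul]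
    rw [Finset.sum_comm]
    exact Finset.sum_congr rfl fun a _ => Finset.sum_congr rfl fun b _ => by ring
  -- the divergences of the gradients of the coordinates form a normal vector
  have h2 : ∀ k, ∑ a, (∑ i, Y.d i (Y.s * Y.V a i)) * Y.d k (Y.X a) = 0 := fun k => by
    have e1 : ∀ a i, Y.d i (Y.s * Y.V a i) * Y.d k (Y.X a) =
        Y.d i (Y.s * (Y.d k (Y.X a) * Y.V a i)) - Y.s * (Y.V a i * Y.d k (Y.d i (Y.X a))) :=
      fun a i => by
        rw [← Y.comm i k]
        simp only [Derivation.leibniz, smul_eq_mul]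
        ring
    simp only [Finset.sum_mul, e1, Finset.sum_sub_distrib, ← Finset.mul_sum]
    rw [Finset.sum_comm, ← D_s]
    have e2 : ∀ i, Y.d i (if i = k then Y.s else 0) = if i = k then Y.d i Y.s else 0 := fun i => by
      split_ifs <;> simp
    simp only [← map_sum, ← Finset.mul_sum, sum_dX_mul_V, mul_ite, mul_one, mul_zero, e2]
    simp
  have aux : ∀ c : Fin (n + 1) → R, (∀ k, ∑ a, c a * Y.d k (Y.X a) = 0) →
      ∑ a, c a * Y.δ a u = 0 := fun c hc => by
    obtain ⟨z, hz⟩ : ∃ z : Fin n → R, ∀ a, Y.δ a u = ∑ k, Y.d k (Y.X a) * z k := by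
      refine ⟨fun k => ∑ i, Y.gi i k * Y.d i u, fun a => ?_⟩
      simp only [δ_apply, V, Finset.sum_mul, Finset.mul_sum]
      rw [Finset.sum_comm]
      exact Finset.sum_congr rfl fun a _ => Finset.sum_congr rfl fun b _ => by ring
    simp only [hz, Finset.mul_sum, ← mul_assoc]
    rw [Finset.sum_comm]
    simp only [← Finset.sum_mul, hc, zero_mul, Finset.sum_const_zero]
  have h3 := aux _ h2
  have h4 : ∀ a i, Y.d i (Y.s * (Y.V a i * Y.δ a u)) =
      Y.d i (Y.s * Y.V a i) * Y.δ a u + Y.s * (Y.V a i * Y.d i (Y.δ a u)) := fun a i => by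
    rw [← mul_assoc, Derivation.leibniz (Y.d i) (Y.s * Y.V a i), smul_eq_mul, smul_eq_mul]
    ring
  simp only [h1, Finset.mul_sum, map_sum, h4]
  rw [Finset.sum_comm]
  simp only [Finset.sum_add_distrib, ← Finset.sum_mul, h3, zero_add]
  rw [Δ_apply, Finset.mul_sum]
  refine Finset.sum_congr rfl fun a _ => ?_
  rw [δ_apply _ a (Y.δ a u), Finset.mul_sum]

variable {Y}

/-- Under mean curvature flow the area density decreases at the rate `H²`. -/
lemma IsFlow.τ_s (hY : Y.IsFlow) : Y.τ Y.s = -(Y.H * Y.H * Y.s) := by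
  rw [D_s]
  have : ∀ a, ∑ i, Y.V a i * Y.τ (Y.d i (Y.X a)) = -(Y.H * Y.δ a (Y.ν a) + Y.ν a * Y.δ a Y.H) :=
    fun a => by
      simp only [Y.comm_τ]
      rw [← δ_apply, hY.τ_X, map_neg, Derivation.leibniz, smul_eq_mul, smul_eq_mul]
  simp only [this, Finset.sum_neg_distrib, Finset.sum_add_distrib, sum_ν_mul_δ, ← Finset.mul_sum]
  rw [show ∑ a, Y.δ a (Y.ν a) = Y.H from rfl]
  ring

/-- Green's identity in space-time. -/
lemma IsFlow.green (hY : Y.IsFlow) (G η : R) :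
    Y.s * (G * (-Y.τ η - Y.Δ η + Y.H * Y.H * η)) = Y.s * (η * Y.L G) +
      (∑ i, Y.d i (Y.s * ∑ j, Y.gi i j * (η * Y.d j G - G * Y.d j η)) - Y.τ (Y.s * (G * η))) := by
  have h : ∀ i, Y.d i (Y.s * ∑ j, Y.gi i j * (η * Y.d j G - G * Y.d j η)) =
      η * Y.d i (Y.s * ∑ j, Y.gi i j * Y.d j G) - G * Y.d i (Y.s * ∑ j, Y.gi i j * Y.d j η) +
      (Y.s * ∑ j, Y.gi i j * Y.d j G * Y.d i η - Y.s * ∑ j, Y.gi i j * Y.d j η * Y.d i G) :=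
    fun i => by
      have : ∑ j, Y.gi i j * (η * Y.d j G - G * Y.d j η) =
          η * ∑ j, Y.gi i j * Y.d j G - G * ∑ j, Y.gi i j * Y.d j η := by
        rw [Finset.mul_sum, Finset.mul_sum, ← Finset.sum_sub_distrib]
        exact Finset.sum_congr rfl fun _ _ => by ring
      rw [this, mul_sub, map_sub, mul_left_comm, mul_left_comm Y.s G, Derivation.leibniz,
        Derivation.leibniz (Y.d i) G, ← Finset.sum_mul, ← Finset.sum_mul]
      simp only [smul_eq_mul]
      ring
  have h0 : ∑ i, ∑ j, Y.gi i j * Y.d j G * Y.d i η = ∑ i, ∑ j, Y.gi i j * Y.d j η * Y.d i G := by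
    rw [Finset.sum_comm]
    exact Finset.sum_congr rfl fun i _ => Finset.sum_congr rfl fun j _ => by
      rw [Y.gi_symm]; ring
  have hτ : Y.τ (Y.s * (G * η)) = Y.s * (G * Y.τ η + η * Y.τ G) - Y.H * Y.H * Y.s * (G * η) := by
    rw [Derivation.leibniz, Derivation.leibniz, hY.τ_s]
    simp only [smul_eq_mul]
    ring
  rw [Finset.sum_congr rfl fun i _ => h i, hτ]
  rw [Finset.sum_add_distrib, Finset.sum_sub_distrib, Finset.sum_sub_distrib, ← Finset.mul_sum,
    ← Finset.mul_sum, sum_d_eq_s_mul_Δ, sum_d_eq_s_mul_Δ, ← Finset.mul_sum, ← Finset.mul_sum, h0,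
    L_apply]
  ring

end HypersurfaceAlgebra

end TangentialCalculus

/-! ### Smooth functions on products with an interval -/

section SmoothFunctions

variable {P : Type*} [NormedAddCommGroup P] [NormedSpace ℝ P]

/-- A set on which one-sided derivatives are well defined and second derivatives are symmetric. -/
structure IsRegularSet (S : Set P) : Prop where
  uniqueDiffOn : UniqueDiffOn ℝ S
  subset_closure : S ⊆ closure (interior S)

/-- The algebra of smooth real functions on the set `S`, which need not be open. -/
def SmoothFun (S : Set P) : Subalgebra ℝ (S → ℝ) where
  carrier := {u | ∃ f : P → ℝ, ContDiffOn ℝ ∞ f S ∧ ∀ p : S, u p = f p}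
  mul_mem' := by
    rintro u v ⟨f, hf, hu⟩ ⟨g, hg, hv⟩
    exact ⟨fun p => f p * g p, hf.mul hg, fun p => by simp [hu, hv]⟩
  add_mem' := by
    rintro u v ⟨f, hf, hu⟩ ⟨g, hg, hv⟩
    exact ⟨fun p => f p + g p, hf.add hg, fun p => by simp [hu, hv]⟩
  algebraMap_mem' := fun c => ⟨fun _ => c, contDiffOn_const, fun _ => rfl⟩

namespace SmoothFun

variable {S : Set P}

/-- The element of the algebra given by a function that is smooth on `S`. -/
def mk (f : P → ℝ) (hf : ContDiffOn ℝ ∞ f S) : SmoothFun S := ⟨fun p => f p, f, hf, fun _ => rfl⟩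

/-- Some function on the ambient space that restricts to `u`. -/
noncomputable def rep (u : SmoothFun S) : P → ℝ := u.2.choose

lemma contDiffOn_rep (u : SmoothFun S) : ContDiffOn ℝ ∞ (rep u) S := u.2.choose_spec.1

lemma rep_apply (u : SmoothFun S) {p : P} (hp : p ∈ S) : rep u p = u.1 ⟨p, hp⟩ :=
  (u.2.choose_spec.2 ⟨p, hp⟩).symm

lemma ext' {u v : SmoothFun S} (h : ∀ p ∈ S, rep u p = rep v p) : u = v := by
  refine Subtype.ext (funext fun p => ?_)
  rw [← rep_apply u p.2, ← rep_apply v p.2, h p p.2]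

/-- Evaluation at a point. -/
def ev {p : P} (hp : p ∈ S) : SmoothFun S →ₐ[ℝ] ℝ :=
  (Pi.evalAlgHom ℝ (fun _ : S => ℝ) ⟨p, hp⟩).comp (SmoothFun S).val

lemma ev_eq {p : P} (hp : p ∈ S) (u : SmoothFun S) : ev hp u = rep u p := (rep_apply u hp).symm

@[simp] lemma ev_mk {p : P} (hp : p ∈ S) (f : P → ℝ) (hf : ContDiffOn ℝ ∞ f S) :
    ev hp (mk f hf) = f p := rfl

lemma eq_of_ev {u v : SmoothFun S} (h : ∀ (p : P) (hp : p ∈ S), ev hp u = ev hp v) : u = v :=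
  ext' fun p hp => by rw [← ev_eq hp, ← ev_eq hp, h p hp]

lemma isUnit_of_ne_zero {u : SmoothFun S} (h : ∀ (p : P) (hp : p ∈ S), ev hp u ≠ 0) :
    IsUnit u := by
  have hne : ∀ p ∈ S, rep u p ≠ 0 := fun p hp => by rw [← ev_eq hp]; exact h p hp
  refine IsUnit.of_mul_eq_one (mk (fun p => (rep u p)⁻¹) ((contDiffOn_rep u).inv hne)) ?_
  refine eq_of_ev fun p hp => ?_
  rw [map_mul, ev_mk, map_one, ev_eq, mul_inv_cancel₀ (hne p hp)]

variable (hS : IsRegularSet S)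
include hS

lemma contDiffOn_fderivWithin_apply {f : P → ℝ} (hf : ContDiffOn ℝ ∞ f S) (v : P) :
    ContDiffOn ℝ ∞ (fun p => fderivWithin ℝ f S p v) S :=
  (hf.fderivWithin hS.uniqueDiffOn (by simp)).clm_apply contDiffOn_const

/-- The directional derivative. -/
noncomputable def deriv (v : P) : Derivation ℝ (SmoothFun S) (SmoothFun S) :=
  have hd : ∀ (u : SmoothFun S), ∀ p ∈ S, DifferentiableWithinAt ℝ (rep u) S p := fun u =>
    (contDiffOn_rep u).differentiableOn (by simp)
  Derivation.mk'
    { toFun := fun u => mk _ (contDiffOn_fderivWithin_apply hS (contDiffOn_rep u) v)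
      map_add' := fun u w => eq_of_ev fun p hp => by
        have : EqOn (rep (u + w)) (rep u + rep w) S := fun q hq => by
          rw [Pi.add_apply, ← ev_eq hq, ← ev_eq hq, ← ev_eq hq, map_add]
        rw [map_add, ev_mk, ev_mk, ev_mk, fderivWithin_congr this (this hp),
          fderivWithin_add (hS.uniqueDiffOn p hp) (hd u p hp) (hd w p hp)]
        rfl
      map_smul' := fun c u => eq_of_ev fun p hp => by
        have : EqOn (rep (c • u)) (c • rep u) S := fun q hq => by
          rw [Pi.smul_apply, ← ev_eq hq, ← ev_eq hq, map_smul]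
        rw [map_smul, ev_mk, ev_mk, fderivWithin_congr this (this hp),
          fderivWithin_const_smul (hS.uniqueDiffOn p hp) (hd u p hp)]
        rfl }
    fun u w => eq_of_ev fun p hp => by
      have : EqOn (rep (u * w)) (fun q => rep u q * rep w q) S := fun q hq => by
        beta_reduce
        rw [← ev_eq hq, ← ev_eq hq, ← ev_eq hq, map_mul]
      simp only [LinearMap.coe_mk, AddHom.coe_mk]
      rw [smul_eq_mul, smul_eq_mul, map_add, map_mul, map_mul, ev_mk, ev_mk, ev_mk,
        fderivWithin_congr this (this hp),
        fderivWithin_fun_mul (hS.uniqueDiffOn p hp) (hd u p hp) (hd w p hp), ev_eq hp, ev_eq hp]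
      rfl

lemma ev_deriv (v : P) (u : SmoothFun S) {p : P} (hp : p ∈ S) :
    ev hp (deriv hS v u) = fderivWithin ℝ (rep u) S p v := rfl

lemma ev_deriv_of_eqOn (v : P) (u : SmoothFun S) {f : P → ℝ} (hf : ∀ p (hp : p ∈ S), ev hp u = f p)
    {p : P} (hp : p ∈ S) : ev hp (deriv hS v u) = fderivWithin ℝ f S p v := by
  rw [ev_deriv, fderivWithin_congr (fun q hq => by rw [← ev_eq hq, hf]) (by rw [← ev_eq hp, hf])]

lemma deriv_comm (v w : P) (u : SmoothFun S) :
    deriv hS v (deriv hS w u) = deriv hS w (deriv hS v u) := by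
  refine eq_of_ev fun p hp => ?_
  have hd : DifferentiableWithinAt ℝ (fderivWithin ℝ (rep u) S) S p :=
    ((contDiffOn_rep u).fderivWithin (m := ∞) hS.uniqueDiffOn (by simp)).differentiableOn (by simp)
      p hp
  have h : ∀ v w : P, ev hp (deriv hS v (deriv hS w u)) =
      fderivWithin ℝ (fderivWithin ℝ (rep u) S) S p v w := fun v w => by
    rw [ev_deriv_of_eqOn hS v _ (fun q hq => ev_deriv hS w u hq),
      fderivWithin_clm_apply (hS.uniqueDiffOn p hp) hd (differentiableWithinAt_const w)]
    simp
  rw [h, h]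
  refine (ContDiffWithinAt.isSymmSndFDerivWithinAt ((contDiffOn_rep u) p hp) ?_ hS.uniqueDiffOn
    (hS.subset_closure hp) hp) v w
  rw [minSmoothness_of_isRCLikeNormedField]
  exact WithTop.coe_le_coe.2 (le_top : (2 : ℕ∞) ≤ ⊤)

end SmoothFun

variable {E : Type*} [NormedAddCommGroup E] [NormedSpace ℝ E]

lemma nonempty_interior_of_ordConnected {J : Set ℝ} (hJ : J.OrdConnected) (hJ' : J.Nontrivial) :
    (interior J).Nonempty := by
  obtain ⟨a, ha, b, hb, hab⟩ := hJ'.exists_lt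
  obtain ⟨c, hc⟩ := exists_between hab
  exact ⟨c, mem_interior.2 ⟨Ioo a b, Ioo_subset_Icc_self.trans (hJ.out ha hb), isOpen_Ioo, hc⟩⟩

lemma isRegularSet_prod {Ω : Set E} {J : Set ℝ} (hΩ : IsOpen Ω) (hJ : J.OrdConnected)
    (hJ' : J.Nontrivial) : IsRegularSet (Ω ×ˢ J) := by
  have hne := nonempty_interior_of_ordConnected hJ hJ'
  have hc : Convex ℝ J := hJ.convex
  refine ⟨hΩ.uniqueDiffOn.prod (uniqueDiffOn_convex hc hne), ?_⟩
  rw [interior_prod_eq, closure_prod_eq, hΩ.interior_eq,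
    hc.closure_interior_eq_closure_of_nonempty_interior hne]
  exact prod_mono subset_closure subset_closure

section Slices

variable {W : Type*} [NormedAddCommGroup W] [NormedSpace ℝ W] {Ω : Set E} {J : Set ℝ}
  {f : E × ℝ → W} {p : E × ℝ}

lemma hasFDerivAt_slice (hΩ : IsOpen Ω) (hp : p ∈ Ω ×ˢ J)
    (hf : DifferentiableWithinAt ℝ f (Ω ×ˢ J) p) : HasFDerivAt (fun y => f (y, p.2))
      ((fderivWithin ℝ f (Ω ×ˢ J) p).comp (ContinuousLinearMap.inl ℝ E ℝ)) p.1 := by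
  have h1 : HasFDerivWithinAt (fun y : E => (y, p.2)) (ContinuousLinearMap.inl ℝ E ℝ) Ω p.1 :=
    (hasFDerivAt_prodMk_left (𝕜 := ℝ) p.1 p.2).hasFDerivWithinAt
  have h2 : HasFDerivWithinAt f (fderivWithin ℝ f (Ω ×ˢ J) p) (Ω ×ˢ J) (p.1, p.2) :=
    hf.hasFDerivWithinAt
  have h3 := HasFDerivWithinAt.comp (g := f) (f := fun y : E => (y, p.2)) p.1 h2 h1
    fun y hy => ⟨hy, hp.2⟩
  exact h3.hasFDerivAt (hΩ.mem_nhds hp.1)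

lemma hasDerivWithinAt_slice (hp : p ∈ Ω ×ˢ J)
    (hf : DifferentiableWithinAt ℝ f (Ω ×ˢ J) p) : HasDerivWithinAt (fun s => f (p.1, s))
      (fderivWithin ℝ f (Ω ×ˢ J) p (0, 1)) J p.2 := by
  have h1 : HasDerivWithinAt (fun s : ℝ => (p.1, s)) ((0 : E), (1 : ℝ)) J p.2 :=
    ((hasDerivAt_const p.2 p.1).prodMk (hasDerivAt_id p.2)).hasDerivWithinAt
  have h2 : HasFDerivWithinAt f (fderivWithin ℝ f (Ω ×ˢ J) p) (Ω ×ˢ J) (p.1, p.2) :=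
    hf.hasFDerivWithinAt
  exact HasFDerivWithinAt.comp_hasDerivWithinAt (f := fun s : ℝ => (p.1, s)) p.2 h2 h1
    fun s hs => ⟨hp.1, hs⟩

end Slices

end SmoothFunctions

/-! ### Hypersurfaces in coordinates -/

section Coordinates

variable {n : ℕ}

/-- The matrix of the inner product pulled back by the linear map `T`. -/
noncomputable def gramMatrix (T : EuclideanSpace ℝ (Fin n) →L[ℝ] EuclideanSpace ℝ (Fin (n + 1))) :
    Matrix (Fin n) (Fin n) ℝ :=
  Matrix.of fun i j => inner ℝ (T (EuclideanSpace.single i 1)) (T (EuclideanSpace.single j 1))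

variable {T : EuclideanSpace ℝ (Fin n) →L[ℝ] EuclideanSpace ℝ (Fin (n + 1))}

lemma det_gramMatrix_pos (hT : Function.Injective T) : 0 < (gramMatrix T).det := by
  have hli : LinearIndependent ℝ fun i : Fin n => T (EuclideanSpace.single i (1 : ℝ)) := by
    have := (EuclideanSpace.basisFun (Fin n) ℝ).toBasis.linearIndependent.map'
      (T : EuclideanSpace ℝ (Fin n) →ₗ[ℝ] EuclideanSpace ℝ (Fin (n + 1)))
      (LinearMap.ker_eq_bot.2 hT)
    simpa [Function.comp_def] using this
  exact (Matrix.posDef_gram_of_linearIndependent hli).det_pos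

/-- The vector whose image under `T` is the projection of the ambient coordinate vector `e_a` to
the range of `T`. -/
noncomputable def tangentGrad (T : EuclideanSpace ℝ (Fin n) →L[ℝ] EuclideanSpace ℝ (Fin (n + 1)))
    (a : Fin (n + 1)) : EuclideanSpace ℝ (Fin n) :=
  WithLp.toLp 2 fun i => ∑ j, (gramMatrix T)⁻¹ i j * T (EuclideanSpace.single j 1) a

lemma euclidean_sum_single (w : EuclideanSpace ℝ (Fin n)) :
    w = ∑ j, w j • EuclideanSpace.single j (1 : ℝ) := by
  simpa using ((EuclideanSpace.basisFun (Fin n) ℝ).sum_repr w).symm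

lemma inner_map_tangentGrad (hT : Function.Injective T) (a : Fin (n + 1))
    (w : EuclideanSpace ℝ (Fin n)) : inner ℝ (T (tangentGrad T a)) (T w) = T w a := by
  have hu : IsUnit (gramMatrix T).det := (det_gramMatrix_pos hT).ne'.isUnit
  have key : ∀ k, inner ℝ (T (tangentGrad T a)) (T (EuclideanSpace.single k 1)) =
      T (EuclideanSpace.single k 1) a := fun k => by
    rw [euclidean_sum_single (tangentGrad T a), map_sum, sum_inner]
    simp only [map_smul, inner_smul_left, conj_trivial, tangentGrad, Finset.sum_mul]
    rw [Finset.sum_comm]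
    have : ∀ j, ∑ i, (gramMatrix T)⁻¹ i j * T (EuclideanSpace.single j 1) a *
        inner ℝ (T (EuclideanSpace.single i 1)) (T (EuclideanSpace.single k 1)) =
        T (EuclideanSpace.single j 1) a * (gramMatrix T * (gramMatrix T)⁻¹) k j := fun j => by
      rw [Matrix.mul_apply, Finset.mul_sum]
      refine Finset.sum_congr rfl fun i _ => ?_
      rw [gramMatrix, Matrix.of_apply, real_inner_comm]
      ring
    simp only [this, Matrix.mul_nonsing_inv _ hu, Matrix.one_apply]
    simp
  rw [euclidean_sum_single w, map_sum, inner_sum]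
  simp [inner_smul_right, key]

lemma eq_tangentGrad (hT : Function.Injective T) {a : Fin (n + 1)} {v : EuclideanSpace ℝ (Fin n)}
    (h : ∀ w, inner ℝ (T v) (T w) = T w a) : v = tangentGrad T a := by
  refine hT (sub_eq_zero.1 (inner_self_eq_zero (𝕜 := ℝ).1 ?_))
  rw [inner_sub_left, ← map_sub, h, inner_map_tangentGrad hT, sub_self]

lemma map_tangentGrad_comp {B : EuclideanSpace ℝ (Fin n) →L[ℝ] EuclideanSpace ℝ (Fin n)}
    (hT : Function.Injective T) (hTB : Function.Injective (T.comp B)) (a : Fin (n + 1)) :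
    B (tangentGrad (T.comp B) a) = tangentGrad T a := by
  refine eq_tangentGrad hT fun w => ?_
  have hB : Function.Injective B := fun x y h => hTB (by simp [h])
  obtain ⟨w, rfl⟩ := (LinearMap.injective_iff_surjective
    (f := (B : EuclideanSpace ℝ (Fin n) →ₗ[ℝ] EuclideanSpace ℝ (Fin n)))).1 hB w
  exact inner_map_tangentGrad hTB a w

/-- The Laplace-Beltrami operator in coordinates, in divergence form, of the metric induced by the
immersion `Z`. -/
noncomputable def coordLaplacian {V : Type*} [NormedAddCommGroup V] [NormedSpace ℝ V]
    (Z : EuclideanSpace ℝ (Fin n) → EuclideanSpace ℝ (Fin (n + 1)))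
    (u : EuclideanSpace ℝ (Fin n) → V) (x : EuclideanSpace ℝ (Fin n)) : V :=
  (Real.sqrt (gramMatrix (fderiv ℝ Z x)).det)⁻¹ •
    ∑ i : Fin n, fderiv ℝ
      (fun y => ∑ j : Fin n, (Real.sqrt (gramMatrix (fderiv ℝ Z y)).det *
        (gramMatrix (fderiv ℝ Z y))⁻¹ i j) • fderiv ℝ u y (EuclideanSpace.single j 1))
      x (EuclideanSpace.single i 1)

/-- The immersions `Z(·, t)` of the open set `Ω`, for `t` in the interval `J`, with unit normals
`N(·, t)`. -/
structure IsCoordHypersurface (Ω : Set (EuclideanSpace ℝ (Fin n))) (J : Set ℝ)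
    (Z N : EuclideanSpace ℝ (Fin n) × ℝ → EuclideanSpace ℝ (Fin (n + 1))) : Prop where
  isOpen : IsOpen Ω
  ordConnected : J.OrdConnected
  nontrivial : J.Nontrivial
  smooth : ContDiffOn ℝ ∞ Z (Ω ×ˢ J)
  smooth_normal : ContDiffOn ℝ ∞ N (Ω ×ˢ J)
  injective : ∀ p ∈ Ω ×ˢ J, Function.Injective (fderiv ℝ (fun y => Z (y, p.2)) p.1)
  norm_eq_one : ∀ p ∈ Ω ×ˢ J, ‖N p‖ = 1
  normal : ∀ p ∈ Ω ×ˢ J, ∀ v, inner ℝ (fderiv ℝ (fun y => Z (y, p.2)) p.1 v) (N p) = 0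

namespace IsCoordHypersurface

variable {Ω : Set (EuclideanSpace ℝ (Fin n))} {J : Set ℝ}
  {Z N : EuclideanSpace ℝ (Fin n) × ℝ → EuclideanSpace ℝ (Fin (n + 1))}
  {p : EuclideanSpace ℝ (Fin n) × ℝ}

lemma regular (h : IsCoordHypersurface Ω J Z N) : IsRegularSet (Ω ×ˢ J) :=
  isRegularSet_prod h.isOpen h.ordConnected h.nontrivial

/-- The `i`-th coordinate derivative. -/
noncomputable def d (h : IsCoordHypersurface Ω J Z N) (i : Fin n) :
    Derivation ℝ (SmoothFun (Ω ×ˢ J)) (SmoothFun (Ω ×ˢ J)) :=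
  SmoothFun.deriv h.regular (EuclideanSpace.single i 1, 0)

/-- The time derivative. -/
noncomputable def τ (h : IsCoordHypersurface Ω J Z N) :
    Derivation ℝ (SmoothFun (Ω ×ˢ J)) (SmoothFun (Ω ×ˢ J)) :=
  SmoothFun.deriv h.regular (0, 1)

lemma ev_d (h : IsCoordHypersurface Ω J Z N) {u : SmoothFun (Ω ×ˢ J)}
    {f : EuclideanSpace ℝ (Fin n) × ℝ → ℝ} (hf : ∀ p (hp : p ∈ Ω ×ˢ J), SmoothFun.ev hp u = f p)
    (hp : p ∈ Ω ×ˢ J) (i : Fin n) : SmoothFun.ev hp (h.d i u) =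
      fderiv ℝ (fun y => f (y, p.2)) p.1 (EuclideanSpace.single i 1) := by
  have h1 := hasFDerivAt_slice h.isOpen hp
    ((SmoothFun.contDiffOn_rep u).differentiableOn (by simp) p hp)
  have h2 : (fun y => f (y, p.2)) =ᶠ[𝓝 p.1] fun y => SmoothFun.rep u (y, p.2) := by
    filter_upwards [h.isOpen.mem_nhds hp.1] with y hy
    have hy' : (y, p.2) ∈ Ω ×ˢ J := ⟨hy, hp.2⟩
    rw [← hf _ hy', SmoothFun.ev_eq]
  rw [h2.fderiv_eq, h1.fderiv]
  rfl

lemma ev_τ (h : IsCoordHypersurface Ω J Z N) {u : SmoothFun (Ω ×ˢ J)}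
    {f : EuclideanSpace ℝ (Fin n) × ℝ → ℝ} (hf : ∀ p (hp : p ∈ Ω ×ˢ J), SmoothFun.ev hp u = f p)
    (hp : p ∈ Ω ×ˢ J) : SmoothFun.ev hp (h.τ u) = derivWithin (fun s => f (p.1, s)) J p.2 := by
  have h1 := hasDerivWithinAt_slice hp
    ((SmoothFun.contDiffOn_rep u).differentiableOn (by simp) p hp)
  have h2 : ∀ s ∈ J, f (p.1, s) = SmoothFun.rep u (p.1, s) := fun s hs => by
    have hs' : (p.1, s) ∈ Ω ×ˢ J := ⟨hp.1, hs⟩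
    rw [← hf _ hs', SmoothFun.ev_eq]
  have h3 : UniqueDiffWithinAt ℝ J p.2 :=
    uniqueDiffOn_convex h.ordConnected.convex
      (nonempty_interior_of_ordConnected h.ordConnected h.nontrivial) _ hp.2
  rw [derivWithin_congr h2 (h2 _ hp.2), h1.derivWithin h3]
  rfl

/-- The components of the position. -/
noncomputable def X (h : IsCoordHypersurface Ω J Z N) (a : Fin (n + 1)) : SmoothFun (Ω ×ˢ J) :=
  SmoothFun.mk (fun p => Z p a) (contDiffOn_euclidean.1 h.smooth a)

/-- The components of the unit normal. -/
noncomputable def ν (h : IsCoordHypersurface Ω J Z N) (a : Fin (n + 1)) : SmoothFun (Ω ×ˢ J) :=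
  SmoothFun.mk (fun p => N p a) (contDiffOn_euclidean.1 h.smooth_normal a)

/-- The induced metric. -/
noncomputable def metric (h : IsCoordHypersurface Ω J Z N) :
    Matrix (Fin n) (Fin n) (SmoothFun (Ω ×ˢ J)) :=
  Matrix.of fun i j => ∑ a, h.d i (h.X a) * h.d j (h.X a)

lemma differentiableAt_slice (h : IsCoordHypersurface Ω J Z N) (hp : p ∈ Ω ×ˢ J) :
    DifferentiableAt ℝ (fun y => Z (y, p.2)) p.1 :=
  (hasFDerivAt_slice h.isOpen hp (h.smooth.differentiableOn (by simp) p hp)).differentiableAt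

lemma differentiableAt_slice_normal (h : IsCoordHypersurface Ω J Z N) (hp : p ∈ Ω ×ˢ J) :
    DifferentiableAt ℝ (fun y => N (y, p.2)) p.1 :=
  (hasFDerivAt_slice h.isOpen hp (h.smooth_normal.differentiableOn (by simp) p hp)).differentiableAt

lemma fderiv_euclidean_apply {E : Type*} [NormedAddCommGroup E] [NormedSpace ℝ E] {m : ℕ}
    {f : E → EuclideanSpace ℝ (Fin m)} {x : E} (hf : DifferentiableAt ℝ f x) (a : Fin m) (v : E) :
    fderiv ℝ (fun y => f y a) x v = fderiv ℝ f x v a := by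
  have h1 := (EuclideanSpace.proj (𝕜 := ℝ) a : EuclideanSpace ℝ (Fin m) →L[ℝ] ℝ).hasFDerivAt.comp
    x hf.hasFDerivAt
  have h2 : HasFDerivAt (fun y => f y a) _ x := h1
  rw [h2.fderiv]
  rfl

lemma ev_d_X (h : IsCoordHypersurface Ω J Z N) (hp : p ∈ Ω ×ˢ J) (i : Fin n) (a : Fin (n + 1)) :
    SmoothFun.ev hp (h.d i (h.X a)) =
      fderiv ℝ (fun y => Z (y, p.2)) p.1 (EuclideanSpace.single i 1) a := by
  rw [← fderiv_euclidean_apply (h.differentiableAt_slice hp)]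
  exact h.ev_d (f := fun p => Z p a) (fun _ _ => rfl) hp i

lemma ev_metric (h : IsCoordHypersurface Ω J Z N) (hp : p ∈ Ω ×ˢ J) :
    h.metric.map (SmoothFun.ev hp) = gramMatrix (fderiv ℝ (fun y => Z (y, p.2)) p.1) := by
  ext i j
  simp only [metric, Matrix.map_apply, Matrix.of_apply, map_sum, map_mul, h.ev_d_X hp, gramMatrix,
    PiLp.inner_apply]
  exact Finset.sum_congr rfl fun _ _ => by simp [mul_comm]

lemma ev_det_metric (h : IsCoordHypersurface Ω J Z N) (hp : p ∈ Ω ×ˢ J) :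
    SmoothFun.ev hp h.metric.det = (gramMatrix (fderiv ℝ (fun y => Z (y, p.2)) p.1)).det := by
  rw [← h.ev_metric hp]
  exact (SmoothFun.ev hp).map_det _

lemma ev_det_metric_pos (h : IsCoordHypersurface Ω J Z N) (hp : p ∈ Ω ×ˢ J) :
    0 < SmoothFun.ev hp h.metric.det := by
  rw [h.ev_det_metric hp]
  exact det_gramMatrix_pos (h.injective p hp)

lemma isUnit_det_metric (h : IsCoordHypersurface Ω J Z N) : IsUnit h.metric.det :=
  SmoothFun.isUnit_of_ne_zero fun _ hp => (h.ev_det_metric_pos hp).ne'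

/-- The area density. -/
noncomputable def s (h : IsCoordHypersurface Ω J Z N) : SmoothFun (Ω ×ˢ J) :=
  SmoothFun.mk (fun p => Real.sqrt (SmoothFun.rep h.metric.det p))
    ((SmoothFun.contDiffOn_rep _).sqrt fun p hp => by
      rw [← SmoothFun.ev_eq hp]
      exact (h.ev_det_metric_pos hp).ne')

lemma ev_s (h : IsCoordHypersurface Ω J Z N) (hp : p ∈ Ω ×ˢ J) : SmoothFun.ev hp h.s =
    Real.sqrt (gramMatrix (fderiv ℝ (fun y => Z (y, p.2)) p.1)).det := by
  rw [s, SmoothFun.ev_mk, ← SmoothFun.ev_eq hp, h.ev_det_metric hp]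

lemma ev_s_pos (h : IsCoordHypersurface Ω J Z N) (hp : p ∈ Ω ×ˢ J) : 0 < SmoothFun.ev hp h.s := by
  rw [h.ev_s hp]
  exact Real.sqrt_pos.2 (det_gramMatrix_pos (h.injective p hp))

/-- The algebra of smooth functions of a hypersurface in coordinates. -/
noncomputable def alg (h : IsCoordHypersurface Ω J Z N) :
    HypersurfaceAlgebra (SmoothFun (Ω ×ˢ J)) n where
  d := h.d
  τ := h.τ
  X := h.X
  ν := h.ν
  gi := h.metric⁻¹
  s := h.s
  comm i j u := SmoothFun.deriv_comm _ _ _ _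
  comm_τ i u := SmoothFun.deriv_comm _ _ _ _
  gi_mul := Matrix.nonsing_inv_mul _ h.isUnit_det_metric
  unit := SmoothFun.eq_of_ev fun p hp => by
    have h1 := h.norm_eq_one p hp
    have h2 := real_inner_self_eq_norm_sq (N p)
    rw [h1, PiLp.inner_apply] at h2
    simp only [map_sum, map_mul, map_one, ν, SmoothFun.ev_mk]
    simpa [sq] using h2
  normal i := SmoothFun.eq_of_ev fun p hp => by
    have h1 := h.normal p hp (EuclideanSpace.single i 1)
    rw [PiLp.inner_apply] at h1
    simp only [map_sum, map_mul, map_zero, h.ev_d_X hp, ν, SmoothFun.ev_mk]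
    rw [← h1]
    exact Finset.sum_congr rfl fun _ _ => by simp [mul_comm]
  s_mul_s := SmoothFun.eq_of_ev fun p hp => by
    rw [map_mul, h.ev_s hp, Real.mul_self_sqrt (det_gramMatrix_pos (h.injective p hp)).le]
    exact (h.ev_det_metric hp).symm
  isUnit_s := SmoothFun.isUnit_of_ne_zero fun _ hp => (h.ev_s_pos hp).ne'

lemma ev_gi (h : IsCoordHypersurface Ω J Z N) (hp : p ∈ Ω ×ˢ J) (i j : Fin n) :
    SmoothFun.ev hp (h.alg.gi i j) = (gramMatrix (fderiv ℝ (fun y => Z (y, p.2)) p.1))⁻¹ i j := by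
  have h1 : h.alg.gi.map (SmoothFun.ev hp) *
      gramMatrix (fderiv ℝ (fun y => Z (y, p.2)) p.1) = 1 := by
    rw [← h.ev_metric hp, ← Matrix.map_mul]
    have : h.alg.gi * h.metric = 1 := h.alg.gi_mul
    rw [this, Matrix.map_one _ (map_zero _) (map_one _)]
  rw [Matrix.inv_eq_left_inv h1, Matrix.map_apply]

lemma ev_V (h : IsCoordHypersurface Ω J Z N) (hp : p ∈ Ω ×ˢ J) (a : Fin (n + 1)) (i : Fin n) :
    SmoothFun.ev hp (h.alg.V a i) = tangentGrad (fderiv ℝ (fun y => Z (y, p.2)) p.1) a i := by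
  simp only [HypersurfaceAlgebra.V, map_sum, map_mul, h.ev_gi hp, tangentGrad]
  exact Finset.sum_congr rfl fun j _ => congrArg _ (h.ev_d_X hp j a)

lemma ev_δ (h : IsCoordHypersurface Ω J Z N) {u : SmoothFun (Ω ×ˢ J)}
    {f : EuclideanSpace ℝ (Fin n) × ℝ → ℝ} (hf : ∀ p (hp : p ∈ Ω ×ˢ J), SmoothFun.ev hp u = f p)
    (hp : p ∈ Ω ×ˢ J) (a : Fin (n + 1)) : SmoothFun.ev hp (h.alg.δ a u) =
      fderiv ℝ (fun y => f (y, p.2)) p.1 (tangentGrad (fderiv ℝ (fun y => Z (y, p.2)) p.1) a) := by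
  rw [HypersurfaceAlgebra.δ_apply, euclidean_sum_single (tangentGrad _ a), map_sum, map_sum]
  refine Finset.sum_congr rfl fun i _ => ?_
  rw [map_mul, map_smul, h.ev_V hp, smul_eq_mul]
  exact congrArg _ (h.ev_d hf hp i)

lemma ev_Δ (h : IsCoordHypersurface Ω J Z N) {u : SmoothFun (Ω ×ˢ J)}
    {f : EuclideanSpace ℝ (Fin n) × ℝ → ℝ} (hf : ∀ p (hp : p ∈ Ω ×ˢ J), SmoothFun.ev hp u = f p)
    (hp : p ∈ Ω ×ˢ J) : SmoothFun.ev hp (h.alg.Δ u) =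
      coordLaplacian (fun y => Z (y, p.2)) (fun y => f (y, p.2)) p.1 := by
  have h1 := congrArg (SmoothFun.ev hp) (h.alg.sum_d_eq_s_mul_Δ u)
  have h2 : ∀ i, ∀ q (hq : q ∈ Ω ×ˢ J),
      SmoothFun.ev hq (h.alg.s * ∑ j, h.alg.gi i j * h.alg.d j u) =
      ∑ j : Fin n, (Real.sqrt (gramMatrix (fderiv ℝ (fun y => Z (y, q.2)) q.1)).det *
        (gramMatrix (fderiv ℝ (fun y => Z (y, q.2)) q.1))⁻¹ i j) •
          fderiv ℝ (fun y => f (y, q.2)) q.1 (EuclideanSpace.single j 1) := fun i q hq => by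
    have e1 : SmoothFun.ev hq h.alg.s = _ := h.ev_s hq
    have e2 : ∀ j, SmoothFun.ev hq (h.alg.d j u) = _ := fun j => h.ev_d hf hq j
    simp only [map_mul, map_sum, h.ev_gi hq, e1, e2, Finset.mul_sum, smul_eq_mul, mul_assoc]
  have h3 : ∀ i, SmoothFun.ev hp (h.alg.d i (h.alg.s * ∑ j, h.alg.gi i j * h.alg.d j u)) = _ :=
    fun i => h.ev_d (h2 i) hp i
  have h4 : SmoothFun.ev hp h.alg.s = _ := h.ev_s hp
  have h5 : SmoothFun.ev hp h.alg.s ≠ 0 := (h.ev_s_pos hp).ne'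
  rw [map_sum, Finset.sum_congr rfl fun i _ => h3 i, map_mul] at h1
  rw [coordLaplacian, h1, ← h4, smul_eq_mul, inv_mul_cancel_left₀ h5]

/-- Tangential derivatives do not depend on the choice of coordinates. -/
lemma ev_δ_comp {Ω' : Set (EuclideanSpace ℝ (Fin n))}
    {Z' N' : EuclideanSpace ℝ (Fin n) × ℝ → EuclideanSpace ℝ (Fin (n + 1))}
    (h : IsCoordHypersurface Ω J Z N) (h' : IsCoordHypersurface Ω' J Z' N')
    {ψ : EuclideanSpace ℝ (Fin n) → EuclideanSpace ℝ (Fin n)} (hψ : MapsTo ψ Ω' Ω)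
    (hψd : DifferentiableOn ℝ ψ Ω') (hZ : ∀ y ∈ Ω', ∀ t ∈ J, Z' (y, t) = Z (ψ y, t))
    {u : SmoothFun (Ω ×ˢ J)} {u' : SmoothFun (Ω' ×ˢ J)}
    (hu : ∀ y (hy : y ∈ Ω') t (ht : t ∈ J), SmoothFun.ev (mk_mem_prod hy ht) u' =
      SmoothFun.ev (mk_mem_prod (hψ hy) ht) u) (a : Fin (n + 1))
    {y : EuclideanSpace ℝ (Fin n)} (hy : y ∈ Ω') {t : ℝ} (ht : t ∈ J) :
    SmoothFun.ev (mk_mem_prod hy ht) (h'.alg.δ a u') =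
      SmoothFun.ev (mk_mem_prod (hψ hy) ht) (h.alg.δ a u) := by
  have hp : (ψ y, t) ∈ Ω ×ˢ J := ⟨hψ hy, ht⟩
  have hp' : (y, t) ∈ Ω' ×ˢ J := ⟨hy, ht⟩
  have hd : DifferentiableAt ℝ ψ y := hψd.differentiableAt (h'.isOpen.mem_nhds hy)
  have hZ' : fderiv ℝ (fun y => Z' (y, t)) y =
      (fderiv ℝ (fun y => Z (y, t)) (ψ y)).comp (fderiv ℝ ψ y) := by
    rw [← fderiv_comp y (h.differentiableAt_slice hp) hd]
    refine Filter.EventuallyEq.fderiv_eq ?_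
    filter_upwards [h'.isOpen.mem_nhds hy] with z hz using hZ z hz t ht
  have hu' : fderiv ℝ (fun y => SmoothFun.rep u' (y, t)) y =
      (fderiv ℝ (fun y => SmoothFun.rep u (y, t)) (ψ y)).comp (fderiv ℝ ψ y) := by
    have := hasFDerivAt_slice h.isOpen hp
      ((SmoothFun.contDiffOn_rep u).differentiableOn (by simp) _ hp)
    rw [← fderiv_comp y this.differentiableAt hd]
    refine Filter.EventuallyEq.fderiv_eq ?_
    filter_upwards [h'.isOpen.mem_nhds hy] with z hz
    have hz' : (z, t) ∈ Ω' ×ˢ J := ⟨hz, ht⟩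
    have hz'' : (ψ z, t) ∈ Ω ×ˢ J := ⟨hψ hz, ht⟩
    simp only [Function.comp_apply]
    rw [← SmoothFun.ev_eq hz', ← SmoothFun.ev_eq hz'']
    exact hu z hz t ht
  have hi := h'.injective _ hp'
  rw [h.ev_δ (fun q hq => SmoothFun.ev_eq hq u) hp, h'.ev_δ (fun q hq => SmoothFun.ev_eq hq u') hp']
  simp only at hi ⊢
  rw [hZ'] at hi ⊢
  rw [hu', ContinuousLinearMap.comp_apply, map_tangentGrad_comp (h.injective _ hp) hi]

lemma ev_Δ_comp {Ω' : Set (EuclideanSpace ℝ (Fin n))}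
    {Z' N' : EuclideanSpace ℝ (Fin n) × ℝ → EuclideanSpace ℝ (Fin (n + 1))}
    (h : IsCoordHypersurface Ω J Z N) (h' : IsCoordHypersurface Ω' J Z' N')
    {ψ : EuclideanSpace ℝ (Fin n) → EuclideanSpace ℝ (Fin n)} (hψ : MapsTo ψ Ω' Ω)
    (hψd : DifferentiableOn ℝ ψ Ω') (hZ : ∀ y ∈ Ω', ∀ t ∈ J, Z' (y, t) = Z (ψ y, t))
    {u : SmoothFun (Ω ×ˢ J)} {u' : SmoothFun (Ω' ×ˢ J)}
    (hu : ∀ y (hy : y ∈ Ω') t (ht : t ∈ J), SmoothFun.ev (mk_mem_prod hy ht) u' =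
      SmoothFun.ev (mk_mem_prod (hψ hy) ht) u)
    {y : EuclideanSpace ℝ (Fin n)} (hy : y ∈ Ω') {t : ℝ} (ht : t ∈ J) :
    SmoothFun.ev (mk_mem_prod hy ht) (h'.alg.Δ u') =
      SmoothFun.ev (mk_mem_prod (hψ hy) ht) (h.alg.Δ u) := by
  rw [HypersurfaceAlgebra.Δ_apply, HypersurfaceAlgebra.Δ_apply, map_sum, map_sum]
  refine Finset.sum_congr rfl fun a _ => ?_
  exact h.ev_δ_comp h' hψ hψd hZ
    (fun z hz s hs => h.ev_δ_comp h' hψ hψd hZ hu a hz hs) a hy ht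

end IsCoordHypersurface

end Coordinates

/-! ### Charts of the manifold -/

section Charts

variable {n : ℕ} {M : Type*} [TopologicalSpace M] [ChartedSpace (EuclideanSpace ℝ (Fin n)) M]
  {e : OpenPartialHomeomorph M (EuclideanSpace ℝ (Fin n))}

/-- The expression of a time-dependent function in the chart `e`. -/
def inChart {V : Type*} (e : OpenPartialHomeomorph M (EuclideanSpace ℝ (Fin n))) (u : ℝ → M → V) :
    EuclideanSpace ℝ (Fin n) × ℝ → V := fun p => u p.2 (e.symm p.1)

variable [IsManifold (𝓡 n) ∞ M] {V : Type*} [NormedAddCommGroup V] [NormedSpace ℝ V]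

lemma contDiffOn_inChart (he : e ∈ atlas (EuclideanSpace ℝ (Fin n)) M) {u : ℝ → M → V} {U : Set M}
    {J : Set ℝ} (hu : ContMDiffOn ((𝓡 n).prod 𝓘(ℝ, ℝ)) 𝓘(ℝ, V) ∞ (fun p : M × ℝ => u p.2 p.1)
      (U ×ˢ J)) {Ω : Set (EuclideanSpace ℝ (Fin n))} (hΩ : Ω ⊆ e.target)
    (hU : MapsTo e.symm Ω U) : ContDiffOn ℝ ∞ (inChart e u) (Ω ×ˢ J) := by
  rw [← contMDiffOn_iff_contDiffOn, modelWithCornersSelf_prod, ← chartedSpaceSelf_prod]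
  have h1 : ContMDiffOn (𝓡 n) (𝓡 n) ∞ e.symm Ω :=
    (contMDiffOn_symm_of_mem_maximalAtlas (IsManifold.subset_maximalAtlas he)).mono hΩ
  have h2 : ContMDiffOn ((𝓡 n).prod 𝓘(ℝ, ℝ)) ((𝓡 n).prod 𝓘(ℝ, ℝ)) ∞
      (fun p : EuclideanSpace ℝ (Fin n) × ℝ => (e.symm p.1, p.2)) (Ω ×ˢ J) :=
    (h1.comp contMDiffOn_fst fun p hp => hp.1).prodMk contMDiffOn_snd
  exact hu.comp h2 fun p hp => ⟨hU hp.1, hp.2⟩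

/-- A chart identifies the tangent space at a point with the coordinate space, compatibly with
differentials. -/
lemma exists_tangentEquiv (he : e ∈ atlas (EuclideanSpace ℝ (Fin n)) M) {x : M}
    (hx : x ∈ e.source) : ∃ B : TangentSpace (𝓡 n) x ≃L[ℝ] EuclideanSpace ℝ (Fin n),
      ∀ Y : M → EuclideanSpace ℝ (Fin (n + 1)),
        MDifferentiableAt (𝓡 n) 𝓘(ℝ, EuclideanSpace ℝ (Fin (n + 1))) Y x →
        DifferentiableAt ℝ (Y ∘ e.symm) (e x) ∧
        ∀ v, differential Y x v = fderiv ℝ (Y ∘ e.symm) (e x) (B v) := by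
  have hm : e.MDifferentiable (𝓡 n) (𝓡 n) := mdifferentiable_of_mem_atlas he
  refine ⟨hm.mfderiv hx, fun Y hY => ?_⟩
  have hex := e.map_source hx
  have h1 : MDifferentiableAt (𝓡 n) 𝓘(ℝ, EuclideanSpace ℝ (Fin (n + 1))) (Y ∘ e.symm) (e x) := by
    refine MDifferentiableAt.comp _ ?_ (hm.mdifferentiableAt_symm hex)
    rwa [e.left_inv hx]
  refine ⟨h1.differentiableAt, fun v => ?_⟩
  have h2 : Y =ᶠ[𝓝 x] (Y ∘ e.symm) ∘ e := by
    filter_upwards [e.open_source.mem_nhds hx] with z hz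
    simp [e.left_inv hz]
  rw [differential, h2.mfderiv_eq, mfderiv_comp x h1 (hm.mdifferentiableAt hx), mfderiv_eq_fderiv]
  rfl

variable {I : Set ℝ} {X ν : ℝ → M → EuclideanSpace ℝ (Fin (n + 1))}

omit [IsManifold (𝓡 n) ∞ M] in
lemma contMDiff_slice {u : ℝ → M → V} {U : Set M}
    (hu : ContMDiffOn ((𝓡 n).prod 𝓘(ℝ, ℝ)) 𝓘(ℝ, V) ∞ (fun p : M × ℝ => u p.2 p.1)
      (U ×ˢ I)) {t : ℝ} (ht : t ∈ I) : ContMDiffOn (𝓡 n) 𝓘(ℝ, V) ∞ (u t) U :=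
  hu.comp (contMDiffOn_id.prodMk contMDiffOn_const) fun _ hx => ⟨hx, ht⟩

omit [IsManifold (𝓡 n) ∞ M] in
lemma IsMeanCurvatureFlow.mono (h : IsMeanCurvatureFlow I X) {J : Set ℝ} (hJ : J.OrdConnected)
    (hJ' : J.Nontrivial) (hJI : J ⊆ I) : IsMeanCurvatureFlow J X := by
  refine ⟨h.smooth.mono (prod_mono le_rfl hJI), fun t ht => h.immersion t (hJI ht),
    fun t ht x => ?_⟩
  have h1 : ContMDiffOn 𝓘(ℝ, ℝ) 𝓘(ℝ, EuclideanSpace ℝ (Fin (n + 1))) ∞ (fun s => X s x) I :=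
    h.smooth.comp (contMDiffOn_const.prodMk contMDiffOn_id) fun s hs => ⟨mem_univ x, hs⟩
  have h2 := ((contMDiffOn_iff_contDiffOn.1 h1).differentiableOn (by simp)) t (hJI ht)
  rw [← h.flow t (hJI ht) x]
  exact (h2.hasDerivWithinAt.mono hJI).derivWithin (uniqueDiffOn_convex hJ.convex
    (nonempty_interior_of_ordConnected hJ hJ') t ht)

omit [IsManifold (𝓡 n) ∞ M] in
lemma IsUnitNormal.mono (h : IsUnitNormal I X ν) {J : Set ℝ} (hJI : J ⊆ I) :
    IsUnitNormal J X ν :=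
  ⟨h.smooth.mono (prod_mono le_rfl hJI), fun t ht => h.norm_eq_one t (hJI ht),
    fun t ht => h.normal t (hJI ht)⟩

omit [IsManifold (𝓡 n) ∞ M] in
lemma IsMeanCurvatureFlow.mdifferentiableAt (hX : IsMeanCurvatureFlow I X) {t : ℝ} (ht : t ∈ I)
    (x : M) : MDifferentiableAt (𝓡 n) 𝓘(ℝ, EuclideanSpace ℝ (Fin (n + 1))) (X t) x :=
  (contMDiffOn_univ.1 (contMDiff_slice hX.smooth ht)).mdifferentiable (by simp) x

omit [IsManifold (𝓡 n) ∞ M] in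
lemma IsUnitNormal.mdifferentiableAt (hν : IsUnitNormal I X ν) {t : ℝ} (ht : t ∈ I)
    (x : M) : MDifferentiableAt (𝓡 n) 𝓘(ℝ, EuclideanSpace ℝ (Fin (n + 1))) (ν t) x :=
  (contMDiffOn_univ.1 (contMDiff_slice hν.smooth ht)).mdifferentiable (by simp) x

lemma isCoordHypersurface_inChart (hI : I.OrdConnected) (hI' : I.Nontrivial)
    (hX : IsMeanCurvatureFlow I X) (hν : IsUnitNormal I X ν)
    (he : e ∈ atlas (EuclideanSpace ℝ (Fin n)) M) {Ω : Set (EuclideanSpace ℝ (Fin n))}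
    (hΩ : IsOpen Ω) (hΩe : Ω ⊆ e.target) :
    IsCoordHypersurface Ω I (inChart e X) (inChart e ν) := by
  have key : ∀ p ∈ Ω ×ˢ I, ∃ B : TangentSpace (𝓡 n) (e.symm p.1) ≃L[ℝ] EuclideanSpace ℝ (Fin n),
      ∀ v, differential (X p.2) (e.symm p.1) v =
        fderiv ℝ (fun y => inChart e X (y, p.2)) p.1 (B v) := fun p hp => by
    obtain ⟨B, hB⟩ := exists_tangentEquiv he (e.map_target (hΩe hp.1))
    refine ⟨B, fun v => ?_⟩
    rw [(hB _ (hX.mdifferentiableAt hp.2 _)).2, e.right_inv (hΩe hp.1)]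
    rfl
  refine ⟨hΩ, hI, hI', contDiffOn_inChart he hX.smooth hΩe (mapsTo_univ _ _),
    contDiffOn_inChart he hν.smooth hΩe (mapsTo_univ _ _), fun p hp => ?_,
    fun p hp => hν.norm_eq_one _ hp.2 _, fun p hp v => ?_⟩
  · obtain ⟨B, hB⟩ := key p hp
    intro v w hvw
    have := hX.immersion _ hp.2 (e.symm p.1) (a₁ := B.symm v) (a₂ := B.symm w)
      (by rw [hB, hB]; simpa using hvw)
    exact B.symm.injective this
  · obtain ⟨B, hB⟩ := key p hp
    have := hν.normal _ hp.2 (e.symm p.1) (B.symm v)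
    rwa [hB, B.apply_symm_apply] at this

/-- In every chart the Laplace-Beltrami operator is the one of the coordinate expressions. -/
lemma laplaceBeltrami_eq_ev (hI : I.OrdConnected) (hI' : I.Nontrivial)
    (hX : IsMeanCurvatureFlow I X) (hν : IsUnitNormal I X ν)
    (he : e ∈ atlas (EuclideanSpace ℝ (Fin n)) M) {Ω : Set (EuclideanSpace ℝ (Fin n))}
    (h : IsCoordHypersurface Ω I (inChart e X) (inChart e ν)) (hΩe : Ω ⊆ e.target)
    {u : ℝ → M → ℝ} {U : Set M} (hU : IsOpen U) (hΩU : MapsTo e.symm Ω U)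
    (hu : ContMDiffOn ((𝓡 n).prod 𝓘(ℝ, ℝ)) 𝓘(ℝ, ℝ) ∞ (fun p : M × ℝ => u p.2 p.1) (U ×ˢ I))
    {w : SmoothFun (Ω ×ˢ I)} (hw : ∀ p (hp : p ∈ Ω ×ˢ I), SmoothFun.ev hp w = inChart e u p)
    {p : EuclideanSpace ℝ (Fin n) × ℝ} (hp : p ∈ Ω ×ˢ I) :
    laplaceBeltrami (X p.2) (u p.2) (e.symm p.1) = SmoothFun.ev hp (h.alg.Δ w) := by
  set x := e.symm p.1 with hx
  set e' := chartAt (EuclideanSpace ℝ (Fin n)) x with he'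
  have hxs : x ∈ e.source := e.map_target (hΩe hp.1)
  have he'a : e' ∈ atlas (EuclideanSpace ℝ (Fin n)) M := chart_mem_atlas _ x
  -- the part of the chart `e'` that corresponds to `Ω`
  let O : Set M := U ∩ (e.source ∩ e ⁻¹' Ω)
  let Ω' : Set (EuclideanSpace ℝ (Fin n)) := e'.target ∩ e'.symm ⁻¹' O
  have hO : IsOpen O := hU.inter (e.isOpen_inter_preimage h.isOpen)
  have hΩ' : IsOpen Ω' := e'.isOpen_inter_preimage_symm hO
  have hΩ'e : Ω' ⊆ e'.target := inter_subset_left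
  have h' := isCoordHypersurface_inChart hI hI' hX hν he'a hΩ' hΩ'e
  have hψ : MapsTo (fun y => e (e'.symm y)) Ω' Ω := fun y hy => hy.2.2.2
  have hψd : DifferentiableOn ℝ (fun y => e (e'.symm y)) Ω' := by
    have h1 : ContMDiffOn (𝓡 n) (𝓡 n) ∞ e'.symm Ω' :=
      (contMDiffOn_symm_of_mem_maximalAtlas (IsManifold.subset_maximalAtlas he'a)).mono hΩ'e
    have h2 : ContMDiffOn (𝓡 n) (𝓡 n) ∞ e e.source :=
      contMDiffOn_of_mem_maximalAtlas (IsManifold.subset_maximalAtlas he)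
    have h3 := h2.comp h1 fun y hy => hy.2.2.1
    exact (contMDiffOn_iff_contDiffOn.1 h3).differentiableOn (by simp)
  have hy : e' x ∈ Ω' := by
    refine ⟨e'.map_source (mem_chart_source _ x), ?_⟩
    rw [mem_preimage, e'.left_inv (mem_chart_source _ x)]
    refine ⟨hΩU hp.1, hxs, ?_⟩
    rw [mem_preimage, hx, e.right_inv (hΩe hp.1)]
    exact hp.1
  have hψx : e (e'.symm (e' x)) = p.1 := by
    rw [e'.left_inv (mem_chart_source _ x), hx, e.right_inv (hΩe hp.1)]
  let w' : SmoothFun (Ω' ×ˢ I) := SmoothFun.mk (inChart e' u)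
    (contDiffOn_inChart he'a hu hΩ'e fun y hy => hy.2.1)
  have hww' : ∀ y (hy : y ∈ Ω') t (ht : t ∈ I), SmoothFun.ev (mk_mem_prod hy ht) w' =
      SmoothFun.ev (mk_mem_prod (hψ hy) ht) w := fun y hy t ht => by
    rw [hw, SmoothFun.ev_mk]
    simp only [inChart]
    rw [e.left_inv hy.2.2.1]
  have h1 := h.ev_Δ_comp h' hψ hψd (fun y hy t ht => by
    simp only [inChart]
    rw [e.left_inv hy.2.2.1]) hww' hy hp.2
  rw [h'.ev_Δ (f := inChart e' u) (fun _ _ => rfl)] at h1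
  have h2 : SmoothFun.ev (mk_mem_prod (hψ hy) hp.2) (h.alg.Δ w) = SmoothFun.ev hp (h.alg.Δ w) := by
    congr!
  rw [← h2, ← h1]
  rfl

end Charts

/-! ### The flow in coordinates and the maximum principle -/

section Evaluation

variable {n : ℕ}

namespace IsCoordHypersurface

variable {Ω : Set (EuclideanSpace ℝ (Fin n))} {J : Set ℝ}
  {Z N : EuclideanSpace ℝ (Fin n) × ℝ → EuclideanSpace ℝ (Fin (n + 1))}
  {p : EuclideanSpace ℝ (Fin n) × ℝ}

lemma contDiffAt_slice {V : Type*} [NormedAddCommGroup V] [NormedSpace ℝ V]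
    (h : IsCoordHypersurface Ω J Z N) {f : EuclideanSpace ℝ (Fin n) × ℝ → V}
    (hf : ContDiffOn ℝ ∞ f (Ω ×ˢ J)) (hp : p ∈ Ω ×ˢ J) :
    ContDiffAt ℝ ∞ (fun y => f (y, p.2)) p.1 := by
  have h1 : ContDiffOn ℝ ∞ (fun y => f (y, p.2)) Ω :=
    hf.comp (contDiffOn_id.prodMk contDiffOn_const) fun y hy => ⟨hy, hp.2⟩
  exact h1.contDiffAt (h.isOpen.mem_nhds hp.1)

/-- The Laplace-Beltrami operator acts on vector valued functions componentwise. -/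
lemma coordLaplacian_apply (h : IsCoordHypersurface Ω J Z N) (hp : p ∈ Ω ×ˢ J) {m : ℕ}
    {u : EuclideanSpace ℝ (Fin n) → EuclideanSpace ℝ (Fin m)} (hu : ContDiffAt ℝ ∞ u p.1)
    (a : Fin m) : coordLaplacian (fun y => Z (y, p.2)) u p.1 a =
      coordLaplacian (fun y => Z (y, p.2)) (fun y => u y a) p.1 := by
  have hgi : ∀ i j, DifferentiableAt ℝ
      (fun y => Real.sqrt (gramMatrix (fderiv ℝ (fun y => Z (y, p.2)) y)).det *
        (gramMatrix (fderiv ℝ (fun y => Z (y, p.2)) y))⁻¹ i j) p.1 := fun i j => by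
    have h1 := (h.contDiffAt_slice (SmoothFun.contDiffOn_rep (h.alg.s * h.alg.gi i j)) hp
      ).differentiableAt (by simp)
    refine h1.congr_of_eventuallyEq ?_
    filter_upwards [h.isOpen.mem_nhds hp.1] with y hy
    have hy' : (y, p.2) ∈ Ω ×ˢ J := ⟨hy, hp.2⟩
    have e1 : SmoothFun.ev hy' h.alg.s = _ := h.ev_s hy'
    rw [← SmoothFun.ev_eq hy', map_mul, h.ev_gi hy', e1]
  have hd : ∀ j, DifferentiableAt ℝ (fun y => fderiv ℝ u y (EuclideanSpace.single j 1)) p.1 :=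
    fun j => ((hu.fderiv_right (m := ∞) (by simp)).differentiableAt
      (by simp)).clm_apply (differentiableAt_const _)
  have hev : ∀ᶠ y in 𝓝 p.1, DifferentiableAt ℝ u y := by
    have := (hu.of_le (m := 1) (by exact mod_cast le_top)).eventually (by simp)
    filter_upwards [this] with y hy using hy.differentiableAt (by simp)
  rw [coordLaplacian, coordLaplacian, PiLp.smul_apply, WithLp.ofLp_sum, Finset.sum_apply]
  refine congrArg _ (Finset.sum_congr rfl fun i _ => ?_)
  rw [← fderiv_euclidean_apply]
  · refine congrArg (fun L : _ →L[ℝ] ℝ => L (EuclideanSpace.single i 1))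
      (Filter.EventuallyEq.fderiv_eq ?_)
    filter_upwards [hev] with y hy
    rw [WithLp.ofLp_sum, Finset.sum_apply]
    refine Finset.sum_congr rfl fun j _ => ?_
    rw [PiLp.smul_apply, fderiv_euclidean_apply hy]
  · exact DifferentiableAt.fun_sum fun j _ => (hgi i j).smul (hd j)

/-- The directional derivative in terms of the tangential derivatives. -/
lemma fderiv_eq_sum_δ (h : IsCoordHypersurface Ω J Z N) {u : SmoothFun (Ω ×ˢ J)}
    {f : EuclideanSpace ℝ (Fin n) × ℝ → ℝ} (hf : ∀ p (hp : p ∈ Ω ×ˢ J), SmoothFun.ev hp u = f p)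
    (hp : p ∈ Ω ×ˢ J) (v : EuclideanSpace ℝ (Fin n)) :
    fderiv ℝ (fun y => f (y, p.2)) p.1 v =
      ∑ a, fderiv ℝ (fun y => Z (y, p.2)) p.1 v a * SmoothFun.ev hp (h.alg.δ a u) := by
  have h1 : ∀ i, fderiv ℝ (fun y => f (y, p.2)) p.1 (EuclideanSpace.single i 1) =
      ∑ a, fderiv ℝ (fun y => Z (y, p.2)) p.1 (EuclideanSpace.single i 1) a *
        SmoothFun.ev hp (h.alg.δ a u) := fun i => by
    have e1 : SmoothFun.ev hp (h.alg.d i u) = _ := h.ev_d hf hp i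
    have e2 : ∀ a, SmoothFun.ev hp (h.alg.d i (h.alg.X a)) = _ := fun a => h.ev_d_X hp i a
    rw [← e1, h.alg.d_eq_sum, map_sum]
    simp only [map_mul, e2]
  conv_lhs => rw [euclidean_sum_single v]
  conv_rhs => rw [euclidean_sum_single v]
  simp only [map_sum, map_smul, smul_eq_mul, h1, WithLp.ofLp_sum, Finset.sum_apply,
    PiLp.smul_apply, Finset.sum_mul, Finset.mul_sum]
  rw [Finset.sum_comm]
  exact Finset.sum_congr rfl fun _ _ => Finset.sum_congr rfl fun _ _ => by ring

lemma map_tangentGrad_apply (h : IsCoordHypersurface Ω J Z N) (hp : p ∈ Ω ×ˢ J)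
    (a b : Fin (n + 1)) :
    fderiv ℝ (fun y => Z (y, p.2)) p.1 (tangentGrad (fderiv ℝ (fun y => Z (y, p.2)) p.1) a) b =
      (if a = b then 1 else 0) - N p a * N p b := by
  rw [← fderiv_euclidean_apply (h.differentiableAt_slice hp)]
  have h1 := h.ev_δ (u := h.alg.X b) (f := fun p => Z p b) (fun _ _ => rfl) hp a
  have h2 := congrArg (SmoothFun.ev hp) (h.alg.δ_X a b)
  rw [map_sub, map_mul, h1] at h2
  rw [h2]
  have h3 : ∀ c, SmoothFun.ev hp (h.alg.ν c) = N p c := fun c => rfl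
  rw [h3, h3]
  split_ifs <;> simp

/-- Every vector that is orthogonal to the normal is tangential. -/
lemma exists_fderiv_eq (h : IsCoordHypersurface Ω J Z N) (hp : p ∈ Ω ×ˢ J)
    {w : EuclideanSpace ℝ (Fin (n + 1))} (hw : ∑ a, w a * N p a = 0) :
    ∃ v, fderiv ℝ (fun y => Z (y, p.2)) p.1 v = w := by
  refine ⟨∑ a, w a • tangentGrad (fderiv ℝ (fun y => Z (y, p.2)) p.1) a, ?_⟩
  ext b
  simp only [map_sum, map_smul, WithLp.ofLp_sum, Finset.sum_apply, PiLp.smul_apply, smul_eq_mul,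
    h.map_tangentGrad_apply hp, mul_sub, Finset.sum_sub_distrib, ← mul_assoc, ← Finset.sum_mul, hw]
  simp

end IsCoordHypersurface

end Evaluation

section MaximumPrinciple

lemma deriv_deriv_nonneg_of_isLocalMin {g : ℝ → ℝ} {x : ℝ} (hg : IsLocalMin g x)
    (hc : ContinuousAt g x) : 0 ≤ deriv (deriv g) x := by
  by_contra! hneg
  -- otherwise `x` would be a strict local maximum, and `g` would be constant near `x`
  have hmax : IsLocalMax g x := isLocalMax_of_deriv_deriv_neg hneg hg.deriv_eq_zero hc
  have hconst : g =ᶠ[𝓝 x] fun _ => g x := by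
    filter_upwards [hg, hmax] with y h1 h2 using le_antisymm h2 h1
  have : deriv (deriv g) x = 0 := by
    rw [hconst.deriv.deriv_eq]
    simp
  linarith

lemma fderiv_fderiv_nonneg_of_isLocalMin {E : Type*} [NormedAddCommGroup E] [NormedSpace ℝ E]
    {f : E → ℝ} {x : E} (hf : ContDiffAt ℝ ∞ f x) (hmin : IsLocalMin f x) (v : E) :
    0 ≤ fderiv ℝ (fun y => fderiv ℝ f y v) x v := by
  have hline : ∀ s : ℝ, HasDerivAt (fun s : ℝ => x + s • v) v s := fun s => by
    simpa using ((hasDerivAt_id s).smul_const v).const_add x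
  have hcont : Filter.Tendsto (fun s : ℝ => x + s • v) (𝓝 0) (𝓝 x) := by
    simpa using (hline 0).continuousAt.tendsto
  have h1 : deriv (fun s : ℝ => f (x + s • v)) =ᶠ[𝓝 0] fun s => fderiv ℝ f (x + s • v) v := by
    have := (hf.of_le (m := 1) (by exact mod_cast le_top)).eventually (by simp)
    filter_upwards [hcont.eventually this] with s hs
    exact ((hs.differentiableAt (by simp)).hasFDerivAt.comp_hasDerivAt s (hline s)).deriv
  have h2 : DifferentiableAt ℝ (fun y => fderiv ℝ f y v) x :=
    ((hf.fderiv_right (m := ∞) (by simp)).differentiableAt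
      (by simp)).clm_apply (differentiableAt_const _)
  have h3 : deriv (deriv fun s : ℝ => f (x + s • v)) 0 =
      fderiv ℝ (fun y => fderiv ℝ f y v) x v := by
    rw [h1.deriv_eq]
    have h4 : HasFDerivAt (fun y => fderiv ℝ f y v) (fderiv ℝ (fun y => fderiv ℝ f y v) x)
        (x + (0 : ℝ) • v) := by simpa using h2.hasFDerivAt
    exact (h4.comp_hasDerivAt (0 : ℝ) (hline 0)).deriv
  rw [← h3]
  refine deriv_deriv_nonneg_of_isLocalMin ?_ ?_
  · have := hcont.eventually hmin
    simpa [IsLocalMin, IsMinFilter] using this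
  · refine ContinuousAt.comp ?_ (hline 0).continuousAt
    simpa using hf.continuousAt

namespace IsCoordHypersurface

variable {n : ℕ} {Ω : Set (EuclideanSpace ℝ (Fin n))} {J : Set ℝ}
  {Z N : EuclideanSpace ℝ (Fin n) × ℝ → EuclideanSpace ℝ (Fin (n + 1))}
  {p : EuclideanSpace ℝ (Fin n) × ℝ}

/-- The heat operator is nonpositive at a minimum at the last time. -/
lemma ev_L_nonpos (h : IsCoordHypersurface Ω J Z N) (hp : p ∈ Ω ×ˢ J) (hJ : J ⊆ Iic p.2)
    {z : SmoothFun (Ω ×ˢ J)} (hz : ∀ q (hq : q ∈ Ω ×ˢ J), 0 ≤ SmoothFun.ev hq z)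
    (hz0 : SmoothFun.ev hp z = 0) : SmoothFun.ev hp (h.alg.L z) ≤ 0 := by
  have hrep : ∀ q ∈ Ω ×ˢ J, SmoothFun.rep z p ≤ SmoothFun.rep z q := fun q hq => by
    rw [← SmoothFun.ev_eq hp, hz0, ← SmoothFun.ev_eq hq]
    exact hz q hq
  have hmin : IsLocalMin (fun y => SmoothFun.rep z (y, p.2)) p.1 := by
    filter_upwards [h.isOpen.mem_nhds hp.1] with y hy using hrep _ ⟨hy, hp.2⟩
  have hτ : SmoothFun.ev hp (h.alg.τ z) ≤ 0 := by
    have e1 : SmoothFun.ev hp (h.alg.τ z) = _ := h.ev_τ (fun q hq => SmoothFun.ev_eq hq z) hp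
    have hne := nonempty_interior_of_ordConnected h.ordConnected h.nontrivial
    have hu : UniqueDiffWithinAt ℝ J p.2 :=
      uniqueDiffOn_convex h.ordConnected.convex hne _ hp.2
    have hd := hasDerivWithinAt_slice hp
      ((SmoothFun.contDiffOn_rep z).differentiableOn (by simp) p hp)
    rw [e1, hd.derivWithin hu]
    have hac : (𝓝[J \ {p.2}] p.2).NeBot := by
      exact accPt_principal_iff_nhdsWithin.1 (uniqueDiffWithinAt_iff_accPt.1 hu)
    refine le_of_tendsto (hasDerivWithinAt_iff_tendsto_slope.1 hd) ?_
    filter_upwards [self_mem_nhdsWithin] with s hs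
    rw [slope_def_field]
    have h1 := hrep (p.1, s) ⟨hp.1, hs.1⟩
    have h2 : s ≤ p.2 := hJ hs.1
    exact div_nonpos_of_nonneg_of_nonpos (by simpa using h1) (by linarith)
  have hd0 : ∀ i, SmoothFun.ev hp (h.alg.d i z) = 0 := fun i => by
    have e1 : SmoothFun.ev hp (h.alg.d i z) = _ := h.ev_d (fun q hq => SmoothFun.ev_eq hq z) hp i
    rw [e1, hmin.fderiv_eq_zero]
    rfl
  have hΔ : 0 ≤ SmoothFun.ev hp (h.alg.Δ z) := by
    rw [HypersurfaceAlgebra.Δ_apply, map_sum]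
    refine Finset.sum_nonneg fun a _ => ?_
    have hs := h.contDiffAt_slice (SmoothFun.contDiffOn_rep z) hp
    have h1 := fderiv_fderiv_nonneg_of_isLocalMin hs hmin
      (tangentGrad (fderiv ℝ (fun y => Z (y, p.2)) p.1) a)
    have h2 : ∀ i j, SmoothFun.ev hp (h.alg.d i (h.alg.d j z)) = fderiv ℝ (fun y => fderiv ℝ
        (fun y => SmoothFun.rep z (y, p.2)) y (EuclideanSpace.single j 1)) p.1
          (EuclideanSpace.single i 1) := fun i j =>
      h.ev_d (fun q hq => h.ev_d (fun q hq => SmoothFun.ev_eq hq z) hq j) hp i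
    have h3 : SmoothFun.ev hp (h.alg.δ a (h.alg.δ a z)) = ∑ i, ∑ j, SmoothFun.ev hp (h.alg.V a i) *
        (SmoothFun.ev hp (h.alg.V a j) * SmoothFun.ev hp (h.alg.d i (h.alg.d j z))) := by
      rw [HypersurfaceAlgebra.δ_apply, map_sum]
      refine Finset.sum_congr rfl fun i _ => ?_
      rw [HypersurfaceAlgebra.δ_apply, map_sum, map_mul, map_sum, Finset.mul_sum]
      refine Finset.sum_congr rfl fun j _ => ?_
      rw [Derivation.leibniz, smul_eq_mul, smul_eq_mul, map_add, map_mul, map_mul, hd0, zero_mul,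
        add_zero]
    have hdd : DifferentiableAt ℝ (fderiv ℝ (fun y => SmoothFun.rep z (y, p.2))) p.1 :=
      (hs.fderiv_right (m := ∞) (by simp)).differentiableAt (by simp)
    have h4 : ∀ v w, fderiv ℝ (fun y => fderiv ℝ (fun y => SmoothFun.rep z (y, p.2)) y w) p.1 v =
        fderiv ℝ (fderiv ℝ (fun y => SmoothFun.rep z (y, p.2))) p.1 v w := fun v w => by
      rw [fderiv_clm_apply hdd (differentiableAt_const _)]
      simp
    rw [h3]
    simp only [h2, h4, h.ev_V hp]
    rw [h4, euclidean_sum_single (tangentGrad _ a)] at h1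
    simp only [map_sum, map_smul, sum_apply, smul_apply,
      smul_eq_mul] at h1
    simp only [Finset.mul_sum] at h1
    refine h1.trans_eq ?_
    rw [Finset.sum_comm]
    refine Finset.sum_congr rfl fun i _ => Finset.sum_congr rfl fun j _ => by ring
  rw [HypersurfaceAlgebra.L_apply, map_sub]
  linarith

end IsCoordHypersurface

end MaximumPrinciple

section Flow

variable {n : ℕ} {M : Type*} [TopologicalSpace M] [ChartedSpace (EuclideanSpace ℝ (Fin n)) M]
  [IsManifold (𝓡 n) ∞ M] {e : OpenPartialHomeomorph M (EuclideanSpace ℝ (Fin n))}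
  {I : Set ℝ} {X ν : ℝ → M → EuclideanSpace ℝ (Fin (n + 1))}

omit [IsManifold (𝓡 n) ∞ M] in
lemma contMDiffOn_apply (hX : IsMeanCurvatureFlow I X) (a : Fin (n + 1)) :
    ContMDiffOn ((𝓡 n).prod 𝓘(ℝ, ℝ)) 𝓘(ℝ, ℝ) ∞ (fun p : M × ℝ => X p.2 p.1 a) (univ ×ˢ I) := by
  have h1 : ContMDiff 𝓘(ℝ, EuclideanSpace ℝ (Fin (n + 1))) 𝓘(ℝ, ℝ) ∞
      fun w : EuclideanSpace ℝ (Fin (n + 1)) => w a :=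
    (EuclideanSpace.proj (𝕜 := ℝ) a : EuclideanSpace ℝ (Fin (n + 1)) →L[ℝ] ℝ).contDiff.contMDiff
  exact h1.comp_contMDiffOn hX.smooth

lemma meanCurvatureVector_apply (hI : I.OrdConnected) (hI' : I.Nontrivial)
    (hX : IsMeanCurvatureFlow I X) (hν : IsUnitNormal I X ν) {t : ℝ} (ht : t ∈ I) (x : M)
    (a : Fin (n + 1)) :
    meanCurvatureVector (X t) x a = laplaceBeltrami (X t) (fun z => X t z a) x := by
  have hx : chartAt (EuclideanSpace ℝ (Fin n)) x x ∈
      (chartAt (EuclideanSpace ℝ (Fin n)) x).target :=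
    (chartAt _ x).map_source (mem_chart_source _ x)
  have h := isCoordHypersurface_inChart hI hI' hX hν (chart_mem_atlas _ x)
    (chartAt (EuclideanSpace ℝ (Fin n)) x).open_target le_rfl
  have hp := mk_mem_prod hx ht
  exact h.coordLaplacian_apply hp (h.contDiffAt_slice h.smooth hp) a

lemma isFlow_alg (hI : I.OrdConnected) (hI' : I.Nontrivial)
    (hX : IsMeanCurvatureFlow I X) (hν : IsUnitNormal I X ν)
    (he : e ∈ atlas (EuclideanSpace ℝ (Fin n)) M) {Ω : Set (EuclideanSpace ℝ (Fin n))}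
    (h : IsCoordHypersurface Ω I (inChart e X) (inChart e ν)) (hΩe : Ω ⊆ e.target) :
    h.alg.IsFlow := fun b => SmoothFun.eq_of_ev fun p hp => by
  have h1 : SmoothFun.ev hp (h.alg.τ (h.alg.X b)) = _ :=
    h.ev_τ (u := h.alg.X b) (f := fun p => inChart e X p b) (fun _ _ => rfl) hp
  rw [h1, ← laplaceBeltrami_eq_ev hI hI' hX hν he h hΩe isOpen_univ (mapsTo_univ _ _)
    (contMDiffOn_apply hX b) (u := fun t x => X t x b) (fun _ _ => rfl) hp,
    ← meanCurvatureVector_apply hI hI' hX hν hp.2, ← hX.flow _ hp.2]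
  have hu : UniqueDiffWithinAt ℝ I p.2 :=
    uniqueDiffOn_convex hI.convex (nonempty_interior_of_ordConnected hI hI') _ hp.2
  have hd := hasDerivWithinAt_slice hp (h.smooth.differentiableOn (by simp) p hp)
  have h2 : HasDerivWithinAt (fun s => X s (e.symm p.1)) _ I p.2 := hd
  have h3 : HasDerivWithinAt (fun s => inChart e X (p.1, s) b) _ I p.2 :=
    (EuclideanSpace.proj (𝕜 := ℝ) b :
      EuclideanSpace ℝ (Fin (n + 1)) →L[ℝ] ℝ).hasFDerivAt.comp_hasDerivWithinAt p.2 h2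
  rw [h2.derivWithin hu, h3.derivWithin hu]
  rfl

end Flow

/-! ### Symmetric matrices and orthonormal frames -/

section MatrixSpace

variable {n : ℕ}

/-- Square matrices as vectors of a Euclidean space, whose norm is the Frobenius norm. -/
def matVec : Matrix (Fin n) (Fin n) ℝ ≃ₗ[ℝ] EuclideanSpace ℝ (Fin n × Fin n) where
  toFun W := WithLp.toLp 2 fun p => W p.1 p.2
  invFun v := Matrix.of fun i j => v (i, j)
  map_add' _ _ := rfl
  map_smul' _ _ := rfl
  left_inv _ := rfl
  right_inv _ := rfl

lemma matVec_apply (W : Matrix (Fin n) (Fin n) ℝ) (p : Fin n × Fin n) :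
    matVec W p = W p.1 p.2 := rfl

lemma inner_matVec (B W : Matrix (Fin n) (Fin n) ℝ) :
    inner ℝ (matVec B) (matVec W) = ∑ i, ∑ j, B i j * W i j := by
  rw [PiLp.inner_apply, Fintype.sum_prod_type]
  exact Finset.sum_congr rfl fun _ _ => Finset.sum_congr rfl fun _ _ => by
    simp [matVec_apply, mul_comm]

lemma norm_matVec_sq (W : Matrix (Fin n) (Fin n) ℝ) : ‖matVec W‖ ^ 2 = (W * Wᵀ).trace := by
  rw [← real_inner_self_eq_norm_sq, inner_matVec]
  simp [Matrix.trace, Matrix.mul_apply]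

/-- The action of an orthogonal matrix by conjugation. -/
def conjIsometry (Q : Matrix (Fin n) (Fin n) ℝ) (hQ : Q ∈ Matrix.orthogonalGroup (Fin n) ℝ) :
    EuclideanSpace ℝ (Fin n × Fin n) ≃ₗᵢ[ℝ] EuclideanSpace ℝ (Fin n × Fin n) where
  toFun v := matVec (Q * matVec.symm v * Qᵀ)
  invFun v := matVec (Qᵀ * matVec.symm v * Q)
  map_add' v w := by simp [mul_add, add_mul]
  map_smul' c v := by simp
  left_inv v := by
    have h : Qᵀ * Q = 1 := (Matrix.mem_orthogonalGroup_iff' _ _).1 hQ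
    simp only [LinearEquiv.symm_apply_apply]
    rw [← mul_assoc, ← mul_assoc, h, one_mul, mul_assoc, h, mul_one, LinearEquiv.apply_symm_apply]
  right_inv v := by
    have h : Q * Qᵀ = 1 := (Matrix.mem_orthogonalGroup_iff _ _).1 hQ
    simp only [LinearEquiv.symm_apply_apply]
    rw [← mul_assoc, ← mul_assoc, h, one_mul, mul_assoc, h, mul_one, LinearEquiv.apply_symm_apply]
  norm_map' v := by
    have h : Qᵀ * Q = 1 := (Matrix.mem_orthogonalGroup_iff' _ _).1 hQ
    obtain ⟨W, rfl⟩ := matVec.surjective v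
    rw [← sq_eq_sq₀ (norm_nonneg _) (norm_nonneg _)]
    change ‖matVec (Q * matVec.symm (matVec W) * Qᵀ)‖ ^ 2 = _
    rw [norm_matVec_sq, norm_matVec_sq, LinearEquiv.symm_apply_apply, Matrix.transpose_mul,
      Matrix.transpose_mul, Matrix.transpose_transpose, Matrix.mul_assoc (Q * W),
      ← Matrix.mul_assoc Qᵀ, h, one_mul, Matrix.mul_assoc, Matrix.trace_mul_comm,
      Matrix.mul_assoc, Matrix.mul_assoc, h, mul_one]

lemma conjIsometry_matVec {Q : Matrix (Fin n) (Fin n) ℝ}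
    (hQ : Q ∈ Matrix.orthogonalGroup (Fin n) ℝ) (W : Matrix (Fin n) (Fin n) ℝ) :
    conjIsometry Q hQ (matVec W) = matVec (Q * W * Qᵀ) := rfl

/-- The subspace of symmetric matrices. -/
def symSubmodule (n : ℕ) : Submodule ℝ (EuclideanSpace ℝ (Fin n × Fin n)) where
  carrier := matVec '' symMatrices n
  zero_mem' := ⟨0, Matrix.isSymm_zero, map_zero _⟩
  add_mem' := by
    rintro _ _ ⟨A, hA, rfl⟩ ⟨B, hB, rfl⟩
    exact ⟨A + B, Matrix.IsSymm.add hA hB, map_add _ _ _⟩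
  smul_mem' := by
    rintro c _ ⟨A, hA, rfl⟩
    exact ⟨c • A, Matrix.IsSymm.smul hA c, map_smul _ _ _⟩

variable {Γ : Set (Matrix (Fin n) (Fin n) ℝ)}

lemma IsInvariantConvexCone.isProperCone (h : IsInvariantConvexCone Γ) :
    IsProperCone (symSubmodule n) (matVec '' Γ) where
  subset := image_mono h.subset_sym
  nonempty := h.nonempty.image _
  ne := fun he => h.ne_all (matVec.injective.image_injective he)
  closed := by
    have : (matVec '' Γ : Set _) = matVec.symm ⁻¹' Γ := matVec.toEquiv.image_eq_preimage_symm Γ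
    rw [this]
    refine h.closed.preimage ?_
    exact continuous_matrix fun i j => by
      change Continuous fun v : EuclideanSpace ℝ (Fin n × Fin n) => v (i, j)
      fun_prop
  convex := h.convex.linear_image matVec.toLinearMap
  cone := by
    rintro c hc _ ⟨W, hW, rfl⟩
    exact ⟨c • W, h.cone c hc W hW, map_smul _ _ _⟩

section Frobenius

attribute [local instance] Matrix.frobeniusNormedAddCommGroup

lemma isometry_matVec : Isometry (matVec : Matrix (Fin n) (Fin n) ℝ → _) := by
  refine Isometry.of_dist_eq fun A B => ?_
  rw [dist_eq_norm, dist_eq_norm, ← map_sub, Matrix.frobenius_norm_def, EuclideanSpace.norm_eq,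
    Fintype.sum_prod_type, Real.sqrt_eq_rpow]
  simp only [matVec_apply, Real.rpow_ofNat]

/-- The signed distance as a concave function on a Euclidean space. -/
lemma IsInvariantConvexCone.signedBdryDist_eq (h : IsInvariantConvexCone Γ)
    {W : Matrix (Fin n) (Fin n) ℝ} (hW : W.IsSymm) :
    signedBdryDist Γ W = coneDist (symSubmodule n) (matVec '' Γ) (matVec W) := by
  have hT : matVec W ∈ symSubmodule n := ⟨W, hW, rfl⟩
  unfold signedBdryDist
  split_ifs with hm
  · rw [h.isProperCone.coneDist_eq_of_mem (mem_image_of_mem _ hm),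
      ← Metric.infDist_image isometry_matVec, image_sdiff matVec.injective]
    rfl
  · rw [h.isProperCone.coneDist_eq_of_notMem hT
      (fun hc => hm ((matVec.injective.mem_set_image).1 hc)), Metric.infDist_image isometry_matVec]

end Frobenius

lemma IsInvariantConvexCone.coneDist_conj (h : IsInvariantConvexCone Γ)
    {Q : Matrix (Fin n) (Fin n) ℝ} (hQ : Q ∈ Matrix.orthogonalGroup (Fin n) ℝ)
    (v : EuclideanSpace ℝ (Fin n × Fin n)) :
    coneDist (symSubmodule n) (matVec '' Γ) (conjIsometry Q hQ v) =
      coneDist (symSubmodule n) (matVec '' Γ) v := by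
  -- an invariant set contains `Q W Qᵀ` if and only if it contains `W`
  have key : ∀ S : Set (Matrix (Fin n) (Fin n) ℝ),
      (∀ Q ∈ Matrix.orthogonalGroup (Fin n) ℝ, ∀ W ∈ S, Q * W * Qᵀ ∈ S) →
      ∀ v, conjIsometry Q hQ v ∈ matVec '' S ↔ v ∈ matVec '' S := fun S hS v => by
    obtain ⟨W, rfl⟩ := matVec.surjective v
    rw [conjIsometry_matVec, matVec.injective.mem_set_image, matVec.injective.mem_set_image]
    refine ⟨fun hm => ?_, hS Q hQ W⟩
    have h1 : Qᵀ * Q = 1 := (Matrix.mem_orthogonalGroup_iff' _ _).1 hQ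
    have hQ' : Qᵀ ∈ Matrix.orthogonalGroup (Fin n) ℝ := by
      rw [Matrix.mem_orthogonalGroup_iff]
      simpa [Matrix.star_eq_conjTranspose] using h1
    have := hS Qᵀ hQ' _ hm
    rwa [Matrix.transpose_transpose, ← mul_assoc, ← mul_assoc, h1, one_mul, mul_assoc, h1,
      mul_one] at this
  refine coneDist_map _ (key _ fun Q _ W hW => ?_) (key _ h.invariant) v
  have : Wᵀ = W := hW
  change (Q * W * Qᵀ)ᵀ = _
  rw [Matrix.transpose_mul, Matrix.transpose_mul, Matrix.transpose_transpose, this, mul_assoc]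

end MatrixSpace

section Frames

variable {n : ℕ}

/-- The rows of `E` form an orthonormal basis of the orthogonal complement of `N`. -/
def IsFrameMatrix (N : Fin (n + 1) → ℝ) (E : Matrix (Fin n) (Fin (n + 1)) ℝ) : Prop :=
  E * Eᵀ = 1 ∧ E *ᵥ N = 0

variable {N : Fin (n + 1) → ℝ} {E E' : Matrix (Fin n) (Fin (n + 1)) ℝ}
  {A : Matrix (Fin (n + 1)) (Fin (n + 1)) ℝ}

/-- The rows of `E` and the normal form an orthonormal basis of the ambient space. -/
lemma IsFrameMatrix.transpose_mul_self (hE : IsFrameMatrix N E) (hN : N ⬝ᵥ N = 1) :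
    Eᵀ * E + Matrix.vecMulVec N N = 1 := by
  have h1 : Matrix.fromRows E (Matrix.replicateRow Unit N) *
      Matrix.fromCols Eᵀ (Matrix.replicateCol Unit N) = 1 := by
    have e1 : E * Matrix.replicateCol Unit N = 0 := by
      rw [← Matrix.replicateCol_mulVec, hE.2]
      rfl
    have e2 : Matrix.replicateRow Unit N * Eᵀ = 0 := by
      rw [← Matrix.transpose_inj, Matrix.transpose_mul, Matrix.transpose_transpose,
        Matrix.transpose_replicateRow, e1, Matrix.transpose_zero]
    have e3 : Matrix.replicateRow Unit N * Matrix.replicateCol Unit N = 1 := by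
      ext i j
      rw [Matrix.mul_apply, Matrix.one_apply_eq]
      exact hN
    rw [Matrix.fromRows_mul_fromCols, hE.1, e1, e2, e3, Matrix.fromBlocks_one]
  have h2 := (Matrix.mul_eq_one_comm_of_card_eq _ _ _ (by simp)).1 h1
  rw [Matrix.fromCols_mul_fromRows] at h2
  rw [← h2]
  congr 1
  ext i j
  simp [Matrix.vecMulVec, Matrix.mul_apply]

lemma IsFrameMatrix.mul_transpose_mul (hE : IsFrameMatrix N E) (hN : N ⬝ᵥ N = 1)
    {m : Type*} [Fintype m] {B : Matrix m (Fin (n + 1)) ℝ} (hB : B *ᵥ N = 0) :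
    B * Eᵀ * E = B := by
  rw [Matrix.mul_assoc, eq_sub_of_add_eq (hE.transpose_mul_self hN), Matrix.mul_sub, Matrix.mul_one,
    Matrix.mul_vecMulVec, hB]
  simp

/-- Two orthonormal frames differ by an orthogonal matrix, so the matrices of a tensor in them are
conjugate. -/
lemma IsFrameMatrix.exists_conj (hE : IsFrameMatrix N E) (hE' : IsFrameMatrix N E')
    (hN : N ⬝ᵥ N = 1) : ∃ Q ∈ Matrix.orthogonalGroup (Fin n) ℝ,
      E * A * Eᵀ = Q * (E' * A * E'ᵀ) * Qᵀ := by
  have h1 : E * E'ᵀ * E' = E := hE'.mul_transpose_mul hN hE.2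
  refine ⟨E * E'ᵀ, ?_, ?_⟩
  · rw [Matrix.mem_orthogonalGroup_iff]
    change E * E'ᵀ * (E * E'ᵀ)ᵀ = 1
    rw [Matrix.transpose_mul, Matrix.transpose_transpose, ← Matrix.mul_assoc, h1, hE.1]
  · have h2 : E'ᵀ * (E * E'ᵀ)ᵀ = Eᵀ := by
      rw [← Matrix.transpose_mul, h1]
    calc E * A * Eᵀ = (E * E'ᵀ * E') * A * (E'ᵀ * (E * E'ᵀ)ᵀ) := by rw [h1, h2]
      _ = _ := by simp only [Matrix.mul_assoc]

lemma IsFrameMatrix.sum_sq (hE : IsFrameMatrix N E) (hN : N ⬝ᵥ N = 1) (hA : A.IsSymm)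
    (hAN : A *ᵥ N = 0) : ∑ i, ∑ j, (E * A * Eᵀ) i j ^ 2 = ∑ a, ∑ b, A a b * A a b := by
  have h1 : ∀ {m : ℕ} (B : Matrix (Fin m) (Fin m) ℝ), ∑ i, ∑ j, B i j * B i j = (B * Bᵀ).trace :=
    fun B => by simp [Matrix.trace, Matrix.mul_apply]
  have h2 := hE.mul_transpose_mul hN hAN
  simp only [sq]
  rw [h1, h1, Matrix.transpose_mul, Matrix.transpose_mul, Matrix.transpose_transpose, hA]
  calc (E * A * Eᵀ * (E * (A * Eᵀ))).trace = (E * ((A * Eᵀ * E) * (A * Eᵀ))).trace := by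
        simp only [Matrix.mul_assoc]
    _ = (A * (A * Eᵀ * E)).trace := by
        rw [h2, Matrix.trace_mul_comm, Matrix.mul_assoc, h2]
    _ = _ := by rw [h2]

end Frames

section Weingarten

variable {n : ℕ} {M : Type*} [TopologicalSpace M] [ChartedSpace (EuclideanSpace ℝ (Fin n)) M]
  {e : OpenPartialHomeomorph M (EuclideanSpace ℝ (Fin n))}
  {I : Set ℝ} {X ν : ℝ → M → EuclideanSpace ℝ (Fin (n + 1))}
  {Ω : Set (EuclideanSpace ℝ (Fin n))} {p : EuclideanSpace ℝ (Fin n) × ℝ}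

/-- The components of the images in the ambient space of the vectors of a frame. -/
noncomputable def frameMatrix (Y : M → EuclideanSpace ℝ (Fin (n + 1))) (x : M)
    (f : Fin n → TangentSpace (𝓡 n) x) : Matrix (Fin n) (Fin (n + 1)) ℝ :=
  Matrix.of fun i a => differential Y x (f i) a

/-- The Weingarten tensor at a point, extended by zero in the normal direction. -/
noncomputable def IsCoordHypersurface.ambientA
    {J : Set ℝ} {Z N : EuclideanSpace ℝ (Fin n) × ℝ → EuclideanSpace ℝ (Fin (n + 1))}
    (h : IsCoordHypersurface Ω J Z N) (hp : p ∈ Ω ×ˢ J) :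
    Matrix (Fin (n + 1)) (Fin (n + 1)) ℝ :=
  Matrix.of fun a b => SmoothFun.ev hp (h.alg.A a b)

lemma IsCoordHypersurface.ambientA_isSymm
    {J : Set ℝ} {Z N : EuclideanSpace ℝ (Fin n) × ℝ → EuclideanSpace ℝ (Fin (n + 1))}
    (h : IsCoordHypersurface Ω J Z N) (hp : p ∈ Ω ×ˢ J) : (h.ambientA hp).IsSymm := by
  ext a b
  exact congrArg (SmoothFun.ev hp) (h.alg.A_symm b a)

lemma IsCoordHypersurface.ambientA_mulVec
    {J : Set ℝ} {Z N : EuclideanSpace ℝ (Fin n) × ℝ → EuclideanSpace ℝ (Fin (n + 1))}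
    (h : IsCoordHypersurface Ω J Z N) (hp : p ∈ Ω ×ˢ J) : h.ambientA hp *ᵥ (N p).ofLp = 0 := by
  ext a
  have := congrArg (SmoothFun.ev hp) (h.alg.sum_A_mul_ν a)
  rw [map_sum, map_zero] at this
  rw [Pi.zero_apply, ← this, Matrix.mulVec, dotProduct]
  exact Finset.sum_congr rfl fun b _ => by rw [map_mul]; rfl

lemma isOrthonormalFrame_iff {Y : M → EuclideanSpace ℝ (Fin (n + 1))} {x : M}
    {f : Fin n → TangentSpace (𝓡 n) x} :
    IsOrthonormalFrame Y x f ↔ frameMatrix Y x f * (frameMatrix Y x f)ᵀ = 1 := by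
  rw [IsOrthonormalFrame, orthonormal_iff_ite, ← Matrix.ext_iff]
  refine forall₂_congr fun i j => ?_
  rw [Matrix.mul_apply, Matrix.one_apply, PiLp.inner_apply]
  simp [frameMatrix, mul_comm]

lemma isFrameMatrix_frameMatrix (hν : IsUnitNormal I X ν) {t : ℝ} (ht : t ∈ I) {x : M}
    {f : Fin n → TangentSpace (𝓡 n) x} (hf : IsOrthonormalFrame (X t) x f) :
    IsFrameMatrix (ν t x).ofLp (frameMatrix (X t) x f) := by
  refine ⟨isOrthonormalFrame_iff.1 hf, ?_⟩
  ext i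
  have := hν.normal t ht x (f i)
  rw [PiLp.inner_apply] at this
  rw [Pi.zero_apply, ← this, Matrix.mulVec, dotProduct]
  exact Finset.sum_congr rfl fun a _ => by simp [frameMatrix, mul_comm]

lemma normal_dotProduct_self (hν : IsUnitNormal I X ν) {t : ℝ} (ht : t ∈ I) (x : M) :
    (ν t x).ofLp ⬝ᵥ (ν t x).ofLp = 1 := by
  have h1 := real_inner_self_eq_norm_sq (ν t x)
  rw [hν.norm_eq_one t ht x, PiLp.inner_apply, one_pow] at h1
  rw [← h1]
  exact Finset.sum_congr rfl fun a _ => by simp [sq]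

variable [IsManifold (𝓡 n) ∞ M]

lemma weingartenMatrix_eq (hX : IsMeanCurvatureFlow I X) (hν : IsUnitNormal I X ν)
    (he : e ∈ atlas (EuclideanSpace ℝ (Fin n)) M)
    (h : IsCoordHypersurface Ω I (inChart e X) (inChart e ν)) (hΩe : Ω ⊆ e.target)
    (hp : p ∈ Ω ×ˢ I) (f : Fin n → TangentSpace (𝓡 n) (e.symm p.1)) :
    weingartenMatrix (X p.2) (ν p.2) (e.symm p.1) f =
      frameMatrix (X p.2) (e.symm p.1) f * h.ambientA hp *
        (frameMatrix (X p.2) (e.symm p.1) f)ᵀ := by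
  obtain ⟨B, hB⟩ := exists_tangentEquiv he (e.map_target (hΩe hp.1))
  have h1 := (hB _ (hX.mdifferentiableAt hp.2 (e.symm p.1))).2
  have h2 := (hB _ (hν.mdifferentiableAt hp.2 (e.symm p.1))).2
  have h3 : ∀ i b, differential (ν p.2) (e.symm p.1) (f i) b =
      ∑ a, differential (X p.2) (e.symm p.1) (f i) a * h.ambientA hp a b := fun i b => by
    have e1 := h.fderiv_eq_sum_δ (u := h.alg.ν b) (f := fun p => inChart e ν p b)
      (fun _ _ => rfl) hp (B (f i))
    rw [IsCoordHypersurface.fderiv_euclidean_apply (h.differentiableAt_slice_normal hp)] at e1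
    rw [h2, h1, e.right_inv (hΩe hp.1)]
    exact e1
  ext i j
  rw [Matrix.mul_apply, weingartenMatrix, Matrix.of_apply, PiLp.inner_apply]
  refine Finset.sum_congr rfl fun b _ => ?_
  rw [Matrix.mul_apply, Matrix.transpose_apply]
  simp [frameMatrix, h3, mul_comm]

lemma exists_frameMatrix_eq (hX : IsMeanCurvatureFlow I X)
    (he : e ∈ atlas (EuclideanSpace ℝ (Fin n)) M)
    (h : IsCoordHypersurface Ω I (inChart e X) (inChart e ν)) (hΩe : Ω ⊆ e.target)
    (hp : p ∈ Ω ×ˢ I) {E : Matrix (Fin n) (Fin (n + 1)) ℝ}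
    (hE : E *ᵥ (inChart e ν p).ofLp = 0) :
    ∃ f, frameMatrix (X p.2) (e.symm p.1) f = E := by
  obtain ⟨B, hB⟩ := exists_tangentEquiv he (e.map_target (hΩe hp.1))
  have h1 := (hB _ (hX.mdifferentiableAt hp.2 (e.symm p.1))).2
  have h2 : ∀ i, ∃ v, fderiv ℝ (fun y => inChart e X (y, p.2)) p.1 v = WithLp.toLp 2 (E i) :=
    fun i => h.exists_fderiv_eq hp (congrFun hE i)
  choose v hv using h2
  refine ⟨fun i => B.symm (v i), ?_⟩
  ext i a
  rw [frameMatrix, Matrix.of_apply, h1, B.apply_symm_apply, e.right_inv (hΩe hp.1)]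
  exact congrArg (fun w : EuclideanSpace ℝ (Fin (n + 1)) => w a) (hv i)

lemma exists_isFrameMatrix {N : EuclideanSpace ℝ (Fin (n + 1))} (hN : ‖N‖ = 1) :
    ∃ E : Matrix (Fin n) (Fin (n + 1)) ℝ, IsFrameMatrix N.ofLp E := by
  have : Fact (Module.finrank ℝ (EuclideanSpace ℝ (Fin (n + 1))) = n + 1) := ⟨by simp⟩
  have hne : N ≠ 0 := fun h0 => by simp [h0] at hN
  let b := OrthonormalBasis.fromOrthogonalSpanSingleton (𝕜 := ℝ) n hne
  refine ⟨Matrix.of fun i a => (b i : EuclideanSpace ℝ (Fin (n + 1))) a, ?_, ?_⟩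
  · ext i j
    have := (orthonormal_iff_ite.1 b.orthonormal) i j
    rw [Submodule.coe_inner, PiLp.inner_apply] at this
    rw [Matrix.mul_apply, Matrix.one_apply, ← this]
    exact Finset.sum_congr rfl fun a _ => by simp [mul_comm]
  · ext i
    have := (Submodule.mem_orthogonal_singleton_iff_inner_right.1 (b i).2)
    rw [PiLp.inner_apply] at this
    rw [Pi.zero_apply, ← this, Matrix.mulVec, dotProduct]
    exact Finset.sum_congr rfl fun a _ => by simp [mul_comm]

variable (hI : I.OrdConnected) (hI' : I.Nontrivial) (hX : IsMeanCurvatureFlow I X)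
  (hν : IsUnitNormal I X ν)
include hI hI' hX hν

lemma exists_isOrthonormalFrame {t : ℝ} (ht : t ∈ I) (x : M) :
    ∃ f, IsOrthonormalFrame (X t) x f := by
  obtain ⟨E, hE⟩ := exists_isFrameMatrix (hν.norm_eq_one t ht x)
  have hx : x ∈ (chartAt (EuclideanSpace ℝ (Fin n)) x).source := mem_chart_source _ x
  have h := isCoordHypersurface_inChart hI hI' hX hν (chart_mem_atlas _ x)
    (chartAt (EuclideanSpace ℝ (Fin n)) x).open_target le_rfl
  have hp := mk_mem_prod ((chartAt (EuclideanSpace ℝ (Fin n)) x).map_source hx) ht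
  have hxx : (chartAt (EuclideanSpace ℝ (Fin n)) x).symm (chartAt (EuclideanSpace ℝ (Fin n)) x x) =
    x := (chartAt (EuclideanSpace ℝ (Fin n)) x).left_inv hx
  have h1 : E *ᵥ (inChart (chartAt (EuclideanSpace ℝ (Fin n)) x) ν
      (chartAt (EuclideanSpace ℝ (Fin n)) x x, t)).ofLp = 0 := by
    simp only [inChart, hxx, hE.2]
  obtain ⟨f, hf⟩ : ∃ f, frameMatrix (X t) x f = E := by
    have h2 := exists_frameMatrix_eq hX (chart_mem_atlas _ x) h le_rfl hp h1
    generalize hz : (chartAt (EuclideanSpace ℝ (Fin n)) x).symm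
      (chartAt (EuclideanSpace ℝ (Fin n)) x x) = z at h2 hxx
    subst hxx
    exact h2
  exact ⟨f, isOrthonormalFrame_iff.2 (by rw [hf, hE.1])⟩

lemma isOrthonormalFrame_someFrame {t : ℝ} (ht : t ∈ I) (x : M) :
    IsOrthonormalFrame (X t) x (someFrame (X t) x) :=
  Classical.epsilon_spec_aux _ _ (exists_isOrthonormalFrame hI hI' hX hν ht x)

/-- The matrix of the Weingarten tensor in the chosen orthonormal frame is orthogonally conjugate
to the one in any other orthonormal frame. -/
lemma weingartenMatrix_someFrame_conj (he : e ∈ atlas (EuclideanSpace ℝ (Fin n)) M)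
    (h : IsCoordHypersurface Ω I (inChart e X) (inChart e ν)) (hΩe : Ω ⊆ e.target)
    (hp : p ∈ Ω ×ˢ I) {E : Matrix (Fin n) (Fin (n + 1)) ℝ}
    (hE : IsFrameMatrix (inChart e ν p).ofLp E) : ∃ Q ∈ Matrix.orthogonalGroup (Fin n) ℝ,
      weingartenMatrix (X p.2) (ν p.2) (e.symm p.1) (someFrame (X p.2) (e.symm p.1)) =
        Q * (E * h.ambientA hp * Eᵀ) * Qᵀ := by
  rw [weingartenMatrix_eq hX hν he h hΩe hp]
  exact (isFrameMatrix_frameMatrix hν hp.2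
    (isOrthonormalFrame_someFrame hI hI' hX hν hp.2 _)).exists_conj hE
    (normal_dotProduct_self hν hp.2 _)

lemma normSqA_eq_ev (he : e ∈ atlas (EuclideanSpace ℝ (Fin n)) M)
    (h : IsCoordHypersurface Ω I (inChart e X) (inChart e ν)) (hΩe : Ω ⊆ e.target)
    (hp : p ∈ Ω ×ˢ I) :
    normSqA (X p.2) (ν p.2) (e.symm p.1) = SmoothFun.ev hp h.alg.N := by
  rw [normSqA, weingartenMatrix_eq hX hν he h hΩe hp,
    (isFrameMatrix_frameMatrix hν hp.2 (isOrthonormalFrame_someFrame hI hI' hX hν hp.2 _)).sum_sq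
      (normal_dotProduct_self hν hp.2 _) (h.ambientA_isSymm hp) (h.ambientA_mulVec hp)]
  simp only [HypersurfaceAlgebra.N, map_sum, map_mul]
  rfl

/-- The Weingarten matrices in two orthonormal frames at the same point are symmetric and
orthogonally conjugate. -/
lemma weingartenMatrix_conj {t : ℝ} (ht : t ∈ I) {x : M} {f f' : Fin n → TangentSpace (𝓡 n) x}
    (hf : IsOrthonormalFrame (X t) x f) (hf' : IsOrthonormalFrame (X t) x f') :
    (weingartenMatrix (X t) (ν t) x f).IsSymm ∧ ∃ Q ∈ Matrix.orthogonalGroup (Fin n) ℝ,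
      weingartenMatrix (X t) (ν t) x f = Q * weingartenMatrix (X t) (ν t) x f' * Qᵀ := by
  obtain ⟨A, hA, hW⟩ : ∃ A : Matrix (Fin (n + 1)) (Fin (n + 1)) ℝ, A.IsSymm ∧ ∀ f,
      weingartenMatrix (X t) (ν t) x f = frameMatrix (X t) x f * A * (frameMatrix (X t) x f)ᵀ := by
    have hx : x ∈ (chartAt (EuclideanSpace ℝ (Fin n)) x).source := mem_chart_source _ x
    have h := isCoordHypersurface_inChart hI hI' hX hν (chart_mem_atlas _ x)
      (chartAt (EuclideanSpace ℝ (Fin n)) x).open_target le_rfl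
    have hp := mk_mem_prod ((chartAt (EuclideanSpace ℝ (Fin n)) x).map_source hx) ht
    have hxx : (chartAt (EuclideanSpace ℝ (Fin n)) x).symm
      (chartAt (EuclideanSpace ℝ (Fin n)) x x) = x :=
        (chartAt (EuclideanSpace ℝ (Fin n)) x).left_inv hx
    refine ⟨h.ambientA hp, h.ambientA_isSymm hp, ?_⟩
    have := weingartenMatrix_eq hX hν (chart_mem_atlas _ x) h le_rfl hp
    generalize h.ambientA hp = A at this
    dsimp only at this
    generalize (chartAt (EuclideanSpace ℝ (Fin n)) x).symm
      (chartAt (EuclideanSpace ℝ (Fin n)) x x) = z at this hxx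
    subst hxx
    exact this
  constructor
  · rw [hW, Matrix.IsSymm, Matrix.transpose_mul, Matrix.transpose_mul, Matrix.transpose_transpose,
      hA, Matrix.mul_assoc]
  · rw [hW, hW]
    exact (isFrameMatrix_frameMatrix hν ht hf).exists_conj (isFrameMatrix_frameMatrix hν ht hf')
      (normal_dotProduct_self hν ht _)

lemma curvatureDist_eq_coneDist {Γ : Set (Matrix (Fin n) (Fin n) ℝ)}
    (hΓ : IsInvariantConvexCone Γ) {t : ℝ} (ht : t ∈ I) (x : M) :
    curvatureDist Γ (X t) (ν t) x = coneDist (symSubmodule n) (matVec '' Γ)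
      (matVec (weingartenMatrix (X t) (ν t) x (someFrame (X t) x))) := by
  have hf := isOrthonormalFrame_someFrame hI hI' hX hν ht x
  exact hΓ.signedBdryDist_eq (weingartenMatrix_conj hI hI' hX hν ht hf hf).1

/-- The signed distance of the Weingarten tensor does not depend on the orthonormal frame. -/
lemma curvatureDist_eq_signedBdryDist {Γ : Set (Matrix (Fin n) (Fin n) ℝ)}
    (hΓ : IsInvariantConvexCone Γ) {t : ℝ} (ht : t ∈ I) (x : M)
    {f : Fin n → TangentSpace (𝓡 n) x} (hf : IsOrthonormalFrame (X t) x f) :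
    curvatureDist Γ (X t) (ν t) x = signedBdryDist Γ (weingartenMatrix (X t) (ν t) x f) := by
  have hf' := isOrthonormalFrame_someFrame hI hI' hX hν ht x
  obtain ⟨hs, Q, hQ, h⟩ := weingartenMatrix_conj hI hI' hX hν ht hf hf'
  rw [curvatureDist_eq_coneDist hI hI' hX hν hΓ ht, hΓ.signedBdryDist_eq hs, h,
    ← conjIsometry_matVec hQ, hΓ.coneDist_conj]

end Weingarten

/-! ### Lower support functions and the viscosity sense -/

section MovingFrame

variable {n : ℕ} {Ω : Set (EuclideanSpace ℝ (Fin n))} {J : Set ℝ}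
  {Z N : EuclideanSpace ℝ (Fin n) × ℝ → EuclideanSpace ℝ (Fin (n + 1))}
  {p : EuclideanSpace ℝ (Fin n) × ℝ}

/-- Near `p` the Weingarten tensor can be read in a smooth orthonormal frame, obtained from an
orthonormal frame at `p` by the rotation that takes the normal at `p` to the normal at the other
point. At `p` its components satisfy the reaction-diffusion equation without gradient terms. -/
lemma IsCoordHypersurface.exists_smooth_weingarten (h : IsCoordHypersurface Ω J Z N)
    (hY : h.alg.IsFlow) (hp : p ∈ Ω ×ˢ J) {E : Matrix (Fin n) (Fin (n + 1)) ℝ}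
    (hE : IsFrameMatrix (N p).ofLp E) (hne : ∀ q ∈ Ω ×ˢ J, 1 + inner ℝ (N p) (N q) ≠ 0) :
    ∃ W : Matrix (Fin n) (Fin n) (SmoothFun (Ω ×ˢ J)),
      (∀ q (hq : q ∈ Ω ×ˢ J), ∃ E', IsFrameMatrix (N q).ofLp E' ∧
        W.map (SmoothFun.ev hq) = E' * h.ambientA hq * E'ᵀ) ∧
      ∀ i j, SmoothFun.ev hp (h.alg.L (W i j)) =
        SmoothFun.ev hp h.alg.N * SmoothFun.ev hp (W i j) := by
  have hD : IsUnit (1 + ∑ a, algebraMap ℝ (SmoothFun (Ω ×ˢ J)) (N p a) * h.alg.ν a) := by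
    refine SmoothFun.isUnit_of_ne_zero fun q hq => ?_
    have h1 := hne q hq
    rw [PiLp.inner_apply] at h1
    have h2 : ∀ a, SmoothFun.ev hq (h.alg.ν a) = N q a := fun a => rfl
    simpa [h2, mul_comm] using h1
  obtain ⟨D', hD'⟩ := hD.exists_left_inv
  let Q : Fin n → SmoothFun (Ω ×ˢ J) := fun i => (∑ a, algebraMap ℝ _ (E i a) * h.alg.ν a) * D'
  have hQ : ∀ i, Q i * (1 + ∑ a, algebraMap ℝ (SmoothFun (Ω ×ˢ J)) (N p a) * h.alg.ν a) =
      ∑ a, algebraMap ℝ _ (E i a) * h.alg.ν a := fun i => by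
    rw [mul_assoc, hD', mul_one]
  have hEN : ∀ i, ∑ a, E i a * N p a = 0 := fun i => congrFun hE.2 i
  have hN : ∑ a, N p a * N p a = 1 := by
    have h1 := real_inner_self_eq_norm_sq (N p)
    rw [h.norm_eq_one p hp, PiLp.inner_apply, one_pow] at h1
    rw [← h1]
    exact Finset.sum_congr rfl fun a _ => by simp [sq]
  refine ⟨Matrix.of fun i j => h.alg.frameA (N p) (E i) (E j) (Q i) (Q j), fun q hq =>
    ⟨Matrix.of fun i a => SmoothFun.ev hq (h.alg.frameVec (N p) (E i) (Q i) a), ⟨?_, ?_⟩, ?_⟩,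
    fun i j => ?_⟩
  · ext i j
    have h1 := congrArg (SmoothFun.ev hq) (HypersurfaceAlgebra.sum_frameVec_mul_frameVec hN (hEN i)
      (hEN j) (hQ i) (hQ j))
    have h2 : (E * Eᵀ) i j = _ := congrFun (congrFun hE.1 i) j
    rw [Matrix.mul_apply] at h2
    simp only [Matrix.transpose_apply] at h2
    rw [h2, AlgHom.commutes, map_sum] at h1
    rw [Matrix.mul_apply]
    simpa using h1
  · ext i
    have h1 := congrArg (SmoothFun.ev hq) (HypersurfaceAlgebra.sum_frameVec_mul_ν (hQ i))
    rw [map_sum, map_zero] at h1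
    rw [Matrix.mulVec, dotProduct, Pi.zero_apply, ← h1]
    exact Finset.sum_congr rfl fun a _ => by rw [map_mul]; rfl
  · ext i j
    rw [Matrix.map_apply, Matrix.of_apply, HypersurfaceAlgebra.frameA, map_sum, Matrix.mul_apply]
    simp only [Matrix.mul_apply, Finset.sum_mul, map_sum, map_mul]
    rw [Finset.sum_comm]
    rfl
  · exact hY.L_frameA (SmoothFun.ev hp) (fun a => rfl) (hEN i) (hEN j) (hQ i) (hQ j)

end MovingFrame

section Touching

variable {n : ℕ} {M : Type*} [TopologicalSpace M] [ChartedSpace (EuclideanSpace ℝ (Fin n)) M]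
  [IsManifold (𝓡 n) ∞ M] {I : Set ℝ} {X ν : ℝ → M → EuclideanSpace ℝ (Fin (n + 1))}

lemma nontrivial_inter_of_mem_nhds {J V : Set ℝ} (hJ : J.OrdConnected) (hJ' : J.Nontrivial) {t : ℝ}
    (ht : t ∈ J) (hV : V ∈ 𝓝 t) : (J ∩ V).Nontrivial := by
  have h1 := uniqueDiffWithinAt_iff_accPt.1 (uniqueDiffOn_convex hJ.convex
    (nonempty_interior_of_ordConnected hJ hJ') t ht)
  obtain ⟨s, hs, hst⟩ := accPt_iff_nhds.1 h1 V hV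
  exact ⟨s, hs.symm, t, ⟨ht, mem_of_mem_nhds hV⟩, hst⟩

/-- The matrix of the Weingarten tensor in the chosen frame at each point, as a vector. -/
noncomputable def weingartenVec (X ν : ℝ → M → EuclideanSpace ℝ (Fin (n + 1))) (t : ℝ) (x : M) :
    EuclideanSpace ℝ (Fin n × Fin n) :=
  matVec (weingartenMatrix (X t) (ν t) x (someFrame (X t) x))

variable (hI : I.OrdConnected) (hI' : I.Nontrivial) (hX : IsMeanCurvatureFlow I X)
  (hν : IsUnitNormal I X ν)
include hI hI' hX hν

/-- Near each space-time point the Weingarten tensor has a smooth matrix, up to conjugation. -/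
lemma exists_local_weingarten {t₀ : ℝ} (ht₀ : t₀ ∈ I) {U : Set M} (hU : IsOpen U)
    {e : OpenPartialHomeomorph M (EuclideanSpace ℝ (Fin n))}
    (he : e ∈ atlas (EuclideanSpace ℝ (Fin n)) M) {x₀ : M} (hx₀ : x₀ ∈ e.source) (hxU : x₀ ∈ U) :
    ∃ (Ω : Set (EuclideanSpace ℝ (Fin n))) (V : Set ℝ)
      (h : IsCoordHypersurface Ω (I ∩ V) (inChart e X) (inChart e ν))
      (hp : (e x₀, t₀) ∈ Ω ×ˢ (I ∩ V)) (W : Matrix (Fin n) (Fin n) (SmoothFun (Ω ×ˢ (I ∩ V)))),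
      Ω ⊆ e.target ∧ MapsTo e.symm Ω U ∧ IsOpen V ∧ (I ∩ V).OrdConnected ∧ (I ∩ V).Nontrivial ∧
      (∀ q (hq : q ∈ Ω ×ˢ (I ∩ V)), ∃ (Q : Matrix (Fin n) (Fin n) ℝ)
        (hQ : Q ∈ Matrix.orthogonalGroup (Fin n) ℝ), weingartenVec X ν q.2 (e.symm q.1) =
          conjIsometry Q hQ (matVec (W.map (SmoothFun.ev hq)))) ∧
      ∀ i j, SmoothFun.ev hp (h.alg.L (W i j)) =
        SmoothFun.ev hp h.alg.N * SmoothFun.ev hp (W i j) := by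
  obtain ⟨E, hE⟩ := exists_isFrameMatrix (hν.norm_eq_one t₀ ht₀ x₀)
  have hex := e.map_source hx₀
  -- near the point the normal is not opposite to `ν t₀ x₀`, so the rotation is well defined
  have hc : ContinuousOn (fun q => 1 + inner ℝ (ν t₀ x₀) (inChart e ν q)) (e.target ×ˢ I) :=
    continuousOn_const.add (continuousOn_const.inner
      (contDiffOn_inChart he hν.smooth le_rfl (mapsTo_univ _ _)).continuousOn)
  have hmem : ∀ᶠ q in 𝓝[e.target ×ˢ I] (e x₀, t₀),
      0 < 1 + inner ℝ (ν t₀ x₀) (inChart e ν q) := by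
    refine (hc _ ⟨hex, ht₀⟩).eventually (lt_mem_nhds ?_)
    simp only [inChart, e.left_inv hx₀, real_inner_self_eq_norm_sq, hν.norm_eq_one t₀ ht₀ x₀]
    norm_num
  rw [nhdsWithin_prod_eq, e.open_target.nhdsWithin_eq hex] at hmem
  obtain ⟨P, hP, P', hP', hPP⟩ := Filter.eventually_prod_iff.1 hmem
  obtain ⟨O, hOP, hO, hxO⟩ := eventually_nhds_iff.1 hP
  obtain ⟨δ, hδ, hδP⟩ := Metric.mem_nhdsWithin_iff.1 hP'
  have hΩ : IsOpen (O ∩ (e.target ∩ e.symm ⁻¹' U)) := hO.inter (e.isOpen_inter_preimage_symm hU)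
  have hΩe : O ∩ (e.target ∩ e.symm ⁻¹' U) ⊆ e.target := fun y hy => hy.2.1
  have hoc : (I ∩ Metric.ball t₀ δ).OrdConnected := hI.inter (convex_ball _ _).ordConnected
  have hnt := nontrivial_inter_of_mem_nhds hI hI' ht₀ (Metric.ball_mem_nhds t₀ hδ)
  have hX' := hX.mono hoc hnt inter_subset_left
  have hν' := hν.mono (J := I ∩ Metric.ball t₀ δ) inter_subset_left
  have h := isCoordHypersurface_inChart hoc hnt hX' hν' he hΩ hΩe
  have hp : (e x₀, t₀) ∈ (O ∩ (e.target ∩ e.symm ⁻¹' U)) ×ˢ (I ∩ Metric.ball t₀ δ) :=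
    ⟨⟨hxO, hex, by rwa [mem_preimage, e.left_inv hx₀]⟩, ht₀, Metric.mem_ball_self hδ⟩
  have hνp : inChart e ν (e x₀, t₀) = ν t₀ x₀ := by simp only [inChart, e.left_inv hx₀]
  obtain ⟨W, hW, hWL⟩ := h.exists_smooth_weingarten (isFlow_alg hoc hnt hX' hν' he h hΩe) hp
    (by rwa [hνp]) fun q hq => by
      rw [hνp]
      exact (hPP (hOP _ hq.1.1) (hδP ⟨hq.2.2, hq.2.1⟩)).ne'
  refine ⟨_, _, h, hp, W, hΩe, fun y hy => hy.2.2, Metric.isOpen_ball, hoc, hnt, fun q hq => ?_,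
    hWL⟩
  obtain ⟨E', hE', hWE⟩ := hW q hq
  obtain ⟨Q, hQ, hQW⟩ := weingartenMatrix_someFrame_conj hoc hnt hX' hν' he h hΩe hq hE'
  exact ⟨Q, hQ, by rw [conjIsometry_matVec, hWE, ← hQW]; rfl⟩

/-- If an invariant function of the Weingarten tensor has an approximate supergradient at each
point, then each smooth lower support function of it is an approximate supersolution. -/
lemma le_heat_of_support {F : EuclideanSpace ℝ (Fin n × Fin n) → ℝ} {ε : ℝ}
    (hF : ∀ Q (hQ : Q ∈ Matrix.orthogonalGroup (Fin n) ℝ) v, F (conjIsometry Q hQ v) = F v)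
    (hsg : ∀ W₀, ∃ B, (∀ W, F W ≤ F W₀ + inner ℝ B (W - W₀)) ∧ F W₀ - ε ≤ inner ℝ B W₀)
    {t₀ : ℝ} (ht₀ : t₀ ∈ I) (hIt : I ⊆ Iic t₀) {U : Set M} (hU : IsOpen U) {x₀ : M} (hx₀ : x₀ ∈ U)
    {φ : ℝ → M → ℝ}
    (hφ : ContMDiffOn ((𝓡 n).prod 𝓘(ℝ, ℝ)) 𝓘(ℝ, ℝ) ∞ (fun p : M × ℝ => φ p.2 p.1) (U ×ˢ I))
    (hle : ∀ t ∈ I, ∀ x ∈ U, φ t x ≤ F (weingartenVec X ν t x))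
    (heq : φ t₀ x₀ = F (weingartenVec X ν t₀ x₀)) :
    normSqA (X t₀) (ν t₀) x₀ * (φ t₀ x₀ - ε) ≤
      derivWithin (fun t => φ t x₀) I t₀ - laplaceBeltrami (X t₀) (φ t₀) x₀ := by
  set e := chartAt (EuclideanSpace ℝ (Fin n)) x₀ with he
  have hea := chart_mem_atlas (EuclideanSpace ℝ (Fin n)) x₀
  have hxe : x₀ ∈ e.source := mem_chart_source _ x₀
  obtain ⟨Ω, V, h, hp, W, hΩe, hΩU, hV, hoc, hnt, hWQ, hWL⟩ :=
    exists_local_weingarten hI hI' hX hν ht₀ hU hea hxe hx₀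
  rw [← he] at h hp hΩe hΩU hWQ
  have hX' := hX.mono hoc hnt inter_subset_left
  have hν' := hν.mono (J := I ∩ V) inter_subset_left
  have hφ' := hφ.mono (prod_mono le_rfl (inter_subset_left (t := V)))
  have hFW : ∀ q (hq : q ∈ Ω ×ˢ (I ∩ V)), F (weingartenVec X ν q.2 (e.symm q.1)) =
      F (matVec (W.map (SmoothFun.ev hq))) := fun q hq => by
    obtain ⟨Q, hQ, h1⟩ := hWQ q hq
    rw [h1, hF]
  obtain ⟨B, hB, hBε⟩ := hsg (matVec (W.map (SmoothFun.ev hp)))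
  obtain ⟨B, rfl⟩ := matVec.surjective B
  let w : SmoothFun (Ω ×ˢ (I ∩ V)) := SmoothFun.mk (inChart e φ)
    (contDiffOn_inChart hea hφ' hΩe hΩU)
  have hw : ∀ q (hq : q ∈ Ω ×ˢ (I ∩ V)), SmoothFun.ev hq w = inChart e φ q := fun _ _ => rfl
  let ℓ : SmoothFun (Ω ×ˢ (I ∩ V)) := ∑ i, ∑ j, B i j • W i j
  have hℓ : ∀ q (hq : q ∈ Ω ×ˢ (I ∩ V)), SmoothFun.ev hq ℓ =
      inner ℝ (matVec B) (matVec (W.map (SmoothFun.ev hq))) := fun q hq => by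
    rw [inner_matVec, map_sum]
    simp only [map_sum, map_smul, smul_eq_mul, Matrix.map_apply]
  have hwp : SmoothFun.ev hp w = F (matVec (W.map (SmoothFun.ev hp))) := by
    rw [hw, ← hFW, inChart, e.left_inv hxe]
    exact heq
  -- the linearization of `F` lies above `φ` and touches it at the given point
  let c : ℝ := F (matVec (W.map (SmoothFun.ev hp))) - SmoothFun.ev hp ℓ
  have hL := h.ev_L_nonpos hp (fun t ht => hIt ht.1)
    (z := algebraMap ℝ _ c + ℓ - w) (fun q hq => by
      rw [map_sub, map_add, AlgHom.commutes, hℓ, hw]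
      have h1 := hle q.2 hq.2.1 (e.symm q.1) (hΩU hq.1)
      rw [hFW q hq] at h1
      have h2 := hB (matVec (W.map (SmoothFun.ev hq)))
      rw [inner_sub_right, ← hℓ q hq, ← hℓ _ hp] at h2
      simp only [Algebra.algebraMap_self, RingHom.id_apply, c, inChart]
      rw [← hℓ q hq]
      linarith) (by
      rw [map_sub, map_add, AlgHom.commutes, hwp]
      simp [c])
  have hLc : h.alg.L (algebraMap ℝ _ c) = 0 := by
    rw [HypersurfaceAlgebra.L_apply, HypersurfaceAlgebra.Δ_apply]
    simp
  have hLℓ : SmoothFun.ev hp (h.alg.L ℓ) = SmoothFun.ev hp h.alg.N * SmoothFun.ev hp ℓ := by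
    simp only [ℓ, map_sum, map_smul, hWL, Finset.mul_sum, smul_eq_mul]
    exact Finset.sum_congr rfl fun i _ => Finset.sum_congr rfl fun j _ => by ring
  rw [map_sub, map_add, hLc, map_sub, map_add, hLℓ, HypersurfaceAlgebra.L_apply, map_sub] at hL
  have e1 : SmoothFun.ev hp (h.alg.τ w) = _ := h.ev_τ hw hp
  have e2 := laplaceBeltrami_eq_ev hoc hnt hX' hν' hea h hΩe hU hΩU hφ' hw hp
  have e3 := normSqA_eq_ev hoc hnt hX' hν' hea h hΩe hp
  simp only [inChart, ← he, e.left_inv hxe] at e1 e2 e3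
  rw [← e2, ← e3, e1, derivWithin_inter (hV.mem_nhds hp.2.2)] at hL
  have h5 : 0 ≤ normSqA (X t₀) (ν t₀) x₀ :=
    Finset.sum_nonneg fun _ _ => Finset.sum_nonneg fun _ _ => sq_nonneg _
  have h6 : φ t₀ x₀ - ε ≤ SmoothFun.ev hp ℓ := by
    rw [hℓ _ hp]
    refine le_trans (le_of_eq ?_) hBε
    rw [← hwp, hw, inChart, e.left_inv hxe]
  have h7 := mul_le_mul_of_nonneg_left h6 h5
  rw [map_zero] at hL
  linarith

end Touching

section Viscosity

variable {n : ℕ} {M : Type*} [TopologicalSpace M] [ChartedSpace (EuclideanSpace ℝ (Fin n)) M]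
  [IsManifold (𝓡 n) ∞ M] {I : Set ℝ} {X ν : ℝ → M → EuclideanSpace ℝ (Fin (n + 1))}
  {Γ : Set (Matrix (Fin n) (Fin n) ℝ)}

lemma isViscositySupersolution_curvatureDist (hI : I.OrdConnected) (hI' : I.Nontrivial)
    (hX : IsMeanCurvatureFlow I X) (hν : IsUnitNormal I X ν) (hΓ : IsInvariantConvexCone Γ) :
    IsViscositySupersolution I X (fun t x => normSqA (X t) (ν t) x)
      (fun t x => curvatureDist Γ (X t) (ν t) x) := by
  intro t₀ ht₀ x₀ U r hU hx₀ hr hrI φ hφ hle heq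
  have hmem : t₀ ∈ Ioc (t₀ - r) t₀ := ⟨by linarith, le_rfl⟩
  have hnt : (Ioc (t₀ - r) t₀).Nontrivial :=
    ⟨t₀ - r / 2, ⟨by linarith, by linarith⟩, t₀, hmem, by linarith⟩
  have hC := hΓ.isProperCone
  have h1 := le_heat_of_support ordConnected_Ioc hnt (hX.mono ordConnected_Ioc hnt hrI)
    (hν.mono hrI) (F := coneDist (symSubmodule n) (matVec '' Γ)) (ε := 0)
    (fun Q hQ v => hΓ.coneDist_conj hQ v) (fun W₀ => by
      obtain ⟨B, hB, h2⟩ := hC.exists_coneDist_eq W₀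
      refine ⟨B, fun W => ?_, by rw [h2, sub_zero]⟩
      rw [h2, inner_sub_right, add_sub_cancel]
      exact coneDist_le hB W) hmem (fun t ht => ht.2) hU hx₀ hφ (fun t ht x hx => by
      rw [weingartenVec, ← curvatureDist_eq_coneDist hI hI' hX hν hΓ (hrI ht)]
      exact hle t ht x hx) (by
      rw [weingartenVec, ← curvatureDist_eq_coneDist hI hI' hX hν hΓ ht₀]
      exact heq)
  have h2 : derivWithin (fun t => φ t x₀) (Ioc (t₀ - r) t₀) t₀ =
      derivWithin (fun t => φ t x₀) (Iic t₀) t₀ := by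
    rw [← Ioi_inter_Iic, inter_comm]
    exact derivWithin_inter (Ioi_mem_nhds (by linarith))
  rw [h2, sub_zero] at h1
  exact h1

end Viscosity

/-! ### The area measure -/

section AreaMeasure

variable {n : ℕ}

lemma gramMatrix_comp (T : EuclideanSpace ℝ (Fin n) →L[ℝ] EuclideanSpace ℝ (Fin (n + 1)))
    (B : EuclideanSpace ℝ (Fin n) →L[ℝ] EuclideanSpace ℝ (Fin n)) :
    Real.sqrt (gramMatrix (T.comp B)).det = |B.det| * Real.sqrt (gramMatrix T).det := by
  let P : Matrix (Fin n) (Fin n) ℝ := Matrix.of fun k i => B (EuclideanSpace.single i 1) k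
  have hP : B.det = P.det := by
    rw [ContinuousLinearMap.det,
      ← LinearMap.det_toMatrix (EuclideanSpace.basisFun (Fin n) ℝ).toBasis]
    congr 1
  have h1 : gramMatrix (T.comp B) = Pᵀ * gramMatrix T * P := by
    ext i j
    rw [gramMatrix, Matrix.of_apply, ContinuousLinearMap.comp_apply, ContinuousLinearMap.comp_apply,
      euclidean_sum_single (B (EuclideanSpace.single i 1)),
      euclidean_sum_single (B (EuclideanSpace.single j 1)), map_sum, map_sum, inner_sum]
    simp only [map_smul, sum_inner, inner_smul_left, inner_smul_right, conj_trivial]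
    rw [Matrix.mul_apply]
    refine Finset.sum_congr rfl fun l _ => ?_
    rw [Matrix.mul_apply, Finset.mul_sum, Finset.sum_mul]
    refine Finset.sum_congr rfl fun k _ => ?_
    simp only [Matrix.transpose_apply, P, gramMatrix, Matrix.of_apply]
    ring
  rw [h1, Matrix.det_mul, Matrix.det_mul, Matrix.det_transpose, hP,
    show P.det * (gramMatrix T).det * P.det = P.det ^ 2 * (gramMatrix T).det by ring,
    Real.sqrt_mul (sq_nonneg _), Real.sqrt_sq_eq_abs]

variable {M : Type*} [TopologicalSpace M] [ChartedSpace (EuclideanSpace ℝ (Fin n)) M]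
  [MeasurableSpace M] [BorelSpace M] {Y : M → EuclideanSpace ℝ (Fin (n + 1))}
  {e e' : OpenPartialHomeomorph M (EuclideanSpace ℝ (Fin n))}

omit [ChartedSpace (EuclideanSpace ℝ (Fin n)) M] in
lemma aemeasurable_symm (e : OpenPartialHomeomorph M (EuclideanSpace ℝ (Fin n)))
    (f : EuclideanSpace ℝ (Fin n) → ENNReal) :
    AEMeasurable e.symm ((volume.restrict e.target).withDensity f) :=
  (e.continuousOn_symm.aemeasurable e.open_target.measurableSet).mono_ac
    (withDensity_absolutelyContinuous _ _)

omit [ChartedSpace (EuclideanSpace ℝ (Fin n)) M] in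
lemma chartArea_apply {A : Set M} (hA : MeasurableSet A) : chartArea Y e A =
    ∫⁻ y in e.target ∩ e.symm ⁻¹' A, ENNReal.ofReal (Real.sqrt (chartMetric Y e y).det) := by
  rw [chartArea, Measure.map_apply_of_aemeasurable (aemeasurable_symm _ _) hA,
    withDensity_apply', Measure.restrict_restrict' e.open_target.measurableSet, inter_comm]

omit [ChartedSpace (EuclideanSpace ℝ (Fin n)) M] in
lemma measurableSet_target_inter_preimage {A : Set M} (hA : MeasurableSet A) :
    MeasurableSet (e.target ∩ e.symm ⁻¹' A) := by
  have h1 := (continuousOn_iff_continuous_domRestrict.1 e.continuousOn_symm).measurable hA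
  have h2 := e.open_target.measurableSet.subtype_image h1
  convert h2 using 1
  ext y
  simp [and_comm]

omit [ChartedSpace (EuclideanSpace ℝ (Fin n)) M] in
lemma chartArea_compl_source : chartArea Y e e.sourceᶜ = 0 := by
  have : e.target ∩ e.symm ⁻¹' e.sourceᶜ = ∅ := by
    ext y
    simp only [mem_inter_iff, mem_preimage, mem_compl_iff, mem_empty_iff_false, iff_false, not_and,
      not_not]
    exact fun hy => e.map_target hy
  rw [chartArea_apply e.open_source.measurableSet.compl, this]
  simp

omit [ChartedSpace (EuclideanSpace ℝ (Fin n)) M] in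
lemma chartArea_inter_source (A : Set M) :
    chartArea Y e (A ∩ e.source) = chartArea Y e A := by
  refine le_antisymm (measure_mono inter_subset_left) ?_
  rw [← measure_inter_add_sdiff A e.open_source.measurableSet,
    measure_mono_null (sdiff_subset_compl A e.source) chartArea_compl_source, add_zero]

variable [IsManifold (𝓡 n) ∞ M]

/-- The area measures of two charts agree on the overlap. -/
lemma chartArea_eq_of_subset
    (hY : MDifferentiable (𝓡 n) 𝓘(ℝ, EuclideanSpace ℝ (Fin (n + 1))) Y)
    (he : e ∈ atlas (EuclideanSpace ℝ (Fin n)) M) (he' : e' ∈ atlas (EuclideanSpace ℝ (Fin n)) M)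
    {A : Set M} (hA : MeasurableSet A) (hAe : A ⊆ e.source) (hAe' : A ⊆ e'.source) :
    chartArea Y e A = chartArea Y e' A := by
  have hd : ∀ y ∈ e'.target ∩ e'.symm ⁻¹' A, DifferentiableAt ℝ (fun y => e (e'.symm y)) y :=
    fun y hy => by
      have h1 : MDifferentiableAt (𝓡 n) (𝓡 n) e'.symm y :=
        (mdifferentiable_of_mem_atlas he').mdifferentiableAt_symm hy.1
      have h2 : MDifferentiableAt (𝓡 n) (𝓡 n) e (e'.symm y) :=
        (mdifferentiable_of_mem_atlas he).mdifferentiableAt (hAe hy.2)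
      exact (MDifferentiableAt.comp y h2 h1).differentiableAt
  have himage : (fun y => e (e'.symm y)) '' (e'.target ∩ e'.symm ⁻¹' A) =
      e.target ∩ e.symm ⁻¹' A := by
    ext z
    constructor
    · rintro ⟨y, hy, rfl⟩
      exact ⟨e.map_source (hAe hy.2), by simpa [e.left_inv (hAe hy.2)] using hy.2⟩
    · intro hz
      have h1 := hAe' hz.2
      refine ⟨e' (e.symm z), ⟨e'.map_source h1, ?_⟩, ?_⟩
      · rw [mem_preimage, e'.left_inv h1]
        exact hz.2
      · simp only
        rw [e'.left_inv h1, e.right_inv hz.1]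
  have hinj : InjOn (fun y => e (e'.symm y)) (e'.target ∩ e'.symm ⁻¹' A) := fun y hy z hz hyz =>
    e'.symm.injOn hy.1 hz.1 (e.injOn (hAe hy.2) (hAe hz.2) hyz)
  have hS := measurableSet_target_inter_preimage (e := e') hA
  rw [chartArea_apply hA, chartArea_apply hA, ← himage,
    lintegral_image_eq_lintegral_abs_det_fderiv_mul volume hS
      (fun y hy => (hd y hy).hasFDerivAt.hasFDerivWithinAt) hinj]
  refine setLIntegral_congr_fun hS fun y hy => ?_
  have hx : e'.symm y ∈ e.source := hAe hy.2
  obtain ⟨B, hB⟩ := exists_tangentEquiv he hx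
  have h1 : fderiv ℝ (Y ∘ e'.symm) y =
      (fderiv ℝ (Y ∘ e.symm) (e (e'.symm y))).comp (fderiv ℝ (fun y => e (e'.symm y)) y) := by
    rw [← fderiv_comp y (hB Y (hY _)).1 (hd y hy)]
    refine Filter.EventuallyEq.fderiv_eq ?_
    have h2 : e'.target ∩ e'.symm ⁻¹' e.source ∈ 𝓝 y :=
      (e'.isOpen_inter_preimage_symm e.open_source).mem_nhds ⟨hy.1, hx⟩
    filter_upwards [h2] with z hz
    simp only [Function.comp_apply]
    rw [e.left_inv hz.2]
  have h3 : Real.sqrt (chartMetric Y e' y).det =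
      Real.sqrt (gramMatrix (fderiv ℝ (Y ∘ e'.symm) y)).det := rfl
  rw [h3, h1, gramMatrix_comp, ENNReal.ofReal_mul (abs_nonneg _)]
  rfl

/-- On the domain of a chart, the area measure is the one of the chart. -/
lemma areaMeasure_restrict
    (hY : MDifferentiable (𝓡 n) 𝓘(ℝ, EuclideanSpace ℝ (Fin (n + 1))) Y) (x : M) :
    (areaMeasure Y).restrict (chartAt (EuclideanSpace ℝ (Fin n)) x).source =
      chartArea Y (chartAt (EuclideanSpace ℝ (Fin n)) x) := by
  set e := chartAt (EuclideanSpace ℝ (Fin n)) x with he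
  have hle : ∀ z, chartArea Y (chartAt (EuclideanSpace ℝ (Fin n)) z) ≤ areaMeasure Y :=
    fun z => le_iSup (fun z => chartArea Y (chartAt (EuclideanSpace ℝ (Fin n)) z)) z
  have hub : areaMeasure Y ≤ (areaMeasure Y).restrict e.sourceᶜ + chartArea Y e := by
    refine iSup_le fun z => Measure.le_iff.2 fun A hA => ?_
    rw [← measure_inter_add_sdiff A e.open_source.measurableSet, add_comm, Measure.add_apply,
      Measure.restrict_apply hA]
    refine add_le_add (hle z _) ?_
    rw [← chartArea_inter_source (A ∩ e.source),
      ← chartArea_eq_of_subset hY (chart_mem_atlas _ x) (chart_mem_atlas _ z)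
        ((hA.inter e.open_source.measurableSet).inter (chartAt _ z).open_source.measurableSet)
        (fun y hy => hy.1.2) inter_subset_right]
    exact measure_mono fun y hy => hy.1.1
  refine le_antisymm (Measure.le_iff.2 fun A hA => ?_) (Measure.le_iff.2 fun A hA => ?_)
  · rw [Measure.restrict_apply hA]
    refine (hub _).trans ?_
    rw [Measure.add_apply, Measure.restrict_apply (hA.inter e.open_source.measurableSet),
      chartArea_inter_source A, inter_assoc, inter_compl_self]
    simp
  · rw [Measure.restrict_apply hA, ← chartArea_inter_source A]
    exact hle x _

variable (hY : MDifferentiable (𝓡 n) 𝓘(ℝ, EuclideanSpace ℝ (Fin (n + 1))) Y) {x : M}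
  (hρ : ContinuousOn (fun y => (chartMetric Y (chartAt (EuclideanSpace ℝ (Fin n)) x) y).det)
    (chartAt (EuclideanSpace ℝ (Fin n)) x).target)
  {f : M → ℝ} (hf : ContinuousOn (fun y => f ((chartAt (EuclideanSpace ℝ (Fin n)) x).symm y))
    (chartAt (EuclideanSpace ℝ (Fin n)) x).target)
  (hf0 : ∀ z ∉ (chartAt (EuclideanSpace ℝ (Fin n)) x).source, f z = 0)
include hf

omit [IsManifold (𝓡 n) ∞ M] in
lemma aestronglyMeasurable_chartArea :
    AEStronglyMeasurable f (chartArea Y (chartAt (EuclideanSpace ℝ (Fin n)) x)) := by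
  set e := chartAt (EuclideanSpace ℝ (Fin n)) x
  have h1 : (chartArea Y e).restrict e.source = chartArea Y e := by
    ext A hA
    rw [Measure.restrict_apply hA, chartArea_inter_source A]
  have h2 : ContinuousOn f e.source := by
    refine (hf.comp e.continuousOn e.mapsTo).congr fun z hz => ?_
    simp [e.left_inv hz]
  rw [← h1]
  exact h2.aestronglyMeasurable e.open_source.measurableSet

include hY hρ hf0

lemma integrable_areaMeasure_iff : Integrable f (areaMeasure Y) ↔
    IntegrableOn (fun y => Real.sqrt
      (chartMetric Y (chartAt (EuclideanSpace ℝ (Fin n)) x) y).det *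
        f ((chartAt (EuclideanSpace ℝ (Fin n)) x).symm y))
      (chartAt (EuclideanSpace ℝ (Fin n)) x).target := by
  have h1 : Integrable f (areaMeasure Y) ↔
      Integrable f (chartArea Y (chartAt (EuclideanSpace ℝ (Fin n)) x)) := by
    rw [← areaMeasure_restrict hY]
    exact (integrableOn_iff_integrable_of_support_subset
      (Function.support_subset_iff'.2 hf0)).symm
  have hρ' := (hρ.sqrt.aemeasurable (μ := volume)
    (chartAt (EuclideanSpace ℝ (Fin n)) x).open_target.measurableSet).ennreal_ofReal
  rw [h1, chartArea, integrable_map_measure (aestronglyMeasurable_chartArea hf)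
    (aemeasurable_symm _ _), integrable_withDensity_iff_integrable_smul₀' hρ'
      (Filter.Eventually.of_forall fun _ => ENNReal.ofReal_lt_top), IntegrableOn]
  refine integrable_congr (Filter.Eventually.of_forall fun y => ?_)
  simp [ENNReal.toReal_ofReal (Real.sqrt_nonneg _)]

/-- Integrals of functions that vanish outside the domain of a chart are computed in the chart. -/
lemma integral_areaMeasure : ∫ z, f z ∂(areaMeasure Y) =
    ∫ y in (chartAt (EuclideanSpace ℝ (Fin n)) x).target, Real.sqrt
      (chartMetric Y (chartAt (EuclideanSpace ℝ (Fin n)) x) y).det *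
        f ((chartAt (EuclideanSpace ℝ (Fin n)) x).symm y) := by
  have h1 : ∫ z, f z ∂(areaMeasure Y) =
      ∫ z, f z ∂(chartArea Y (chartAt (EuclideanSpace ℝ (Fin n)) x)) := by
    rw [← areaMeasure_restrict hY, setIntegral_eq_integral_of_forall_compl_eq_zero hf0]
  have hρ' := (hρ.sqrt.aemeasurable (μ := volume)
    (chartAt (EuclideanSpace ℝ (Fin n)) x).open_target.measurableSet).ennreal_ofReal
  rw [h1, chartArea, integral_map (aemeasurable_symm _ _) (aestronglyMeasurable_chartArea hf),
    integral_withDensity_eq_integral_toReal_smul₀ hρ'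
      (Filter.Eventually.of_forall fun _ => ENNReal.ofReal_lt_top)]
  refine integral_congr_ae (Filter.Eventually.of_forall fun y => ?_)
  simp [ENNReal.toReal_ofReal (Real.sqrt_nonneg _)]

end AreaMeasure

/-! ### Integration by parts against compactly supported functions -/

section CompactSupport

lemma continuous_indicator_of_compact {P : Type*} [TopologicalSpace P] [T2Space P] {S K : Set P}
    (hS : IsOpen S) (hK : IsCompact K) (hKS : K ⊆ S) {f : P → ℝ} (hf : ContinuousOn f S)
    (h0 : ∀ p ∈ S, p ∉ K → f p = 0) :
    Continuous (S.indicator f) ∧ HasCompactSupport (S.indicator f) := by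
  have hz : ∀ p ∉ K, S.indicator f p = 0 := fun p hp => by
    by_cases hpS : p ∈ S
    · rw [indicator_of_mem hpS, h0 p hpS hp]
    · exact indicator_of_notMem hpS _
  refine ⟨continuous_iff_continuousAt.2 fun p => ?_, HasCompactSupport.intro hK hz⟩
  by_cases hp : p ∈ K
  · have h1 : S ∈ 𝓝 p := hS.mem_nhds (hKS hp)
    refine (hf.continuousAt h1).congr ?_
    filter_upwards [h1] with q hq using (indicator_of_mem hq f).symm
  · refine (continuousAt_const (y := (0 : ℝ))).congr ?_
    filter_upwards [hK.isClosed.isOpen_compl.mem_nhds hp] with q hq using (hz q hq).symm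

variable {P : Type*} [NormedAddCommGroup P] [NormedSpace ℝ P]

lemma integral_fderiv_eq_zero [FiniteDimensional ℝ P] [MeasurableSpace P] [BorelSpace P]
    (μ : Measure P) [μ.IsAddHaarMeasure] {f : P → ℝ} (hf : ContDiff ℝ ∞ f)
    (hc : HasCompactSupport f) (v : P) : ∫ p, fderiv ℝ f p v ∂μ = 0 := by
  have h1 : Continuous fun p => fderiv ℝ f p v :=
    (hf.continuous_fderiv (by simp)).clm_apply continuous_const
  have h2 : HasCompactSupport fun p => fderiv ℝ f p v :=
    (hc.fderiv (𝕜 := ℝ)).comp_left (g := fun L : P →L[ℝ] ℝ => L v) rfl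
  have := integral_mul_fderiv_eq_neg_fderiv_mul_of_integrable (μ := μ) (f := fun _ : P => (1 : ℝ))
    (g := f) (v := v) (by simp) (by simpa using h1.integrable_of_hasCompactSupport h2)
    (by simpa using hf.continuous.integrable_of_hasCompactSupport hc)
    (fun _ _ => differentiableAt_const _) (fun p _ => hf.differentiable (by simp) p)
  simpa using this

namespace SmoothFun

variable {S K : Set P}

/-- The functions that vanish outside of `K`. -/
def vanishingIdeal (K : Set P) : Ideal (SmoothFun S) where
  carrier := {u | ∀ p (hp : p ∈ S), p ∉ K → ev hp u = 0}
  add_mem' := fun hu hv p hp hpK => by rw [map_add, hu p hp hpK, hv p hp hpK, add_zero]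
  zero_mem' := fun p hp _ => map_zero _
  smul_mem' := fun c u hu p hp hpK => by rw [smul_eq_mul, map_mul, hu p hp hpK, mul_zero]

lemma deriv_mem_vanishingIdeal (hS : IsRegularSet S) (hK : IsClosed K) {u : SmoothFun S}
    (hu : u ∈ vanishingIdeal K) (v : P) : deriv hS v u ∈ vanishingIdeal K := fun p hp hpK => by
  have h1 : rep u =ᶠ[𝓝[S] p] fun _ => 0 := by
    filter_upwards [self_mem_nhdsWithin, mem_nhdsWithin_of_mem_nhds (hK.isOpen_compl.mem_nhds hpK)]
      with q hq hqK
    rw [← ev_eq hq]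
    exact hu q hq hqK
  rw [ev_deriv, h1.fderivWithin_eq (by rw [← ev_eq hp]; exact hu p hp hpK)]
  simp

/-- The extension by zero. -/
noncomputable def zeroExt (u : SmoothFun S) : P → ℝ := S.indicator (rep u)

lemma zeroExt_of_mem (u : SmoothFun S) {p : P} (hp : p ∈ S) : zeroExt u p = ev hp u := by
  rw [zeroExt, indicator_of_mem hp, ev_eq hp]

lemma zeroExt_of_notMem (u : SmoothFun S) {p : P} (hp : p ∉ S) : zeroExt u p = 0 :=
  indicator_of_notMem hp _

lemma zeroExt_add (u v : SmoothFun S) : zeroExt (u + v) = fun p => zeroExt u p + zeroExt v p := by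
  ext p
  by_cases hp : p ∈ S
  · rw [zeroExt_of_mem _ hp, zeroExt_of_mem _ hp, zeroExt_of_mem _ hp, map_add]
  · rw [zeroExt_of_notMem _ hp, zeroExt_of_notMem _ hp, zeroExt_of_notMem _ hp, add_zero]

lemma zeroExt_neg (u : SmoothFun S) : zeroExt (-u) = fun p => -zeroExt u p := by
  ext p
  by_cases hp : p ∈ S
  · rw [zeroExt_of_mem _ hp, zeroExt_of_mem _ hp, map_neg]
  · rw [zeroExt_of_notMem _ hp, zeroExt_of_notMem _ hp, neg_zero]

lemma zeroExt_zero : zeroExt (0 : SmoothFun S) = fun _ => 0 := by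
  ext p
  by_cases hp : p ∈ S
  · rw [zeroExt_of_mem _ hp, map_zero]
  · rw [zeroExt_of_notMem _ hp]

variable (hSo : IsOpen S) (hK : IsCompact K) (hKS : K ⊆ S) {u : SmoothFun S}
  (hu : u ∈ vanishingIdeal K)
include hSo hK hKS hu

lemma continuous_zeroExt : Continuous (zeroExt u) ∧ HasCompactSupport (zeroExt u) :=
  continuous_indicator_of_compact hSo hK hKS (contDiffOn_rep u).continuousOn fun p hp hpK => by
    rw [← ev_eq hp, hu p hp hpK]

omit hSo in
lemma zeroExt_eventuallyEq_zero {p : P} (hp : p ∉ S) : zeroExt u =ᶠ[𝓝 p] fun _ => 0 := by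
  filter_upwards [hK.isClosed.isOpen_compl.mem_nhds fun h => hp (hKS h)] with q hq
  by_cases hqS : q ∈ S
  · rw [zeroExt_of_mem u hqS, hu q hqS hq]
  · exact zeroExt_of_notMem u hqS

lemma contDiff_zeroExt : ContDiff ℝ ∞ (zeroExt u) := by
  refine contDiff_iff_contDiffAt.2 fun p => ?_
  by_cases hp : p ∈ S
  · have h1 : S ∈ 𝓝 p := hSo.mem_nhds hp
    refine ((contDiffOn_rep u).contDiffAt h1).congr_of_eventuallyEq ?_
    filter_upwards [h1] with q hq using indicator_of_mem hq _
  · exact contDiffAt_const.congr_of_eventuallyEq (zeroExt_eventuallyEq_zero hK hKS hu hp)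

/-- The integral of a derivative of a compactly supported function vanishes. -/
lemma integral_zeroExt_deriv [FiniteDimensional ℝ P] [MeasurableSpace P] [BorelSpace P]
    (μ : Measure P) [μ.IsAddHaarMeasure] (hS : IsRegularSet S) (v : P) :
    ∫ p, zeroExt (deriv hS v u) p ∂μ = 0 := by
  rw [← integral_fderiv_eq_zero μ (contDiff_zeroExt hSo hK hKS hu)
    (continuous_zeroExt hSo hK hKS hu).2 v]
  refine integral_congr_ae (Filter.Eventually.of_forall fun p => ?_)
  by_cases hp : p ∈ S
  · have h1 : S ∈ 𝓝 p := hSo.mem_nhds hp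
    have h2 : zeroExt u =ᶠ[𝓝 p] rep u := by
      filter_upwards [h1] with q hq using indicator_of_mem hq _
    simp only
    rw [zeroExt_of_mem _ hp, ev_deriv, fderivWithin_of_isOpen hSo hp, h2.fderiv_eq]
  · simp only
    rw [zeroExt_of_notMem _ hp, (zeroExt_eventuallyEq_zero hK hKS hu hp).fderiv_eq]
    simp

lemma integrable_zeroExt [MeasurableSpace P] [BorelSpace P]
    (μ : Measure P) [IsFiniteMeasureOnCompacts μ] : Integrable (zeroExt u) μ :=
  (continuous_zeroExt hSo hK hKS hu).1.integrable_of_hasCompactSupport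
    (continuous_zeroExt hSo hK hKS hu).2

end SmoothFun

end CompactSupport

section WeakInequality

variable {n : ℕ} {Ω : Set (EuclideanSpace ℝ (Fin n))} {J : Set ℝ}
  {Z N : EuclideanSpace ℝ (Fin n) × ℝ → EuclideanSpace ℝ (Fin (n + 1))}
  {K : Set (EuclideanSpace ℝ (Fin n) × ℝ)}

namespace IsCoordHypersurface

open SmoothFun

/-- The formal adjoint of the operator `∂_t - Δ - |A|²` with respect to the area measure. -/
noncomputable def adjoint (h : IsCoordHypersurface Ω J Z N) (η : SmoothFun (Ω ×ˢ J)) :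
    SmoothFun (Ω ×ˢ J) :=
  -h.alg.τ η - h.alg.Δ η + h.alg.H * h.alg.H * η - h.alg.N * η

section

variable (h : IsCoordHypersurface Ω J Z N) (hK : IsClosed K) {η : SmoothFun (Ω ×ˢ J)}
  (hη : η ∈ vanishingIdeal K)
include hK hη

lemma d_mem (i : Fin n) : h.alg.d i η ∈ vanishingIdeal K :=
  deriv_mem_vanishingIdeal h.regular hK hη _

lemma τ_mem : h.alg.τ η ∈ vanishingIdeal K :=
  deriv_mem_vanishingIdeal h.regular hK hη _

lemma δ_mem (a : Fin (n + 1)) : h.alg.δ a η ∈ vanishingIdeal K := by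
  rw [HypersurfaceAlgebra.δ_apply]
  exact Ideal.sum_mem _ fun i _ => Ideal.mul_mem_left _ _ (h.d_mem hK hη i)

lemma adjoint_mem : h.adjoint η ∈ vanishingIdeal K := by
  have hΔ : h.alg.Δ η ∈ vanishingIdeal K := by
    rw [HypersurfaceAlgebra.Δ_apply]
    exact Ideal.sum_mem _ fun a _ => h.δ_mem hK (h.δ_mem hK hη a) a
  exact sub_mem (add_mem (sub_mem (neg_mem (h.τ_mem hK hη)) hΔ) (Ideal.mul_mem_left _ _ hη))
    (Ideal.mul_mem_left _ _ hη)

end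

variable (h : IsCoordHypersurface Ω J Z N) {η : SmoothFun (Ω ×ˢ J)} (hη : η ∈ vanishingIdeal K)
  (hK : IsCompact K) (hKS : K ⊆ Ω ×ˢ J) (hJ : IsOpen J)
include hη hK hKS hJ

/-- The divergence terms in Green's identity do not contribute to the integral. -/
lemma integral_divergence (G : SmoothFun (Ω ×ˢ J)) : ∫ p, zeroExt
    ((∑ i, h.alg.d i (h.alg.s * ∑ j, h.alg.gi i j * (η * h.alg.d j G - G * h.alg.d j η))) -
      h.alg.τ (h.alg.s * (G * η))) p = 0 := by
  have hS : IsOpen (Ω ×ˢ J) := h.isOpen.prod hJ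
  have : (volume : Measure (EuclideanSpace ℝ (Fin n) × ℝ)).IsAddHaarMeasure :=
    Measure.prod.instIsAddHaarMeasure volume volume
  have h1 : ∀ i, h.alg.s * ∑ j, h.alg.gi i j * (η * h.alg.d j G - G * h.alg.d j η) ∈
      vanishingIdeal K := fun i =>
    Ideal.mul_mem_left _ _ (Ideal.sum_mem _ fun j _ => Ideal.mul_mem_left _ _
      (sub_mem (Ideal.mul_mem_right _ _ hη)
        (Ideal.mul_mem_left _ _ (h.d_mem hK.isClosed hη j))))
  have h2 : h.alg.s * (G * η) ∈ vanishingIdeal K :=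
    Ideal.mul_mem_left _ _ (Ideal.mul_mem_left _ _ hη)
  have h3 := (vanishingIdeal (S := Ω ×ˢ J) K).neg_mem (h.τ_mem hK.isClosed h2)
  have h4 : ∀ i, h.alg.d i (h.alg.s * ∑ j, h.alg.gi i j *
      (η * h.alg.d j G - G * h.alg.d j η)) ∈ vanishingIdeal K := fun i =>
    h.d_mem hK.isClosed (h1 i) i
  have h5 : ∀ s : Finset (Fin n), (∑ i ∈ s, h.alg.d i (h.alg.s * ∑ j, h.alg.gi i j *
      (η * h.alg.d j G - G * h.alg.d j η))) ∈ vanishingIdeal K := fun s =>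
    Ideal.sum_mem _ fun i _ => h4 i
  have h6 : ∀ s : Finset (Fin n), ∫ p, zeroExt (∑ i ∈ s, h.alg.d i (h.alg.s * ∑ j, h.alg.gi i j *
      (η * h.alg.d j G - G * h.alg.d j η))) p = 0 := fun s => by
    induction s using Finset.cons_induction with
    | empty => simp [zeroExt_zero]
    | cons i s hi ih =>
      rw [Finset.sum_cons, zeroExt_add]
      simp only
      rw [integral_add (integrable_zeroExt hS hK hKS (h4 i) _)
        (integrable_zeroExt hS hK hKS (h5 s) _), ih, add_zero]
      exact integral_zeroExt_deriv hS hK hKS (h1 i) volume h.regular _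
  rw [sub_eq_add_neg, zeroExt_add]
  simp only
  rw [integral_add (integrable_zeroExt hS hK hKS (h5 _) _)
    (integrable_zeroExt hS hK hKS h3 _), h6, zero_add, zeroExt_neg, integral_neg, neg_eq_zero]
  exact integral_zeroExt_deriv hS hK hKS h2 volume h.regular _

/-- A uniform limit of smooth approximate supersolutions is a weak supersolution. -/
lemma integral_adjoint_nonneg (hY : h.alg.IsFlow)
    (hη0 : ∀ p (hp : p ∈ Ω ×ˢ J), 0 ≤ ev hp η) {g : EuclideanSpace ℝ (Fin n) × ℝ → ℝ}
    (hg : ContinuousOn g (Ω ×ˢ J))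
    (happrox : ∀ ε > 0, ∃ G : SmoothFun (Ω ×ˢ J), ∀ p (hp : p ∈ Ω ×ˢ J), |ev hp G - g p| ≤ ε ∧
      ev hp h.alg.N * (ev hp G - ε) ≤ ev hp (h.alg.L G)) :
    0 ≤ ∫ p, g p * zeroExt (h.alg.s * h.adjoint η) p := by
  have hS : IsOpen (Ω ×ˢ J) := h.isOpen.prod hJ
  set θ := h.alg.s * h.adjoint η with hθ
  have hθK : θ ∈ vanishingIdeal K := Ideal.mul_mem_left _ _ (h.adjoint_mem hK.isClosed hη)
  have hNK : h.alg.s * h.alg.N * η ∈ vanishingIdeal K := Ideal.mul_mem_left _ _ hη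
  have hint1 := (integrable_zeroExt hS hK hKS hθK volume).abs
  have hint2 := integrable_zeroExt hS hK hKS hNK volume
  have hint : Integrable (fun p => g p * zeroExt θ p) := by
    have h1 := continuous_indicator_of_compact hS hK hKS
      (hg.mul (continuous_zeroExt hS hK hKS hθK).1.continuousOn) fun p hp hpK => by
        rw [Pi.mul_apply, zeroExt_of_mem _ hp, hθK p hp hpK, mul_zero]
    refine (h1.1.integrable_of_hasCompactSupport h1.2).congr
      (Filter.Eventually.of_forall fun p => ?_)
    by_cases hp : p ∈ Ω ×ˢ J
    · exact indicator_of_mem hp _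
    · simp only
      rw [indicator_of_notMem hp, zeroExt_of_notMem _ hp, mul_zero]
  set C := (∫ p, |zeroExt θ p|) + ∫ p, zeroExt (h.alg.s * h.alg.N * η) p with hC
  -- Green's identity for a smooth approximation within `ε`; the errors come from replacing `g` by
  -- `G` against `θ`, and from the defect `ε |A|²` in the supersolution inequality
  have key : ∀ ε > 0, -(ε * C) ≤ ∫ p, g p * zeroExt θ p := fun ε hε => by
    obtain ⟨G, hG⟩ := happrox ε hε
    have hdiv := h.integral_divergence hη hK hKS hJ G
    set D := (∑ i, h.alg.d i (h.alg.s * ∑ j, h.alg.gi i j *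
      (η * h.alg.d j G - G * h.alg.d j η))) - h.alg.τ (h.alg.s * (G * η)) with hD
    have hgreen := hY.green G η
    rw [← hD] at hgreen
    have hDK : D ∈ vanishingIdeal K := by
      have : D = G * θ + h.alg.s * h.alg.N * η * G - h.alg.s * (η * h.alg.L G) := by
        rw [hθ, adjoint]
        linear_combination -hgreen
      rw [this]
      exact sub_mem (add_mem (Ideal.mul_mem_left _ _ hθK) (Ideal.mul_mem_right _ _ hNK))
        (Ideal.mul_mem_left _ _ (Ideal.mul_mem_right _ _ hη))
    have hint3 := integrable_zeroExt hS hK hKS hDK volume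
    have hint4 : Integrable fun p =>
        -(ε * (|zeroExt θ p| + zeroExt (h.alg.s * h.alg.N * η) p)) :=
      ((hint1.add hint2).const_mul ε).neg
    have h1 : ∫ p, (-(ε * (|zeroExt θ p| + zeroExt (h.alg.s * h.alg.N * η) p)) + zeroExt D p) =
        -(ε * C) := by
      rw [integral_add hint4 hint3, hdiv, add_zero, integral_neg,
        integral_const_mul, integral_add hint1 hint2]
    rw [← h1]
    refine integral_mono (hint4.add hint3) hint fun p => ?_
    by_cases hp : p ∈ Ω ×ˢ J
    · obtain ⟨h2, h3⟩ := hG p hp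
      simp only [zeroExt_of_mem _ hp]
      have h4 := congrArg (ev hp) hgreen
      have h5 : ev hp θ = ev hp h.alg.s * ev hp (h.adjoint η) := map_mul _ _ _
      simp only [adjoint, map_mul, map_add, map_sub, map_neg] at h4 h5 ⊢
      have h6 : 0 ≤ ev hp h.alg.s * ev hp η := mul_nonneg (h.ev_s_pos hp).le (hη0 p hp)
      have h7 := mul_le_mul_of_nonneg_left h3 h6
      have h8 : -(ε * |ev hp θ|) ≤ (g p - ev hp G) * ev hp θ := by
        have := neg_abs_le ((g p - ev hp G) * ev hp θ)
        rw [abs_mul, abs_sub_comm] at this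
        have h9 := mul_le_mul_of_nonneg_right h2 (abs_nonneg (ev hp θ))
        linarith
      have h10 : ev hp G * ev hp θ = ev hp h.alg.s * (ev hp η * ev hp (h.alg.L G)) + ev hp D -
          ev hp h.alg.s * ev hp η * (ev hp h.alg.N * ev hp G) := by
        rw [h5]
        linear_combination h4
      nlinarith [h7, h8, h10]
    · simp only [zeroExt_of_notMem _ hp]
      simp
  by_contra! hneg
  have hCpos : 0 ≤ |C| := abs_nonneg C
  have h1 := key ((-∫ p, g p * zeroExt θ p) / (2 * (|C| + 1))) (by
    exact div_pos (by linarith) (by linarith))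
  have h2 : (-∫ p, g p * zeroExt θ p) / (2 * (|C| + 1)) * C ≤ (-∫ p, g p * zeroExt θ p) / 2 := by
    rw [div_mul_eq_mul_div, div_le_div_iff₀ (by linarith) (by norm_num)]
    have := le_abs_self C
    nlinarith
  linarith

end IsCoordHypersurface

end WeakInequality

/-! ### Smooth approximation and the distributional sense -/

section Approximation

variable {n : ℕ} {M : Type*} [TopologicalSpace M] [ChartedSpace (EuclideanSpace ℝ (Fin n)) M]
  [IsManifold (𝓡 n) ∞ M] {e : OpenPartialHomeomorph M (EuclideanSpace ℝ (Fin n))}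
  {J : Set ℝ} {X ν : ℝ → M → EuclideanSpace ℝ (Fin (n + 1))}
  {F : EuclideanSpace ℝ (Fin n × Fin n) → ℝ}

lemma contMDiffOn_of_contDiffOn_inChart {V : Type*} [NormedAddCommGroup V] [NormedSpace ℝ V]
    (he : e ∈ atlas (EuclideanSpace ℝ (Fin n)) M) {u : ℝ → M → V}
    (hu : ContDiffOn ℝ ∞ (inChart e u) (e.target ×ˢ J)) :
    ContMDiffOn ((𝓡 n).prod 𝓘(ℝ, ℝ)) 𝓘(ℝ, V) ∞ (fun p : M × ℝ => u p.2 p.1) (e.source ×ˢ J) := by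
  have h1 : ContMDiffOn (𝓡 n) (𝓡 n) ∞ e e.source :=
    contMDiffOn_of_mem_maximalAtlas (IsManifold.subset_maximalAtlas he)
  have h2 : ContMDiffOn ((𝓡 n).prod 𝓘(ℝ, ℝ)) 𝓘(ℝ, EuclideanSpace ℝ (Fin n) × ℝ) ∞
      (fun p : M × ℝ => (e p.1, p.2)) (e.source ×ˢ J) :=
    (h1.comp contMDiffOn_fst fun p hp => hp.1).prodMk_space contMDiffOn_snd
  refine (hu.contMDiffOn.comp h2 fun p hp => ⟨e.map_source hp.1, hp.2⟩).congr fun p hp => ?_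
  simp [inChart, e.left_inv hp.1]

variable (hJ : J.OrdConnected) (hJ' : J.Nontrivial) (hJo : IsOpen J)
  (hX : IsMeanCurvatureFlow J X) (hν : IsUnitNormal J X ν)
  (he : e ∈ atlas (EuclideanSpace ℝ (Fin n)) M)
include hJ hJ' hJo hX hν he

/-- Near each point, invariant functions of the Weingarten tensor are functions of a matrix that
depends smoothly on the point. -/
lemma exists_contDiffAt_eq
    (hF : ∀ Q (hQ : Q ∈ Matrix.orthogonalGroup (Fin n) ℝ) v, F (conjIsometry Q hQ v) = F v)
    {p : EuclideanSpace ℝ (Fin n) × ℝ} (hp : p ∈ e.target ×ˢ J) :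
    ∃ w : EuclideanSpace ℝ (Fin n) × ℝ → EuclideanSpace ℝ (Fin n × Fin n), ContDiffAt ℝ ∞ w p ∧
      ∀ᶠ q in 𝓝 p, F (weingartenVec X ν q.2 (e.symm q.1)) = F (w q) := by
  obtain ⟨Ω, V, h, hp', W, -, -, hV, -, -, hWQ, -⟩ := exists_local_weingarten hJ hJ' hX hν hp.2
    isOpen_univ he (e.map_target hp.1) (mem_univ _)
  rw [e.right_inv hp.1] at hp'
  have hmem : Ω ×ˢ (J ∩ V) ∈ 𝓝 p := (h.isOpen.prod (hJo.inter hV)).mem_nhds hp'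
  refine ⟨fun q => matVec (Matrix.of fun i j => SmoothFun.rep (W i j) q), ?_, ?_⟩
  · refine contDiffAt_euclidean.2 fun ij => ?_
    exact (SmoothFun.contDiffOn_rep (W ij.1 ij.2)).contDiffAt hmem
  · filter_upwards [hmem] with q hq
    obtain ⟨Q, hQ, h1⟩ := hWQ q hq
    rw [h1, hF]
    congr 2
    ext i j
    exact SmoothFun.ev_eq hq _

lemma contDiffOn_invariant
    (hF : ∀ Q (hQ : Q ∈ Matrix.orthogonalGroup (Fin n) ℝ) v, F (conjIsometry Q hQ v) = F v)
    (hs : ContDiff ℝ ∞ F) : ContDiffOn ℝ ∞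
      (inChart e fun t x => F (weingartenVec X ν t x)) (e.target ×ˢ J) := fun p hp => by
  obtain ⟨w, hw, heq⟩ := exists_contDiffAt_eq hJ hJ' hJo hX hν he hF hp
  exact ((hs.contDiffAt.comp p hw).congr_of_eventuallyEq heq).contDiffWithinAt

lemma continuousOn_invariant
    (hF : ∀ Q (hQ : Q ∈ Matrix.orthogonalGroup (Fin n) ℝ) v, F (conjIsometry Q hQ v) = F v)
    (hs : Continuous F) :
    ContinuousOn (inChart e fun t x => F (weingartenVec X ν t x)) (e.target ×ˢ J) := fun p hp => by
  obtain ⟨w, hw, heq⟩ := exists_contDiffAt_eq hJ hJ' hJo hX hν he hF hp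
  exact ((hs.continuousAt.comp hw.continuousAt).congr_of_eventuallyEq heq).continuousWithinAt

/-- Smooth functions of the Weingarten tensor with approximate supergradients are approximate
supersolutions. -/
lemma mul_le_ev_L {ε : ℝ}
    (hF : ∀ Q (hQ : Q ∈ Matrix.orthogonalGroup (Fin n) ℝ) v, F (conjIsometry Q hQ v) = F v)
    (hsg : ∀ W₀, ∃ B, (∀ W, F W ≤ F W₀ + inner ℝ B (W - W₀)) ∧ F W₀ - ε ≤ inner ℝ B W₀)
    (h : IsCoordHypersurface e.target J (inChart e X) (inChart e ν))
    {G : SmoothFun (e.target ×ˢ J)} (hG : ∀ p (hp : p ∈ e.target ×ˢ J),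
      SmoothFun.ev hp G = inChart e (fun t x => F (weingartenVec X ν t x)) p)
    (hs : ContDiffOn ℝ ∞ (inChart e fun t x => F (weingartenVec X ν t x)) (e.target ×ˢ J))
    {p : EuclideanSpace ℝ (Fin n) × ℝ} (hp : p ∈ e.target ×ˢ J) :
    SmoothFun.ev hp h.alg.N * (SmoothFun.ev hp G - ε) ≤ SmoothFun.ev hp (h.alg.L G) := by
  -- `F` of the Weingarten tensor is its own lower support function up to the time `p.2`
  have hoc : (J ∩ Iic p.2).OrdConnected := hJ.inter ordConnected_Iic
  have hnt : (J ∩ Iic p.2).Nontrivial := by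
    obtain ⟨l, hl, hlJ⟩ := exists_Ioc_subset_of_mem_nhds (hJo.mem_nhds hp.2) (exists_lt p.2)
    exact ⟨(l + p.2) / 2, ⟨hlJ ⟨by linarith, by linarith⟩, by simp only [mem_Iic]; linarith⟩, p.2,
      ⟨hp.2, mem_Iic.2 le_rfl⟩, by linarith⟩
  have hφ := contMDiffOn_of_contDiffOn_inChart he hs
  have h1 := le_heat_of_support hoc hnt (hX.mono hoc hnt inter_subset_left)
    (hν.mono inter_subset_left) hF hsg ⟨hp.2, mem_Iic.2 le_rfl⟩ inter_subset_right e.open_source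
    (e.map_target hp.1) (hφ.mono (prod_mono le_rfl inter_subset_left)) (fun _ _ _ _ => le_rfl) rfl
  have e1 : SmoothFun.ev hp (h.alg.τ G) = _ := h.ev_τ hG hp
  have hu : UniqueDiffWithinAt ℝ (J ∩ Iic p.2) p.2 := uniqueDiffOn_convex hoc.convex
    (nonempty_interior_of_ordConnected hoc hnt) _ ⟨hp.2, mem_Iic.2 le_rfl⟩
  have hd := hasDerivWithinAt_slice hp (hs.differentiableOn (by simp) p hp)
  have e4 : derivWithin (fun t => F (weingartenVec X ν t (e.symm p.1))) (J ∩ Iic p.2) p.2 = _ :=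
    (hd.mono inter_subset_left).derivWithin hu
  rw [e4, laplaceBeltrami_eq_ev hJ hJ' hX hν he h le_rfl e.open_source e.mapsTo_symm hφ hG hp,
    normSqA_eq_ev hJ hJ' hX hν he h le_rfl hp] at h1
  rw [HypersurfaceAlgebra.L_apply, map_sub, e1, hd.derivWithin (hu.mono inter_subset_left), hG]
  exact h1

variable {Γ : Set (Matrix (Fin n) (Fin n) ℝ)} (hΓ : IsInvariantConvexCone Γ)
include hΓ

lemma continuousOn_curvatureDist : ContinuousOn
    (inChart e fun t x => curvatureDist Γ (X t) (ν t) x) (e.target ×ˢ J) := by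
  refine (continuousOn_invariant hJ hJ' hJo hX hν he (fun Q hQ v => hΓ.coneDist_conj hQ v)
    hΓ.isProperCone.lipschitz_coneDist.continuous).congr fun p hp => ?_
  exact curvatureDist_eq_coneDist hJ hJ' hX hν hΓ hp.2 _

/-- The signed distance is a uniform limit of smooth approximate supersolutions. -/
lemma exists_smooth_approx
    (h : IsCoordHypersurface e.target J (inChart e X) (inChart e ν)) {ε : ℝ} (hε : 0 < ε) :
    ∃ G : SmoothFun (e.target ×ˢ J), ∀ p (hp : p ∈ e.target ×ˢ J),
      |SmoothFun.ev hp G - inChart e (fun t x => curvatureDist Γ (X t) (ν t) x) p| ≤ ε ∧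
      SmoothFun.ev hp h.alg.N * (SmoothFun.ev hp G - ε) ≤ SmoothFun.ev hp (h.alg.L G) := by
  have hC := hΓ.isProperCone
  have hF : ∀ Q (hQ : Q ∈ Matrix.orthogonalGroup (Fin n) ℝ) v,
      mollify ε (coneDist (symSubmodule n) (matVec '' Γ)) (conjIsometry Q hQ v) =
        mollify ε (coneDist (symSubmodule n) (matVec '' Γ)) v := fun Q hQ v =>
    mollify_map _ (fun W => hΓ.coneDist_conj hQ W) v
  have hs := contDiffOn_invariant hJ hJ' hJo hX hν he hF
    (contDiff_mollify hε hC.lipschitz_coneDist.continuous)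
  refine ⟨SmoothFun.mk _ hs, fun p hp => ⟨?_, ?_⟩⟩
  · rw [SmoothFun.ev_mk, inChart, inChart, curvatureDist_eq_coneDist hJ hJ' hX hν hΓ hp.2]
    exact abs_mollify_sub_le hε hC.lipschitz_coneDist _
  · exact mul_le_ev_L hJ hJ' hJo hX hν he hF (exists_supergradient_mollify hε hC.lipschitz_coneDist
      hC.concaveOn_coneDist fun c hc W => hC.coneDist_smul hc W) h (fun _ _ => rfl) hs hp

end Approximation

section Distributional

variable {n : ℕ} {M : Type*} [TopologicalSpace M] [ChartedSpace (EuclideanSpace ℝ (Fin n)) M]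
  {J : Set ℝ} {X ν : ℝ → M → EuclideanSpace ℝ (Fin (n + 1))} {G η : ℝ → M → ℝ}

/-- The integrand in the weak formulation of the supersolution property. -/
noncomputable def testIntegrand (X ν : ℝ → M → EuclideanSpace ℝ (Fin (n + 1))) (G η : ℝ → M → ℝ)
    (t : ℝ) (x : M) : ℝ :=
  G t x * (-deriv (fun s => η s x) t - laplaceBeltrami (X t) (η t) x +
    (meanCurvature (X t) (ν t) x) ^ 2 * η t x - normSqA (X t) (ν t) x * η t x)

lemma laplaceBeltrami_eq_zero {Y : M → EuclideanSpace ℝ (Fin (n + 1))} {u : M → ℝ} {x : M}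
    (hu : u =ᶠ[𝓝 x] fun _ => 0) : laplaceBeltrami Y u x = 0 := by
  set e := chartAt (EuclideanSpace ℝ (Fin n)) x with he
  have hx : x ∈ e.source := mem_chart_source _ x
  have h1 : u ∘ e.symm =ᶠ[𝓝 (e x)] fun _ => 0 := by
    have := e.continuousAt_symm (e.map_source hx)
    rw [ContinuousAt, e.left_inv hx] at this
    exact this.eventually hu
  have h2 : ∀ i : Fin n, (fun y => ∑ j : Fin n, (Real.sqrt (chartMetric Y e y).det *
      (chartMetric Y e y)⁻¹ i j) • fderiv ℝ (u ∘ e.symm) y (EuclideanSpace.single j 1)) =ᶠ[𝓝 (e x)]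
      fun _ => 0 := fun i => by
    filter_upwards [h1.fderiv (𝕜 := ℝ)] with y hy
    simp [hy]
  simp only [laplaceBeltrami, ← he]
  rw [Finset.sum_eq_zero fun i _ => by rw [(h2 i).fderiv_eq]; simp, smul_zero]

lemma testIntegrand_eq_zero {x : M} {t : ℝ} (h : ∀ᶠ p : M × ℝ in 𝓝 (x, t), η p.2 p.1 = 0) :
    testIntegrand X ν G η t x = 0 := by
  have h1 : η t =ᶠ[𝓝 x] fun _ => 0 :=
    (Continuous.prodMk_left (X := M) t).continuousAt.eventually h
  have h2 : (fun s => η s x) =ᶠ[𝓝 t] fun _ => 0 :=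
    (Continuous.prodMk_right (Y := ℝ) x).continuousAt.eventually h
  rw [testIntegrand, laplaceBeltrami_eq_zero h1, h2.deriv_eq, h1.self_of_nhds]
  simp

variable [IsManifold (𝓡 n) ∞ M]

lemma meanCurvature_eq_ev {e : OpenPartialHomeomorph M (EuclideanSpace ℝ (Fin n))}
    (hJ : J.OrdConnected) (hJ' : J.Nontrivial)
    (hX : IsMeanCurvatureFlow J X) (hν : IsUnitNormal J X ν)
    (he : e ∈ atlas (EuclideanSpace ℝ (Fin n)) M)
    (h : IsCoordHypersurface e.target J (inChart e X) (inChart e ν))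
    {p : EuclideanSpace ℝ (Fin n) × ℝ} (hp : p ∈ e.target ×ˢ J) :
    meanCurvature (X p.2) (ν p.2) (e.symm p.1) = SmoothFun.ev hp h.alg.H := by
  have h1 : ∀ a, meanCurvatureVector (X p.2) (e.symm p.1) a =
      -(SmoothFun.ev hp h.alg.H * ν p.2 (e.symm p.1) a) := fun a => by
    rw [meanCurvatureVector_apply hJ hJ' hX hν hp.2]
    have h2 := laplaceBeltrami_eq_ev hJ hJ' hX hν he h le_rfl isOpen_univ (mapsTo_univ _ _)
      (contMDiffOn_apply hX a) (w := h.alg.X a) (u := fun t x => X t x a) (fun _ _ => rfl) hp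
    rw [h.alg.Δ_X, map_neg, map_mul] at h2
    exact h2
  have h3 : ∑ a, ν p.2 (e.symm p.1) a * ν p.2 (e.symm p.1) a = 1 :=
    normal_dotProduct_self hν hp.2 _
  rw [meanCurvature, PiLp.inner_apply]
  have h4 : ∀ a, inner ℝ (meanCurvatureVector (X p.2) (e.symm p.1) a) (ν p.2 (e.symm p.1) a) =
      -(SmoothFun.ev hp h.alg.H) * (ν p.2 (e.symm p.1) a * ν p.2 (e.symm p.1) a) := fun a => by
    rw [h1]
    simp
    ring
  rw [Finset.sum_congr rfl fun a _ => h4 a, ← Finset.mul_sum, h3]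
  ring

variable (hJ : J.OrdConnected) (hJ' : J.Nontrivial) (hJo : IsOpen J)
  (hX : IsMeanCurvatureFlow J X) (hν : IsUnitNormal J X ν)
include hJ hJ' hJo hX hν

lemma testIntegrand_eq_ev {e : OpenPartialHomeomorph M (EuclideanSpace ℝ (Fin n))}
    (he : e ∈ atlas (EuclideanSpace ℝ (Fin n)) M)
    (h : IsCoordHypersurface e.target J (inChart e X) (inChart e ν))
    (hη : ContMDiff ((𝓡 n).prod 𝓘(ℝ, ℝ)) 𝓘(ℝ, ℝ) ∞ (fun p : M × ℝ => η p.2 p.1))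
    {w : SmoothFun (e.target ×ˢ J)}
    (hw : ∀ p (hp : p ∈ e.target ×ˢ J), SmoothFun.ev hp w = inChart e η p)
    {p : EuclideanSpace ℝ (Fin n) × ℝ} (hp : p ∈ e.target ×ˢ J) :
    testIntegrand X ν G η p.2 (e.symm p.1) =
      G p.2 (e.symm p.1) * SmoothFun.ev hp (h.adjoint w) := by
  have h1 : SmoothFun.ev hp (h.alg.τ w) = deriv (fun s => η s (e.symm p.1)) p.2 :=
    (h.ev_τ hw hp).trans (derivWithin_of_isOpen hJo hp.2)
  rw [testIntegrand, laplaceBeltrami_eq_ev hJ hJ' hX hν he h le_rfl isOpen_univ (mapsTo_univ _ _)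
    hη.contMDiffOn hw hp, meanCurvature_eq_ev hJ hJ' hX hν he h hp,
    normSqA_eq_ev hJ hJ' hX hν he h le_rfl hp, ← h1, IsCoordHypersurface.adjoint]
  simp only [map_sub, map_add, map_neg, map_mul, hw, inChart]
  ring

lemma testIntegrand_sum {ι : Type*} (s : Finset ι) {η : ι → ℝ → M → ℝ}
    (hη : ∀ k, ContMDiff ((𝓡 n).prod 𝓘(ℝ, ℝ)) 𝓘(ℝ, ℝ) ∞ (fun p : M × ℝ => η k p.2 p.1))
    {t : ℝ} (ht : t ∈ J) (x : M) :
    testIntegrand X ν G (fun t x => ∑ k ∈ s, η k t x) t x =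
      ∑ k ∈ s, testIntegrand X ν G (η k) t x := by
  set e := chartAt (EuclideanSpace ℝ (Fin n)) x
  have hx : x ∈ e.source := mem_chart_source _ x
  have hea : e ∈ atlas (EuclideanSpace ℝ (Fin n)) M := chart_mem_atlas _ x
  have h := isCoordHypersurface_inChart hJ hJ' hX hν hea e.open_target le_rfl
  have hp := mk_mem_prod (e.map_source hx) ht
  let w : ι → SmoothFun (e.target ×ˢ J) := fun k => SmoothFun.mk (inChart e (η k))
    (contDiffOn_inChart hea (hη k).contMDiffOn le_rfl (mapsTo_univ _ _))
  have h1 := fun k => testIntegrand_eq_ev (G := G) hJ hJ' hJo hX hν hea h (hη k) (w := w k)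
    (fun _ _ => rfl) hp
  have hsum : ContMDiff ((𝓡 n).prod 𝓘(ℝ, ℝ)) 𝓘(ℝ, ℝ) ∞
      (fun p : M × ℝ => ∑ k ∈ s, η k p.2 p.1) := contMDiff_finsetSum fun k _ => hη k
  have h2 := testIntegrand_eq_ev (G := G) hJ hJ' hJo hX hν hea h
    (η := fun t x => ∑ k ∈ s, η k t x) hsum (w := ∑ k ∈ s, w k)
    (fun q hq => by rw [map_sum]; rfl) hp
  simp only [e.left_inv hx] at h1 h2
  have h3 : h.adjoint (∑ k ∈ s, w k) = ∑ k ∈ s, h.adjoint (w k) := by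
    simp only [IsCoordHypersurface.adjoint, map_sum, Finset.mul_sum, Finset.sum_add_distrib,
      Finset.sum_sub_distrib, Finset.sum_neg_distrib]
  rw [h2, h3, map_sum, Finset.mul_sum]
  exact Finset.sum_congr rfl fun k _ => (h1 k).symm

variable [MeasurableSpace M] [BorelSpace M]
  {Γ : Set (Matrix (Fin n) (Fin n) ℝ)} (hΓ : IsInvariantConvexCone Γ)
include hΓ

/-- The weak inequality for test functions that are supported in the domain of a chart. -/
lemma weak_inequality_of_tsupport_subset {x₀ : M}
    (hη : ContMDiff ((𝓡 n).prod 𝓘(ℝ, ℝ)) 𝓘(ℝ, ℝ) ∞ (fun p : M × ℝ => η p.2 p.1))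
    (hc : HasCompactSupport (fun p : M × ℝ => η p.2 p.1))
    (hsupp : tsupport (fun p : M × ℝ => η p.2 p.1) ⊆
      (chartAt (EuclideanSpace ℝ (Fin n)) x₀).source ×ˢ J) (hη0 : ∀ t x, 0 ≤ η t x) :
    (∀ t ∈ J, Integrable (testIntegrand X ν (fun t x => curvatureDist Γ (X t) (ν t) x) η t)
      (areaMeasure (X t))) ∧
    IntegrableOn (fun t => ∫ x, testIntegrand X ν (fun t x => curvatureDist Γ (X t) (ν t) x) η t x
      ∂(areaMeasure (X t))) J ∧
    0 ≤ ∫ t in J, ∫ x, testIntegrand X ν (fun t x => curvatureDist Γ (X t) (ν t) x) η t x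
      ∂(areaMeasure (X t)) := by
  set e := chartAt (EuclideanSpace ℝ (Fin n)) x₀ with he
  set G : ℝ → M → ℝ := fun t x => curvatureDist Γ (X t) (ν t) x with hG
  have hea : e ∈ atlas (EuclideanSpace ℝ (Fin n)) M := chart_mem_atlas _ x₀
  have h := isCoordHypersurface_inChart hJ hJ' hX hν hea e.open_target le_rfl
  have hS : IsOpen (e.target ×ˢ J) := e.open_target.prod hJo
  let w : SmoothFun (e.target ×ˢ J) := SmoothFun.mk (inChart e η)
    (contDiffOn_inChart hea hη.contMDiffOn le_rfl (mapsTo_univ _ _))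
  -- the support in the chart
  set K : Set (EuclideanSpace ℝ (Fin n) × ℝ) :=
    (fun p : M × ℝ => (e p.1, p.2)) '' tsupport (fun p : M × ℝ => η p.2 p.1) with hKdef
  have hK : IsCompact K := by
    refine IsCompact.image_of_continuousOn hc ?_
    exact (e.continuousOn.comp continuousOn_fst fun p hp => (hsupp hp).1).prodMk continuousOn_snd
  have hKS : K ⊆ e.target ×ˢ J := by
    rintro _ ⟨p, hp, rfl⟩
    exact ⟨e.map_source (hsupp hp).1, (hsupp hp).2⟩
  have hwK : w ∈ SmoothFun.vanishingIdeal K := fun p hp hpK => by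
    have h1 : (e.symm p.1, p.2) ∉ tsupport (fun p : M × ℝ => η p.2 p.1) := fun hmem =>
      hpK ⟨_, hmem, by simp [e.right_inv hp.1]⟩
    exact image_eq_zero_of_notMem_tsupport (f := fun p : M × ℝ => η p.2 p.1) h1
  have hg := continuousOn_curvatureDist hJ hJ' hJo hX hν hea hΓ
  have hnonneg := h.integral_adjoint_nonneg hwK hK hKS hJo (isFlow_alg hJ hJ' hX hν hea h le_rfl)
    (fun p hp => hη0 _ _) hg fun ε hε => exists_smooth_approx hJ hJ' hJo hX hν hea hΓ h hε
  set Ψ : EuclideanSpace ℝ (Fin n) × ℝ → ℝ := fun p =>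
    inChart e G p * SmoothFun.zeroExt (h.alg.s * h.adjoint w) p with hΨ
  have hθK : h.alg.s * h.adjoint w ∈ SmoothFun.vanishingIdeal K :=
    Ideal.mul_mem_left _ _ (h.adjoint_mem hK.isClosed hwK)
  have hΨc : Continuous Ψ ∧ HasCompactSupport Ψ := by
    have h1 := continuous_indicator_of_compact hS hK hKS
      (hg.mul (SmoothFun.continuous_zeroExt hS hK hKS hθK).1.continuousOn) fun p hp hpK => by
        rw [Pi.mul_apply, SmoothFun.zeroExt_of_mem _ hp, hθK p hp hpK, mul_zero]
    have h2 : (e.target ×ˢ J).indicator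
        ((inChart e G) * SmoothFun.zeroExt (h.alg.s * h.adjoint w)) = Ψ := by
      ext p
      by_cases hp : p ∈ e.target ×ˢ J
      · exact indicator_of_mem hp _
      · rw [indicator_of_notMem hp, hΨ]
        simp only
        rw [SmoothFun.zeroExt_of_notMem _ hp, mul_zero]
    rwa [← h2]
  have hΨint : Integrable Ψ := hΨc.1.integrable_of_hasCompactSupport hΨc.2
  have hΨ0 : ∀ p ∉ e.target ×ˢ J, Ψ p = 0 := fun p hp => by
    rw [hΨ]
    simp only
    rw [SmoothFun.zeroExt_of_notMem _ hp, mul_zero]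
  -- properties of the integrand at a fixed time
  have hY : ∀ t ∈ J, MDifferentiable (𝓡 n) 𝓘(ℝ, EuclideanSpace ℝ (Fin (n + 1))) (X t) :=
    fun t ht => hX.mdifferentiableAt ht
  have hslice : ∀ t : ℝ, ContinuousOn (fun y : EuclideanSpace ℝ (Fin n) => (y, t)) e.target :=
    fun t => (Continuous.prodMk_left t).continuousOn
  have hρ : ∀ t ∈ J, ContinuousOn (fun y => (chartMetric (X t) e y).det) e.target := fun t ht => by
    refine ((SmoothFun.contDiffOn_rep h.metric.det).continuousOn.comp (hslice t)
      fun y hy => ⟨hy, ht⟩).congr fun y hy => ?_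
    have hy' : (y, t) ∈ e.target ×ˢ J := ⟨hy, ht⟩
    rw [Function.comp_apply, ← SmoothFun.ev_eq hy', h.ev_det_metric hy']
    rfl
  have heq : ∀ p (hp : p ∈ e.target ×ˢ J), testIntegrand X ν G η p.2 (e.symm p.1) =
      inChart e G p * SmoothFun.ev hp (h.adjoint w) := fun p hp =>
    testIntegrand_eq_ev hJ hJ' hJo hX hν hea h hη (fun _ _ => rfl) hp
  have hcont : ∀ t ∈ J, ContinuousOn (fun y => testIntegrand X ν G η t (e.symm y)) e.target :=
    fun t ht => by
      refine ((hg.mul (SmoothFun.contDiffOn_rep (h.adjoint w)).continuousOn).comp (hslice t)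
        fun y hy => ⟨hy, ht⟩).congr fun y hy => ?_
      have hy' : (y, t) ∈ e.target ×ˢ J := ⟨hy, ht⟩
      rw [Function.comp_apply, Pi.mul_apply, ← SmoothFun.ev_eq hy']
      exact heq _ hy'
  have hzero : ∀ t, ∀ z ∉ e.source, testIntegrand X ν G η t z = 0 := fun t z hz => by
    refine testIntegrand_eq_zero ?_
    have h1 : (z, t) ∉ tsupport (fun p : M × ℝ => η p.2 p.1) := fun hmem => hz (hsupp hmem).1
    filter_upwards [(isClosed_tsupport _).isOpen_compl.mem_nhds h1] with q hq
    exact image_eq_zero_of_notMem_tsupport (f := fun p : M × ℝ => η p.2 p.1) hq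
  have hdens : ∀ t ∈ J, EqOn (fun y => Real.sqrt (chartMetric (X t) e y).det *
      testIntegrand X ν G η t (e.symm y)) (fun y => Ψ (y, t)) e.target := fun t ht y hy => by
    have hy' : (y, t) ∈ e.target ×ˢ J := ⟨hy, ht⟩
    have h1 : SmoothFun.ev hy' h.alg.s = Real.sqrt (chartMetric (X t) e y).det := h.ev_s hy'
    have h2 := heq _ hy'
    simp only [hΨ]
    simp only at h2
    rw [SmoothFun.zeroExt_of_mem _ hy', h2, map_mul, h1]
    ring
  have hΨslice : ∀ t, Integrable fun y => Ψ (y, t) := fun t => by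
    refine (hΨc.1.comp (Continuous.prodMk_left t)).integrable_of_hasCompactSupport ?_
    refine HasCompactSupport.intro (hK.image continuous_fst) fun y hy => ?_
    have hyK : (y, t) ∉ K := fun hmem => hy ⟨_, hmem, rfl⟩
    by_cases hyS : (y, t) ∈ e.target ×ˢ J
    · simp only [hΨ, Function.comp_apply]
      rw [SmoothFun.zeroExt_of_mem _ hyS, hθK _ hyS hyK, mul_zero]
    · exact hΨ0 _ hyS
  have hint : ∀ t ∈ J, ∫ x, testIntegrand X ν G η t x ∂(areaMeasure (X t)) = ∫ y, Ψ (y, t) :=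
    fun t ht => by
      rw [integral_areaMeasure (hY t ht) (hρ t ht) (hcont t ht) (hzero t),
        setIntegral_congr_fun e.open_target.measurableSet (hdens t ht)]
      exact setIntegral_eq_integral_of_forall_compl_eq_zero fun y hy => hΨ0 _ fun hmem => hy hmem.1
  have hprod : Integrable Ψ ((volume : Measure (EuclideanSpace ℝ (Fin n))).prod volume) := hΨint
  refine ⟨fun t ht => ?_, ?_, ?_⟩
  · rw [integrable_areaMeasure_iff (hY t ht) (hρ t ht) (hcont t ht) (hzero t)]
    exact (hΨslice t).integrableOn.congr_fun (fun y hy => (hdens t ht hy).symm)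
      e.open_target.measurableSet
  · exact hprod.integral_prod_right.integrableOn.congr_fun (fun t ht => (hint t ht).symm)
      hJo.measurableSet
  · rw [setIntegral_congr_fun hJo.measurableSet hint,
      setIntegral_eq_integral_of_forall_compl_eq_zero fun t ht => by
        simp [hΨ0 _ fun hmem : (_, t) ∈ e.target ×ˢ J => ht hmem.2], ← integral_prod_symm _ hprod]
    exact hnonneg

variable [T2Space M] [SecondCountableTopology M]

/-- The weak inequality is linear in the test function, so a partition of unity on the projection of
its support to the manifold reduces it to test functions supported in the domain of a chart. -/
lemma weak_inequality
    (hη : ContMDiff ((𝓡 n).prod 𝓘(ℝ, ℝ)) 𝓘(ℝ, ℝ) ∞ (fun p : M × ℝ => η p.2 p.1))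
    (hc : HasCompactSupport (fun p : M × ℝ => η p.2 p.1))
    (hsupp : tsupport (fun p : M × ℝ => η p.2 p.1) ⊆ univ ×ˢ J) (hη0 : ∀ t x, 0 ≤ η t x) :
    (∀ t ∈ J, Integrable (testIntegrand X ν (fun t x => curvatureDist Γ (X t) (ν t) x) η t)
      (areaMeasure (X t))) ∧
    IntegrableOn (fun t => ∫ x, testIntegrand X ν (fun t x => curvatureDist Γ (X t) (ν t) x) η t x
      ∂(areaMeasure (X t))) J ∧
    0 ≤ ∫ t in J, ∫ x, testIntegrand X ν (fun t x => curvatureDist Γ (X t) (ν t) x) η t x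
      ∂(areaMeasure (X t)) := by
  set G : ℝ → M → ℝ := fun t x => curvatureDist Γ (X t) (ν t) x with hG
  have : LocallyCompactSpace M := ChartedSpace.locallyCompactSpace (EuclideanSpace ℝ (Fin n)) M
  set K := Prod.fst '' tsupport (fun p : M × ℝ => η p.2 p.1) with hKdef
  have hK : IsCompact K := IsCompact.image hc continuous_fst
  obtain ⟨T, hT⟩ := hK.elim_finite_subcover
    (fun x : M => (chartAt (EuclideanSpace ℝ (Fin n)) x).source)
    (fun x => (chartAt (EuclideanSpace ℝ (Fin n)) x).open_source)
    fun x _ => mem_iUnion.2 ⟨x, mem_chart_source _ x⟩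
  obtain ⟨χ, hχ⟩ := SmoothPartitionOfUnity.exists_isSubordinate (𝓡 n) hK.isClosed
    (fun k : T => (chartAt (EuclideanSpace ℝ (Fin n)) (k : M)).source)
    (fun k => (chartAt (EuclideanSpace ℝ (Fin n)) (k : M)).open_source) fun x hx => by
      obtain ⟨k, hk, hxk⟩ := mem_iUnion₂.1 (hT hx)
      exact mem_iUnion.2 ⟨⟨k, hk⟩, hxk⟩
  -- split the test function
  let ζ : T → ℝ → M → ℝ := fun k t x => χ k x * η t x
  have hζ : ∀ k, ContMDiff ((𝓡 n).prod 𝓘(ℝ, ℝ)) 𝓘(ℝ, ℝ) ∞ (fun p : M × ℝ => ζ k p.2 p.1) :=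
    fun k => ((χ k).contMDiff.comp contMDiff_fst).mul hη
  have hsum : η = fun t x => ∑ k, ζ k t x := by
    ext t x
    simp only [ζ, ← Finset.sum_mul]
    by_cases hx : x ∈ K
    · have := χ.sum_eq_one hx
      rw [finsum_eq_sum_of_fintype] at this
      rw [this, one_mul]
    · have : η t x = 0 := by
        have h1 : (x, t) ∉ tsupport (fun p : M × ℝ => η p.2 p.1) := fun hmem => hx ⟨_, hmem, rfl⟩
        exact image_eq_zero_of_notMem_tsupport (f := fun p : M × ℝ => η p.2 p.1) h1
      rw [this, mul_zero]
  have hpiece := fun k : T => weak_inequality_of_tsupport_subset hJ hJ' hJo hX hν hΓ (x₀ := k)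
    (hζ k) (hc.mul_left) (fun p hp => ⟨hχ k (tsupport_comp_subset_preimage (χ k) continuous_fst
      (tsupport_mul_subset_left hp)), (hsupp (tsupport_mul_subset_right hp)).2⟩)
    fun t x => mul_nonneg (χ.nonneg k x) (hη0 t x)
  have hF : ∀ t ∈ J, testIntegrand X ν G η t = fun x => ∑ k, testIntegrand X ν G (ζ k) t x :=
    fun t ht => by
      ext x
      conv_lhs => rw [hsum]
      exact testIntegrand_sum hJ hJ' hJo hX hν Finset.univ hζ ht x
  have hint : EqOn (fun t => ∫ x, testIntegrand X ν G η t x ∂(areaMeasure (X t)))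
      (fun t => ∑ k, ∫ x, testIntegrand X ν G (ζ k) t x ∂(areaMeasure (X t))) J := fun t ht => by
    simp only
    rw [hF t ht]
    exact integral_finsetSum _ fun k _ => (hpiece k).1 t ht
  refine ⟨fun t ht => ?_, ?_, ?_⟩
  · rw [hF t ht]
    exact integrable_finsetSum _ fun k _ => (hpiece k).1 t ht
  · have h1 : IntegrableOn
        (fun t => ∑ k, ∫ x, testIntegrand X ν G (ζ k) t x ∂(areaMeasure (X t))) J :=
      integrable_finsetSum _ fun k _ => (hpiece k).2.1
    exact h1.congr_fun (fun t ht => (hint ht).symm) hJo.measurableSet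
  · rw [setIntegral_congr_fun hJo.measurableSet hint,
      integral_finsetSum _ fun k _ => (hpiece k).2.1]
    exact Finset.sum_nonneg fun k _ => (hpiece k).2.2

end Distributional

theorem proposition2p2 {n : ℕ} {M : Type*} [TopologicalSpace M] [T2Space M]
    [SecondCountableTopology M] [ChartedSpace (EuclideanSpace ℝ (Fin n)) M]
    [IsManifold (𝓡 n) ∞ M] [MeasurableSpace M] [BorelSpace M]
    (I : Set ℝ) (hI : I.OrdConnected) (hI' : I.Nontrivial)
    (X ν : ℝ → M → EuclideanSpace ℝ (Fin (n + 1)))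
    (hX : IsMeanCurvatureFlow I X) (hν : IsUnitNormal I X ν)
    (Γ : Set (Matrix (Fin n) (Fin n) ℝ)) (hΓ : IsInvariantConvexCone Γ) :
    (∀ t ∈ I, ∀ x : M, (∃ f, IsOrthonormalFrame (X t) x f) ∧
      ∀ f, IsOrthonormalFrame (X t) x f →
        curvatureDist Γ (X t) (ν t) x = signedBdryDist Γ (weingartenMatrix (X t) (ν t) x f)) ∧
    IsViscositySupersolution I X (fun t x => normSqA (X t) (ν t) x)
      (fun t x => curvatureDist Γ (X t) (ν t) x) ∧
    IsDistributionalSupersolution I X ν (fun t x => normSqA (X t) (ν t) x)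
      (fun t x => curvatureDist Γ (X t) (ν t) x) := by
  refine ⟨fun t ht x => ⟨exists_isOrthonormalFrame hI hI' hX hν ht x, fun f hf =>
    curvatureDist_eq_signedBdryDist hI hI' hX hν hΓ ht x hf⟩,
    isViscositySupersolution_curvatureDist hI hI' hX hν hΓ, fun η hη hc hsupp hη0 => ?_⟩
  have hJ : (interior I).OrdConnected := hI.convex.interior.ordConnected
  have hJ' : (interior I).Nontrivial := by
    obtain ⟨t, ht⟩ := nonempty_interior_of_ordConnected hI hI'
    exact (infinite_of_mem_nhds t (isOpen_interior.mem_nhds ht)).nontrivial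
  exact weak_inequality hJ hJ' isOpen_interior (hX.mono hJ hJ' interior_subset)
    (hν.mono interior_subset) hΓ hη hc hsupp hη0
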